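/- **Theorem (High-probability bound for cross-validated residuals).** *Model.* Let $W=(X,Y)$ be a random element of $\mathbf R^p\times\mathcal Y$ with law $P$, let $m:\mathbf R\times\mathcal Y\to\mathbf R$ be a loss and $m_1'$ its derivative in the first argument, let $\Theta\subseteq\mathbf R^p$, and let $\theta_0\in\Theta$ minimize $M(\theta):=\mathrm E[m(X^\top\theta,Y)]$ over $\Theta$. Write $\mathcal E(\theta):=M(\theta)-M(\theta_0)$ for the excess risk and $s\ge1$ for the number of nonzero coordinates of $\theta_0$. Let $W_i=(X_i,Y_i)$, $i=1,\dots,n$, be independent copies of $W$, and write $\mathbb E_n$ for the sample average, $U_i:=m_1'(X_i^\top\theta_0,Y_i)$, $a\wedge b:=\min\{a,b\}$ and $a\vee b:=\max\{a,b\}$. Assume $n\ge3$, $p\ge2$. Fix $c_0>1$ and put $\bar c_0:=(c_0+1)/(c_0-1)$. *Assumptions.* All of the following constants are strictly positive, and $B_n\ge1$, $c_D\in(0,1)$, $a\in(0,1)$. 1. $\Theta$ is convex and $\theta_0$ is an interior point of $\Theta$. 2. $t\mapsto m(t,y)$ is convex for every $y\in\mathcal Y$. 3. For every $\theta\in\Theta$,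 $m_1'(X^\top\theta,Y)$ exists almost surely and $\mathrm E|m(X^\top\theta,Y)|<\infty$. 4. (Margin) $\mathcal E(\theta)\ge c_M\|\theta-\theta_0\|_2^2$ for all $\theta\in\Theta$ with $\|\theta-\theta_0\|_1\le c_M'$. 5. $\max_{i}\|X_i\|_\infty\le B_n$ with probability at least $1-\zeta_n$, and $\max_j\sum_{i=1}^nX_{ij}^4\le nC_X^4$ with probability at least $1-\zeta_n$. 6. There is a function $L\ge0$ with $\mathrm E[L(W)^8]\le(C_L/2)^8$ such that, for every value $w=(x,y)$ of $W$, $|m(x^\top\theta_0+t_1,y)-m(x^\top\theta_0+t_2,y)|\le L(w)|t_1-t_2|$ whenever $|t_1|\vee|t_2|\le c_L$; and $\mathrm E[\{m(X^\top\theta,Y)-m(X^\top\theta_0,Y)\}^2]\le C_L^2t^2$ for all $t\in[0,c_L]$ and $\theta\in\Theta$ with $\|\theta-\theta_0\|_2\le t$. 7. (Data partition) $\{1,\dots,n\}$ is partitioned into $I_1,\dots,I_K$, $K\ge2$, with $|I_k|\ge c_Dn$ for all $k$. 8. (Candidate penalties) $\Lambda_n=\{C_\Lambda a^\ell:\ a^\ell\ge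 c_\Lambda/n,\ \ell\in\{0,1,2,\dots\}\}$. 9. (Residual) For all $t\in\mathbf R$, $\ln\mathrm E[\exp(t\,m_1'(X^\top\theta_0,Y))\mid X]\le\sigma^2t^2/2$ almost surely; and for all $\theta\in\Theta$, $\mathrm E[\{m_1'(X^\top\theta,Y)-m_1'(X^\top\theta_0,Y)\}^2]\le C_{ms1}^2(\sqrt{\mathcal E(\theta)}\vee\mathcal E(\theta))$. 10. For all $\theta\in\Theta$, $\mathrm E[\{m(X^\top\theta,Y)-m(X^\top\theta_0,Y)\}^2]\le C_{ms}^2(\mathcal E(\theta)\vee\mathcal E(\theta)^2)$. *Cross-validation.* For each $k$ and $\lambda\in\Lambda_n$ let $\hat\theta_{I_k^c}(\lambda)$, a function of the observations $W_i$, $i\notin I_k$, only, almost surely minimize $|I_k^c|^{-1}\sum_{i\notin I_k}m(X_i^\top\theta,Y_i)+\lambda\|\theta\|_1$ over $\theta\in\Theta$; let the random variable $\hat\lambda^{cv}$ almost surely minimize $\sum_{k=1}^K\sum_{i\in I_k}m(X_i^\top\hat\theta_{I_k^c}(\lambda),Y_i)$ over $\lambda\in\Lambda_n$; and put $\hat U_i^{cv}:=m_1'(X_i^\top\hat\theta_{I_k^c}(\hat\lambda^{cv}),Y_i)$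 for $i\in I_k$, $k=1,\dots,K$. *Side conditions.* Put $C_\epsilon:=16\sqrt2(1+\bar c_0)C_LC_X$, $C_S:=\dfrac{2C_X\sigma}{(K-1)c_D}$, $$C_{\mathcal E}:=\sqrt{\tfrac2{c_M}}\Big(\tfrac{C_\epsilon}{(K-1)c_D}+\tfrac{(1+\bar c_0)c_0C_S}{a}\Big),\qquad \tilde u_0:=\tfrac2{c_M}\Big(\tfrac{C_\epsilon}{(K-1)c_D}+\tfrac{(1+\bar c_0)c_0C_S}{a}\Big)\sqrt{\tfrac{s\ln(pn)}n},$$ and suppose that $$s\ln(pn)\ge\frac{16(K-1)c_DC_L^2}{C_\epsilon^2},\qquad(1+\bar c_0)\tilde u_0\sqrt s\le\frac{c_L}{B_n}\wedge c_M',$$ $$\frac{\ln(pn)}n\le\Big(\frac{C_\Lambda a}{c_0C_S}\Big)^2,\qquad n\ln(pn)\ge\Big(\frac{C_\Lambda c_\Lambda}{c_0C_S}\Big)^2,\qquad n\ge\frac1{c_\Lambda\wedge a}.$$ *Conclusion.* For every $t>0$ satisfying $$\frac{48C_{ms}^2}{c_D^2\ln(1/a)}\frac{t\ln n}n+\frac{8C_{\mathcal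 E}^2}{c_D}\frac{s\ln(pn)}n\le1,$$ the bound $$\mathbb E_n\big[(\hat U_i^{cv}-U_i)^2\big]\le\frac{12C_{ms1}^2\,t\ln n}{\ln(1/a)}\Big(\frac{3C_{ms}^2}{c_D^2\ln(1/a)}\frac{t\ln n}n+\frac{C_{\mathcal E}^2}{2c_D}\frac{s\ln(pn)}n\Big)^{1/2}$$ holds with probability at least $1-K\Big(\dfrac5n+9\zeta_n+\dfrac1{(K-1)c_Dn}+\dfrac2t\Big)$. -/

import Mathlib

open MeasureTheory ProbabilityTheory

namespace CVResidual

noncomputable section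

/-- An observation `w = (x, y)`: a regressor vector `x ∈ ℝᵖ` and an outcome `y`. -/
abbrev Obs (p : ℕ) (𝒴 : Type*) : Type _ := (Fin p → ℝ) × 𝒴

/-- The `ℓ¹` norm on `ℝᵖ`. -/
def l1norm {p : ℕ} (θ : Fin p → ℝ) : ℝ := ∑ j, |θ j|

/-- The `ℓ²` norm on `ℝᵖ`. -/
def l2norm {p : ℕ} (θ : Fin p → ℝ) : ℝ := Real.sqrt (∑ j, θ j ^ 2)

/-- The number of nonzero coordinates of `θ`. -/
def sparsity {p : ℕ} (θ : Fin p → ℝ) : ℕ := (Finset.univ.filter fun j => θ j ≠ 0).card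

/-- The loss of the parameter `θ` at the observation `w = (x, y)`: `m (xᵀθ, y)`. -/
def lossAt {p : ℕ} {𝒴 : Type*} (m : ℝ → 𝒴 → ℝ) (θ : Fin p → ℝ) (w : Obs p 𝒴) : ℝ :=
  m (w.1 ⬝ᵥ θ) w.2

/-- The derivative of the loss in its first argument, at `(xᵀθ, y)`: `m₁' (xᵀθ, y)`. -/
def residualAt {p : ℕ} {𝒴 : Type*} (m : ℝ → 𝒴 → ℝ) (θ : Fin p → ℝ) (w : Obs p 𝒴) : ℝ :=
  deriv (fun t => m t w.2) (w.1 ⬝ᵥ θ)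

/-- The risk `M θ = E[m (Xᵀθ, Y)]`, where `P` is the law of `W = (X, Y)`. -/
def risk {p : ℕ} {𝒴 : Type*} [MeasurableSpace 𝒴] (P : Measure (Obs p 𝒴)) (m : ℝ → 𝒴 → ℝ)
    (θ : Fin p → ℝ) : ℝ :=
  ∫ w, lossAt m θ w ∂P

/-- The excess risk `ℰ θ = M θ - M θ₀`. -/
def excessRisk {p : ℕ} {𝒴 : Type*} [MeasurableSpace 𝒴] (P : Measure (Obs p 𝒴))
    (m : ℝ → 𝒴 → ℝ) (θ₀ θ : Fin p → ℝ) : ℝ :=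
  risk P m θ - risk P m θ₀

/-! ### Assumptions on the model -/

/-- The parameter space is convex with `θ₀` in its interior. -/
def ParameterSpace {p : ℕ} (Θ : Set (Fin p → ℝ)) (θ₀ : Fin p → ℝ) : Prop :=
  Convex ℝ Θ ∧ θ₀ ∈ interior Θ

/-- `θ₀` minimizes the risk over the parameter space. -/
def IsTarget {p : ℕ} {𝒴 : Type*} [MeasurableSpace 𝒴] (P : Measure (Obs p 𝒴))
    (m : ℝ → 𝒴 → ℝ) (Θ : Set (Fin p → ℝ)) (θ₀ : Fin p → ℝ) : Prop :=
  θ₀ ∈ Θ ∧ ∀ θ ∈ Θ, risk P m θ₀ ≤ risk P m θ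

/-- The loss is convex in its first argument. -/
def ConvexLoss {𝒴 : Type*} (m : ℝ → 𝒴 → ℝ) : Prop :=
  ∀ y, ConvexOn ℝ Set.univ (fun t => m t y)

/-- For every `θ ∈ Θ`, `m₁' (Xᵀθ, Y)` exists almost surely and `m (Xᵀθ, Y)` is integrable. -/
def DifferentiableIntegrable {p : ℕ} {𝒴 : Type*} [MeasurableSpace 𝒴] (P : Measure (Obs p 𝒴))
    (m : ℝ → 𝒴 → ℝ) (Θ : Set (Fin p → ℝ)) : Prop :=
  ∀ θ ∈ Θ, (∀ᵐ w ∂P, DifferentiableAt ℝ (fun t => m t w.2) (w.1 ⬝ᵥ θ)) ∧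
    Integrable (lossAt m θ) P

/-- The margin condition. -/
def Margin {p : ℕ} {𝒴 : Type*} [MeasurableSpace 𝒴] (P : Measure (Obs p 𝒴))
    (m : ℝ → 𝒴 → ℝ) (Θ : Set (Fin p → ℝ)) (θ₀ : Fin p → ℝ) (cM cM' : ℝ) : Prop :=
  0 < cM ∧ 0 < cM' ∧
    ∀ θ ∈ Θ, l1norm (θ - θ₀) ≤ cM' → cM * l2norm (θ - θ₀) ^ 2 ≤ excessRisk P m θ₀ θ

/-- `W` is a sample of `n` independent observations with common law `P`. -/
def IsSample {p n : ℕ} {𝒴 Ω : Type*} [MeasurableSpace 𝒴] [MeasurableSpace Ω] (μ : Measure Ω)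
    (P : Measure (Obs p 𝒴)) (W : Fin n → Ω → Obs p 𝒴) : Prop :=
  (∀ i, Measurable (W i)) ∧ iIndepFun W μ ∧ ∀ i, μ.map (W i) = P

/-- With probability at least `1 - ζ` all regressors are bounded by `B`, and with probability at
least `1 - ζ` the empirical fourth moments of all regressors are bounded by `CX ^ 4`. -/
def Covariates {p n : ℕ} {𝒴 Ω : Type*} [MeasurableSpace Ω] (μ : Measure Ω)
    (W : Fin n → Ω → Obs p 𝒴) (ζ B CX : ℝ) : Prop :=
  0 < ζ ∧ 1 ≤ B ∧ 0 < CX ∧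
    1 - ζ ≤ μ.real {ω | ∀ i j, |(W i ω).1 j| ≤ B} ∧
    1 - ζ ≤ μ.real {ω | ∀ j, ∑ i, (W i ω).1 j ^ 4 ≤ n * CX ^ 4}

/-- Local loss behaviour: local Lipschitz continuity around the true index, with a Lipschitz
constant having a bounded eighth moment, and mean-square continuity at `θ₀`. The Lipschitz bound
is required for almost every value of `W`. -/
def LocalLoss {p : ℕ} {𝒴 : Type*} [MeasurableSpace 𝒴] (P : Measure (Obs p 𝒴))
    (m : ℝ → 𝒴 → ℝ) (Θ : Set (Fin p → ℝ)) (θ₀ : Fin p → ℝ) (cL CL : ℝ) : Prop :=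
  0 < cL ∧ 0 < CL ∧
    (∃ L : Obs p 𝒴 → ℝ, Measurable L ∧ (∀ w, 0 ≤ L w) ∧
      (∀ᵐ w ∂P, ∀ t₁ t₂ : ℝ, max |t₁| |t₂| ≤ cL →
        |m (w.1 ⬝ᵥ θ₀ + t₁) w.2 - m (w.1 ⬝ᵥ θ₀ + t₂) w.2| ≤ L w * |t₁ - t₂|) ∧
      ∫⁻ w, ENNReal.ofReal (L w ^ 8) ∂P ≤ ENNReal.ofReal ((CL / 2) ^ 8)) ∧
    ∀ t ∈ Set.Icc 0 cL, ∀ θ ∈ Θ, l2norm (θ - θ₀) ≤ t →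
      ∫⁻ w, ENNReal.ofReal ((lossAt m θ w - lossAt m θ₀ w) ^ 2) ∂P
        ≤ ENNReal.ofReal (CL ^ 2 * t ^ 2)

/-- The residual is sub-Gaussian conditionally on `X`, and the loss derivative is mean-square
continuous in the excess risk. -/
def ResidualCV {p : ℕ} {𝒴 : Type*} [MeasurableSpace 𝒴] (P : Measure (Obs p 𝒴))
    (m : ℝ → 𝒴 → ℝ) (Θ : Set (Fin p → ℝ)) (θ₀ : Fin p → ℝ) (σ Cms1 : ℝ) : Prop :=
  0 < σ ∧ 0 < Cms1 ∧
    (∀ t : ℝ, Integrable (fun w => Real.exp (t * residualAt m θ₀ w)) P ∧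
      ∀ᵐ w ∂P, Real.log ((P[fun w' => Real.exp (t * residualAt m θ₀ w') |
          MeasurableSpace.comap Prod.fst inferInstance]) w) ≤ σ ^ 2 * t ^ 2 / 2) ∧
    ∀ θ ∈ Θ, ∫⁻ w, ENNReal.ofReal ((residualAt m θ w - residualAt m θ₀ w) ^ 2) ∂P
      ≤ ENNReal.ofReal
          (Cms1 ^ 2 * max (Real.sqrt (excessRisk P m θ₀ θ)) (excessRisk P m θ₀ θ))

/-- Global loss behaviour: the loss is mean-square continuous in the excess risk. -/
def GlobalLoss {p : ℕ} {𝒴 : Type*} [MeasurableSpace 𝒴] (P : Measure (Obs p 𝒴))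
    (m : ℝ → 𝒴 → ℝ) (Θ : Set (Fin p → ℝ)) (θ₀ : Fin p → ℝ) (Cms : ℝ) : Prop :=
  0 < Cms ∧ ∀ θ ∈ Θ, ∫⁻ w, ENNReal.ofReal ((lossAt m θ w - lossAt m θ₀ w) ^ 2) ∂P
    ≤ ENNReal.ofReal (Cms ^ 2 * max (excessRisk P m θ₀ θ) (excessRisk P m θ₀ θ ^ 2))

/-! ### Cross-validation

A partition of the sample indices into `I₁, …, I_K` is given by the map `fold` that sends an index
to the label of its cell, so that `I_k = {i | fold i = k}`. -/

/-- The indices outside the cell `I_k`. -/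
abbrev Outside {n K : ℕ} (fold : Fin n → Fin K) (k : Fin K) : Type := {i : Fin n // fold i ≠ k}

/-- Every cell of the partition contains at least `cD * n` indices. -/
def DataPartition {n K : ℕ} (fold : Fin n → Fin K) (cD : ℝ) : Prop :=
  2 ≤ K ∧ 0 < cD ∧ cD < 1 ∧
    ∀ k, cD * n ≤ ((Finset.univ.filter fun i => fold i = k).card : ℝ)

/-- The candidate penalties `C_Λ a^ℓ`, `ℓ = 0, 1, 2, …`, with `a^ℓ ≥ c_Λ / n`. -/
def candidatePenalties (n : ℕ) (cΛ CΛ a : ℝ) : Set ℝ :=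
  {l | ∃ ℓ : ℕ, cΛ / n ≤ a ^ ℓ ∧ l = CΛ * a ^ ℓ}

/-- The average loss of `θ` over a finite family `d` of observations. -/
def empRisk {p : ℕ} {𝒴 ι : Type*} [Fintype ι] (m : ℝ → 𝒴 → ℝ) (d : ι → Obs p 𝒴)
    (θ : Fin p → ℝ) : ℝ :=
  (Fintype.card ι : ℝ)⁻¹ * ∑ i, lossAt m θ (d i)

/-- `θ` solves the `ℓ¹`-penalized problem over `Θ` with data `d` and penalty level `l`. -/
def IsPenalizedMinimizer {p : ℕ} {𝒴 ι : Type*} [Fintype ι] (m : ℝ → 𝒴 → ℝ)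
    (Θ : Set (Fin p → ℝ)) (d : ι → Obs p 𝒴) (l : ℝ) (θ : Fin p → ℝ) : Prop :=
  θ ∈ Θ ∧ ∀ θ' ∈ Θ, empRisk m d θ + l * l1norm θ ≤ empRisk m d θ' + l * l1norm θ'

/-- The type of families of subsample estimators: for a held-out cell `k` and a penalty `l`, a
function of the observations outside `I_k` only. -/
abbrev SubsampleEstimator {n K : ℕ} (fold : Fin n → Fin K) (p : ℕ) (𝒴 : Type*) : Type _ :=
  ∀ k : Fin K, ℝ → (Outside fold k → Obs p 𝒴) → (Fin p → ℝ)

/-- The subsample estimate `θ̂_{I_kᶜ}(l)` computed from the full data set `d`. -/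
def subsampleEstimate {n K p : ℕ} {𝒴 : Type*} {fold : Fin n → Fin K}
    (est : SubsampleEstimator fold p 𝒴) (d : Fin n → Obs p 𝒴) (k : Fin K) (l : ℝ) :
    Fin p → ℝ :=
  est k l (fun i => d i.1)

/-- `est` is a family of (measurable) `ℓ¹`-penalized M-estimators: for every held-out cell and
every penalty in `Λ`, it almost surely solves the penalized problem on the remaining
observations. -/
def IsSubsampleMEstimator {n K p : ℕ} {𝒴 Ω : Type*} [MeasurableSpace 𝒴] [MeasurableSpace Ω]
    (μ : Measure Ω) (W : Fin n → Ω → Obs p 𝒴) (m : ℝ → 𝒴 → ℝ) (Θ : Set (Fin p → ℝ))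
    (Λ : Set ℝ) {fold : Fin n → Fin K} (est : SubsampleEstimator fold p 𝒴) : Prop :=
  ∀ k, ∀ l ∈ Λ, Measurable (est k l) ∧
    ∀ᵐ ω ∂μ, IsPenalizedMinimizer m Θ (fun i : Outside fold k => W i.1 ω) l
      (subsampleEstimate est (fun i => W i ω) k l)

/-- The out-of-sample loss `∑ₖ ∑_{i ∈ I_k} m (X_iᵀ θ̂_{I_kᶜ}(l), Y_i)`. -/
def cvCriterion {n K p : ℕ} {𝒴 : Type*} {fold : Fin n → Fin K} (m : ℝ → 𝒴 → ℝ)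
    (est : SubsampleEstimator fold p 𝒴) (d : Fin n → Obs p 𝒴) (l : ℝ) : ℝ :=
  ∑ k, ∑ i ∈ Finset.univ.filter (fun i => fold i = k),
    lossAt m (subsampleEstimate est d k l) (d i)

/-- `lcv` is a cross-validated penalty: a random variable that almost surely minimizes the
out-of-sample loss over `Λ`. -/
def IsCVPenalty {n K p : ℕ} {𝒴 Ω : Type*} [MeasurableSpace Ω]
    (μ : Measure Ω) (W : Fin n → Ω → Obs p 𝒴) (m : ℝ → 𝒴 → ℝ)
    (Λ : Set ℝ) {fold : Fin n → Fin K} (est : SubsampleEstimator fold p 𝒴)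
    (lcv : Ω → ℝ) : Prop :=
  Measurable lcv ∧ ∀ᵐ ω ∂μ, lcv ω ∈ Λ ∧
    ∀ l ∈ Λ, cvCriterion m est (fun i => W i ω) (lcv ω) ≤ cvCriterion m est (fun i => W i ω) l

/-- The CV residual estimate `Û_i = m₁' (X_iᵀ θ̂_{I_kᶜ}(l), Y_i)` for `i ∈ I_k`, at penalty `l`. -/
def cvResidual {n K p : ℕ} {𝒴 : Type*} {fold : Fin n → Fin K} (m : ℝ → 𝒴 → ℝ)
    (est : SubsampleEstimator fold p 𝒴) (d : Fin n → Obs p 𝒴) (l : ℝ) (i : Fin n) : ℝ :=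
  residualAt m (subsampleEstimate est d (fold i) l) (d i)

/-! ### Constants -/

/-- `c̄₀ = (c₀ + 1) / (c₀ - 1)`. -/
def cbar (c₀ : ℝ) : ℝ := (c₀ + 1) / (c₀ - 1)

/-- `C_ε = 16 √2 (1 + c̄₀) C_L C_X`. -/
def Ceps (c₀ CL CX : ℝ) : ℝ := 16 * Real.sqrt 2 * (1 + cbar c₀) * CL * CX

/-- `C_S = 2 C_X σ / ((K - 1) c_D)`. -/
def CS (K : ℕ) (cD CX σ : ℝ) : ℝ := 2 * CX * σ / (((K : ℝ) - 1) * cD)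

/-- `C_ε / ((K - 1) c_D) + (1 + c̄₀) c₀ C_S / a`, the factor common to `C_ℰ` and `ũ₀`. -/
def Cfactor (K : ℕ) (c₀ CL CX cD σ a : ℝ) : ℝ :=
  Ceps c₀ CL CX / (((K : ℝ) - 1) * cD) + (1 + cbar c₀) * c₀ * CS K cD CX σ / a

/-- `C_ℰ = √(2 / c_M) (C_ε / ((K - 1) c_D) + (1 + c̄₀) c₀ C_S / a)`. -/
def Crisk (K : ℕ) (c₀ cM CL CX cD σ a : ℝ) : ℝ :=
  Real.sqrt (2 / cM) * Cfactor K c₀ CL CX cD σ a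

/-- `ũ₀ = (2 / c_M) (C_ε / ((K - 1) c_D) + (1 + c̄₀) c₀ C_S / a) √(s ln(pn) / n)`. -/
def utilde (n p s K : ℕ) (c₀ cM CL CX cD σ a : ℝ) : ℝ :=
  2 / cM * Cfactor K c₀ CL CX cD σ a * Real.sqrt (s * Real.log (p * n) / n)

end

end CVResidual

open CVResidual

/-!
The proof combines an oracle bound for each subsample with a comparison of held-out losses.

*Oracle bound.* Fix a cell and let `l` be the candidate penalty within a factor `a` of
`c₀ C_S √(ln(pn) / n)`. On an event of large probability `l` exceeds `c₀` times the maximum norm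
of the score, and the empirical risk increments are uniformly close to their means over the part
`‖θ - θ₀‖₁ ≤ r`, `‖θ - θ₀‖₂ ≤ ũ₀` of the parameter space. The score is controlled conditionally on
the regressors, by a self-normalized exponential inequality
(`CVResidual.measure_exists_score_gt_le`). The increments are controlled by symmetrization
(`CVResidual.measure_exists_sum_sub_gt_le`) followed by the contraction principle for Rademacher
averages with observation-wise Lipschitz constants (`CVResidual.card_signs_exceeding_le`). On this
event the argument is deterministic (`CVResidual.excessRisk_le_of_isPenalizedMinimizer`): convexity
of the loss puts the estimation error into the cone in which the `ℓ¹` norm is at most `(1 + c̄₀) √s`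
times the `ℓ²` norm, the error is shrunk to `ℓ²` norm at most `ũ₀`, and the margin condition shows
both that no shrinking was needed and that the excess risk is at most `C_ℰ² s ln(pn) / n`. As the
event does not depend on the estimator, `CVResidual.measure_not_oracle_bound_le` bounds all
penalized minimizers at once.

*Held-out data.* Given the observations outside a cell, each subsample estimate is a fixed
parameter, so that Chebyshev's inequality for the loss increments and Markov's inequality for the
squared residual increments apply on the cell (`CVResidual.prod_heldOutFailure_le`). There are at
most `3 ln n / ln(1/a)` candidate penalties, and failure at one of them has probability of order
`ln(1/a) / (t ln n)`; this produces the term `2 / t`.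

*Comparison.* The cross-validated penalty has an out-of-sample loss no larger than that of the
oracle penalty. Writing `e_k` for the excess risk in cell `k` at the cross-validated penalty and
`w_k` for the share of the cell, this gives `∑ w_k e_k ≤ E + D (∑ w_k (√e_k ∨ e_k) + √E ∨ E)`, where
`E` is the oracle bound and `D` is of order `√(t ln n / n)`. The smallness condition on `t` allows
the right-hand side to be absorbed (`CVResidual.sum_weight_mul_max_le`), and the bound on
`∑ w_k (√e_k ∨ e_k)` obtained in this way is the one for the residuals.
-/

namespace CVResidual

/-! ### Measurability of losses, residuals and risks -/

/-- One-sided derivatives of a convex function exist, and are limits of difference quotients along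
`1 / n`; the two-sided derivative is determined by comparing them. -/
lemma measurable_deriv_of_convexLoss {𝒴 : Type*} [MeasurableSpace 𝒴] {m : ℝ → 𝒴 → ℝ}
    (hm : Measurable (Function.uncurry m)) (hconvex : ConvexLoss m) :
    Measurable fun z : ℝ × 𝒴 => deriv (fun t => m t z.2) z.1 := by
  have key : ∀ z : ℝ × 𝒴,
      HasDerivWithinAt (fun t => m t z.2) (derivWithin (fun t => m t z.2) (Set.Ioi z.1) z.1)
        (Set.Ioi z.1) z.1 ∧
      HasDerivWithinAt (fun t => m t z.2) (derivWithin (fun t => m t z.2) (Set.Iio z.1) z.1)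
        (Set.Iio z.1) z.1 := fun z =>
    ⟨((hconvex z.2).differentiableWithinAt_Ioi_of_mem_interior (by simp)).hasDerivWithinAt,
      ((hconvex z.2).differentiableWithinAt_Iio_of_mem_interior (by simp)).hasDerivWithinAt⟩
  have hmz : ∀ c : ℝ, Measurable fun z : ℝ × 𝒴 => m (z.1 + c) z.2 := fun c =>
    hm.comp ((measurable_fst.add_const c).prodMk measurable_snd)
  have hstep : ∀ c : ℝ, c ≠ 0 → Measurable fun z : ℝ × 𝒴 =>
      slope (fun t => m t z.2) z.1 (z.1 + c) := by
    intro c hc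
    simp only [slope_def_field, add_sub_cancel_left]
    have h0 := hmz 0
    simp only [add_zero] at h0
    exact ((hmz c).sub h0).div_const _
  have hR : Measurable fun z : ℝ × 𝒴 => derivWithin (fun t => m t z.2) (Set.Ioi z.1) z.1 := by
    refine measurable_of_tendsto_metrizable
      (f := fun (n : ℕ) (z : ℝ × 𝒴) => slope (fun t => m t z.2) z.1 (z.1 + 1 / ((n : ℝ) + 1)))
      (fun n => hstep _ (by positivity)) ?_
    rw [tendsto_pi_nhds]
    intro z
    have h1 := (hasDerivWithinAt_iff_tendsto_slope' (by simp)).1 (key z).1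
    refine h1.comp (tendsto_nhdsWithin_iff.2 ⟨?_, Filter.Eventually.of_forall fun n => ?_⟩)
    · simpa using tendsto_const_nhds.add (tendsto_one_div_add_atTop_nhds_zero_nat (𝕜 := ℝ))
    · simp only [Set.mem_Ioi, lt_add_iff_pos_right]; positivity
  have hL : Measurable fun z : ℝ × 𝒴 => derivWithin (fun t => m t z.2) (Set.Iio z.1) z.1 := by
    refine measurable_of_tendsto_metrizable
      (f := fun (n : ℕ) (z : ℝ × 𝒴) => slope (fun t => m t z.2) z.1 (z.1 + -(1 / ((n : ℝ) + 1))))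
      (fun n => hstep _ (neg_ne_zero.2 (by positivity))) ?_
    rw [tendsto_pi_nhds]
    intro z
    have h1 := (hasDerivWithinAt_iff_tendsto_slope' (by simp)).1 (key z).2
    refine h1.comp (tendsto_nhdsWithin_iff.2 ⟨?_, Filter.Eventually.of_forall fun n => ?_⟩)
    · simpa using tendsto_const_nhds.add (tendsto_one_div_add_atTop_nhds_zero_nat (𝕜 := ℝ)).neg
    · simp only [Set.mem_Iio, add_lt_iff_neg_left, neg_lt_zero]; positivity
  have heq : (fun z : ℝ × 𝒴 => deriv (fun t => m t z.2) z.1) =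
      fun z => if derivWithin (fun t => m t z.2) (Set.Ioi z.1) z.1 =
          derivWithin (fun t => m t z.2) (Set.Iio z.1) z.1
        then derivWithin (fun t => m t z.2) (Set.Ioi z.1) z.1 else 0 := by
    funext z
    split_ifs with h
    · have h2 := (key z).2
      rw [← h] at h2
      have h3 := (hasDerivWithinAt_Iio_iff_Iic.1 h2).union
        (hasDerivWithinAt_Ioi_iff_Ici.1 (key z).1)
      rw [Set.Iic_union_Ici, hasDerivWithinAt_univ] at h3
      exact h3.deriv
    · refine deriv_zero_of_not_differentiableAt fun hd => h ?_
      rw [hd.derivWithin (uniqueDiffWithinAt_Ioi _), hd.derivWithin (uniqueDiffWithinAt_Iio _)]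
  rw [heq]
  exact Measurable.ite (measurableSet_eq_fun hR hL) hR measurable_const

section
variable {p : ℕ} {𝒴 : Type*} [MeasurableSpace 𝒴] {m : ℝ → 𝒴 → ℝ}

lemma measurable_index :
    Measurable fun z : (Fin p → ℝ) × Obs p 𝒴 => (z.2.1 ⬝ᵥ z.1, z.2.2) := by
  refine Measurable.prodMk ?_ (measurable_snd.comp measurable_snd)
  unfold dotProduct
  fun_prop

lemma measurable_lossAt_uncurry (hm : Measurable (Function.uncurry m)) :
    Measurable fun z : (Fin p → ℝ) × Obs p 𝒴 => lossAt m z.1 z.2 :=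
  hm.comp measurable_index

lemma measurable_residualAt_uncurry (hm : Measurable (Function.uncurry m))
    (hconvex : ConvexLoss m) :
    Measurable fun z : (Fin p → ℝ) × Obs p 𝒴 => residualAt m z.1 z.2 :=
  (measurable_deriv_of_convexLoss hm hconvex).comp measurable_index

lemma measurable_lossAt (hm : Measurable (Function.uncurry m)) (θ : Fin p → ℝ) :
    Measurable (lossAt m θ) :=
  (measurable_lossAt_uncurry hm).comp measurable_prodMk_left

lemma measurable_residualAt (hm : Measurable (Function.uncurry m))
    (hconvex : ConvexLoss m) (θ : Fin p → ℝ) : Measurable (residualAt m θ) :=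
  (measurable_residualAt_uncurry hm hconvex).comp measurable_prodMk_left

lemma measurable_risk (hm : Measurable (Function.uncurry m)) (P : Measure (Obs p 𝒴))
    [IsProbabilityMeasure P] : Measurable (risk P m) :=
  (measurable_lossAt_uncurry hm).stronglyMeasurable.integral_prod_right'.measurable

lemma measurable_excessRisk (hm : Measurable (Function.uncurry m)) (P : Measure (Obs p 𝒴))
    [IsProbabilityMeasure P] (θ₀ : Fin p → ℝ) : Measurable (excessRisk P m θ₀) :=
  (measurable_risk hm P).sub_const _

end

section
variable {p : ℕ} {𝒴 : Type*} {m : ℝ → 𝒴 → ℝ}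

lemma continuous_lossAt (hconvex : ConvexLoss m) (w : Obs p 𝒴) :
    Continuous fun θ => lossAt m θ w := by
  refine (continuousOn_univ.1 ((hconvex w.2).continuousOn isOpen_univ)).comp ?_
  unfold dotProduct
  fun_prop

/-- A convex function lies above its tangent. -/
lemma lossAt_add_residualAt_mul_le (hconvex : ConvexLoss m) {w : Obs p 𝒴} {θ₀ : Fin p → ℝ}
    (hd : DifferentiableAt ℝ (fun t => m t w.2) (w.1 ⬝ᵥ θ₀)) (θ : Fin p → ℝ) :
    lossAt m θ₀ w + residualAt m θ₀ w * (w.1 ⬝ᵥ (θ - θ₀)) ≤ lossAt m θ w := by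
  rw [dotProduct_sub]
  unfold lossAt residualAt
  rcases lt_trichotomy (w.1 ⬝ᵥ θ₀) (w.1 ⬝ᵥ θ) with h | h | h
  · have := (hconvex w.2).deriv_le_slope (Set.mem_univ _) (Set.mem_univ _) h hd
    rw [slope_def_field, le_div_iff₀ (sub_pos.2 h)] at this
    linarith
  · rw [h]; simp
  · have := (hconvex w.2).slope_le_deriv (Set.mem_univ _) (Set.mem_univ _) h hd
    rw [slope_def_field, div_le_iff₀ (sub_pos.2 h)] at this
    linarith

end

/-! ### Rademacher averages: contraction and a maximal inequality -/

/-- Two points that are weakly majorized by two others have the smaller sum of exponentials. -/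
lemma exp_add_exp_le_of_weakly_majorized {a b A B : ℝ} (hab : a + b ≤ A + B) (ha : a ≤ max A B)
    (hb : b ≤ max A B) : Real.exp a + Real.exp b ≤ Real.exp A + Real.exp B := by
  wlog hAB : B ≤ A generalizing A B
  · rw [add_comm (Real.exp A)]
    exact this (by linarith) (by rwa [max_comm]) (by rwa [max_comm]) (le_of_not_ge hAB)
  wlog hle : b ≤ a generalizing a b
  · rw [add_comm (Real.exp a)]
    exact this (by linarith) hb ha (le_of_not_ge hle)
  rw [max_eq_left hAB] at ha hb
  rcases le_total b B with h | h
  · exact add_le_add (Real.exp_le_exp.2 ha) (Real.exp_le_exp.2 h)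
  · have h1 : Real.exp a ≤ Real.exp (A + B - b) := Real.exp_le_exp.2 (by linarith)
    have h2 : Real.exp (A + B - b) = Real.exp A * Real.exp (B - b) := by
      rw [← Real.exp_add]; ring_nf
    have h3 : Real.exp B = Real.exp b * Real.exp (B - b) := by
      rw [← Real.exp_add]; ring_nf
    have h4 : Real.exp (B - b) ≤ 1 := Real.exp_le_one_iff.2 (by linarith)
    have h5 : Real.exp b ≤ Real.exp A := Real.exp_le_exp.2 (by linarith)
    rw [h3]
    nlinarith

section
variable {T : Type*} {D : Finset T} (hD : D.Nonempty)

/-- Replacing a symmetric perturbation `± φ` by a larger one `± ψ` increases the average of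
`exp (sup (h ± φ))`. -/
lemma exp_sup'_add_exp_sup'_le {h φ ψ : T → ℝ}
    (hdiff : ∀ t ∈ D, ∀ t' ∈ D, |φ t - φ t'| ≤ |ψ t - ψ t'|) (habs : ∀ t ∈ D, |φ t| ≤ |ψ t|) :
    Real.exp (D.sup' hD fun t => h t + φ t) + Real.exp (D.sup' hD fun t => h t - φ t) ≤
      Real.exp (D.sup' hD fun t => h t + ψ t) + Real.exp (D.sup' hD fun t => h t - ψ t) := by
  obtain ⟨t₁, ht₁, h₁⟩ := D.exists_mem_eq_sup' hD fun t => h t + φ t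
  obtain ⟨t₂, ht₂, h₂⟩ := D.exists_mem_eq_sup' hD fun t => h t - φ t
  have hA : ∀ t ∈ D, h t + ψ t ≤ D.sup' hD fun t => h t + ψ t := fun t ht =>
    D.le_sup' (fun t => h t + ψ t) ht
  have hB : ∀ t ∈ D, h t - ψ t ≤ D.sup' hD fun t => h t - ψ t := fun t ht =>
    D.le_sup' (fun t => h t - ψ t) ht
  have hmax : ∀ t ∈ D, h t + |φ t| ≤
      max (D.sup' hD fun t => h t + ψ t) (D.sup' hD fun t => h t - ψ t) := by
    intro t ht
    have h3 := habs t ht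
    rcases abs_cases (ψ t) with h4 | h4
    · exact le_max_of_le_left ((by linarith : _ ≤ h t + ψ t).trans (hA t ht))
    · exact le_max_of_le_right ((by linarith : _ ≤ h t - ψ t).trans (hB t ht))
  rw [h₁, h₂]
  refine exp_add_exp_le_of_weakly_majorized ?_ ?_ ?_
  · have h3 := hdiff t₁ ht₁ t₂ ht₂
    have h4 := le_abs_self (φ t₁ - φ t₂)
    rcases abs_cases (ψ t₁ - ψ t₂) with h5 | h5
    · linarith [hA t₁ ht₁, hB t₂ ht₂]
    · linarith [hA t₂ ht₂, hB t₁ ht₁]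
  · linarith [hmax t₁ ht₁, le_abs_self (φ t₁)]
  · linarith [hmax t₂ ht₂, neg_le_abs (φ t₂)]

variable {ι : Type*} [Fintype ι] [DecidableEq ι]

/-- One step of the contraction principle: the sums over `ε` and over `ε` with its `j`-th sign
reversed agree, so that averaging the two isolates the `j`-th coordinate as a symmetric
perturbation. -/
lemma sum_signs_contraction_single (χ : ι → T → ℝ) (j : ι) (ψ : T → ℝ)
    (hdiff : ∀ t ∈ D, ∀ t' ∈ D, |χ j t - χ j t'| ≤ |ψ t - ψ t'|)
    (habs : ∀ t ∈ D, |χ j t| ≤ |ψ t|) :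
    ∑ ε : ι → ℤˣ, Real.exp (D.sup' hD fun t => ∑ i, ((ε i : ℤ) : ℝ) * χ i t) ≤
      ∑ ε : ι → ℤˣ, Real.exp (D.sup' hD fun t =>
        ∑ i, ((ε i : ℤ) : ℝ) * Function.update χ j ψ i t) := by
  obtain ⟨g, hg, hgj⟩ : ∃ g : (ι → ℤˣ) ≃ (ι → ℤˣ),
      (∀ ε i, i ≠ j → g ε i = ε i) ∧ ∀ ε, g ε j = -ε j := by
    refine ⟨Equiv.mulLeft (Pi.mulSingle j (-1)), fun ε i hi => ?_, fun ε => ?_⟩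
    · simp [Pi.mulSingle_eq_of_ne hi]
    · simp
  have hflip : ∀ F : (ι → ℤˣ) → ℝ, 2 * ∑ ε, F ε = ∑ ε, (F ε + F (g ε)) := by
    intro F
    rw [Finset.sum_add_distrib, two_mul, Equiv.sum_comp g F]
  have hsplit : ∀ (ε : ι → ℤˣ) (ξ : ι → T → ℝ) (t : T),
      ∑ i, ((ε i : ℤ) : ℝ) * ξ i t =
        ∑ i ∈ Finset.univ.erase j, ((ε i : ℤ) : ℝ) * ξ i t + ((ε j : ℤ) : ℝ) * ξ j t := fun ε ξ t =>
    (Finset.sum_erase_add _ _ (Finset.mem_univ j)).symm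
  have hrest : ∀ (ε : ι → ℤˣ) (ξ : ι → T → ℝ) (t : T),
      ∑ i ∈ Finset.univ.erase j, ((g ε i : ℤ) : ℝ) * ξ i t =
        ∑ i ∈ Finset.univ.erase j, ((ε i : ℤ) : ℝ) * ξ i t := fun ε ξ t =>
    Finset.sum_congr rfl fun i hi => by rw [hg _ _ (Finset.ne_of_mem_erase hi)]
  have hrest' : ∀ (ε : ι → ℤˣ) (t : T),
      ∑ i ∈ Finset.univ.erase j, ((ε i : ℤ) : ℝ) * Function.update χ j ψ i t =
        ∑ i ∈ Finset.univ.erase j, ((ε i : ℤ) : ℝ) * χ i t := fun ε t =>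
    Finset.sum_congr rfl fun i hi => by
      rw [Function.update_of_ne (Finset.ne_of_mem_erase hi)]
  refine le_of_mul_le_mul_left (a := 2) ?_ two_pos
  rw [hflip, hflip]
  refine Finset.sum_le_sum fun ε _ => ?_
  have hstep := exp_sup'_add_exp_sup'_le hD
    (h := fun t => ∑ i ∈ Finset.univ.erase j, ((ε i : ℤ) : ℝ) * χ i t) hdiff habs
  simp only [hsplit, hrest, hrest', hgj, Function.update_self]
  rcases Int.units_eq_one_or (ε j) with h | h
  · simp only [h, Units.val_neg, Units.val_one, Int.cast_neg, Int.cast_one, one_mul, neg_mul,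
      ← sub_eq_add_neg]
    exact hstep
  · simp only [h, neg_neg, Units.val_neg, Units.val_one, Int.cast_neg, Int.cast_one, one_mul,
      neg_mul, ← sub_eq_add_neg]
    linarith [hstep]

/-- The Ledoux–Talagrand contraction principle for exponential moments of Rademacher averages. -/
lemma sum_signs_contraction (φ ψ : ι → T → ℝ)
    (hdiff : ∀ i, ∀ t ∈ D, ∀ t' ∈ D, |φ i t - φ i t'| ≤ |ψ i t - ψ i t'|)
    (habs : ∀ i, ∀ t ∈ D, |φ i t| ≤ |ψ i t|) :
    ∑ ε : ι → ℤˣ, Real.exp (D.sup' hD fun t => ∑ i, ((ε i : ℤ) : ℝ) * φ i t) ≤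
      ∑ ε : ι → ℤˣ, Real.exp (D.sup' hD fun t => ∑ i, ((ε i : ℤ) : ℝ) * ψ i t) := by
  have key : ∀ s : Finset ι,
      ∑ ε : ι → ℤˣ, Real.exp (D.sup' hD fun t => ∑ i, ((ε i : ℤ) : ℝ) * φ i t) ≤
      ∑ ε : ι → ℤˣ, Real.exp (D.sup' hD fun t => ∑ i, ((ε i : ℤ) : ℝ) * s.piecewise ψ φ i t) := by
    intro s
    induction s using Finset.induction_on with
    | empty => simp
    | insert j s hj ih =>
      refine ih.trans ?_
      rw [Finset.piecewise_insert]
      refine sum_signs_contraction_single hD _ j (ψ j) ?_ ?_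
      · rw [Finset.piecewise_eq_of_notMem _ _ _ hj]; exact hdiff j
      · rw [Finset.piecewise_eq_of_notMem _ _ _ hj]; exact habs j
  simpa using key Finset.univ

/-- Rademacher sums are sub-Gaussian. -/
lemma sum_signs_exp_le (c : ι → ℝ) :
    ∑ ε : ι → ℤˣ, Real.exp (∑ i, ((ε i : ℤ) : ℝ) * c i) ≤
      2 ^ Fintype.card ι * Real.exp ((∑ i, c i ^ 2) / 2) := by
  have h1 : ∑ ε : ι → ℤˣ, Real.exp (∑ i, ((ε i : ℤ) : ℝ) * c i) =
      ∏ i, ∑ e : ℤˣ, Real.exp (((e : ℤ) : ℝ) * c i) := by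
    rw [Finset.prod_univ_sum, Fintype.piFinset_univ]
    exact Finset.sum_congr rfl fun ε _ => Real.exp_sum _ _
  have h2 : ∀ i, ∑ e : ℤˣ, Real.exp (((e : ℤ) : ℝ) * c i) = 2 * Real.cosh (c i) := by
    intro i
    have : (Finset.univ : Finset ℤˣ) = {1, -1} := rfl
    rw [this, Finset.sum_pair (by decide), Real.cosh_eq]
    simp only [Units.val_one, Int.cast_one, one_mul, Units.val_neg, Int.cast_neg, neg_mul]
    ring
  rw [h1]
  calc ∏ i, ∑ e : ℤˣ, Real.exp (((e : ℤ) : ℝ) * c i)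
      ≤ ∏ i, 2 * Real.exp (c i ^ 2 / 2) := by
        refine Finset.prod_le_prod (fun i _ => Finset.sum_nonneg fun e _ => (Real.exp_pos _).le)
          fun i _ => ?_
        rw [h2]
        exact mul_le_mul_of_nonneg_left (Real.cosh_le_exp_half_sq _) zero_le_two
    _ = 2 ^ Fintype.card ι * Real.exp ((∑ i, c i ^ 2) / 2) := by
        rw [Finset.prod_mul_distrib, ← Real.exp_sum, Finset.sum_div]
        simp

/-- Hölder's inequality between `ℓ¹` and `ℓ^∞`, with the maximal coordinate made explicit. -/
lemma exists_abs_dotProduct_le {p : ℕ} (hp : 0 < p) (Z : Fin p → ℝ) :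
    ∃ j, ∀ δ : Fin p → ℝ, |∑ k, δ k * Z k| ≤ l1norm δ * |Z j| := by
  have : Nonempty (Fin p) := ⟨⟨0, hp⟩⟩
  obtain ⟨j, hj⟩ := Finite.exists_max fun k => |Z k|
  refine ⟨j, fun δ => (Finset.abs_sum_le_sum_abs _ _).trans ?_⟩
  rw [l1norm, Finset.sum_mul]
  refine Finset.sum_le_sum fun k _ => ?_
  rw [abs_mul]
  exact mul_le_mul_of_nonneg_left (hj k) (abs_nonneg _)

/-- Tail bound for the supremum of a Rademacher process over a finite part of an `ℓ¹` ball, for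
summands that are Lipschitz functions of a linear index. -/
lemma card_signs_exceeding_le {p : ℕ} (hp : 0 < p) (φ : ι → T → ℝ) (x : ι → Fin p → ℝ) (L : ι → ℝ)
    (δ : T → Fin p → ℝ) {r V y : ℝ} (hr : 0 < r) (hV : 0 < V) (hy : 0 < y)
    (hδ : ∀ t ∈ D, l1norm (δ t) ≤ r)
    (hdiff : ∀ i, ∀ t ∈ D, ∀ t' ∈ D, |φ i t - φ i t'| ≤ L i * |x i ⬝ᵥ δ t - x i ⬝ᵥ δ t'|)
    (habs : ∀ i, ∀ t ∈ D, |φ i t| ≤ L i * |x i ⬝ᵥ δ t|) (hL : ∀ i, 0 ≤ L i)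
    (hxV : ∀ j, ∑ i, (L i * x i j) ^ 2 ≤ V) :
    ((Finset.univ.filter fun ε : ι → ℤˣ =>
        ∃ t ∈ D, y < |∑ i, ((ε i : ℤ) : ℝ) * φ i t|).card : ℝ) ≤
      2 ^ Fintype.card ι * (4 * p * Real.exp (-(y ^ 2 / (2 * r ^ 2 * V)))) := by
  rcases D.eq_empty_or_nonempty with rfl | hD
  · simp; positivity
  -- `τ` minimizes the exponent `-τ y + τ² r² V / 2`
  set τ : ℝ := y / (r ^ 2 * V) with hτ
  have hτ0 : 0 < τ := by positivity
  -- exponential moments of the linearized process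
  have hlin : ∑ ε : ι → ℤˣ, Real.exp (D.sup' hD fun t =>
      ∑ i, ((ε i : ℤ) : ℝ) * (τ * (L i * (x i ⬝ᵥ δ t)))) ≤
      2 * p * (2 ^ Fintype.card ι * Real.exp (τ ^ 2 * r ^ 2 * V / 2)) := by
    have hpt : ∀ ε : ι → ℤˣ, Real.exp (D.sup' hD fun t =>
        ∑ i, ((ε i : ℤ) : ℝ) * (τ * (L i * (x i ⬝ᵥ δ t)))) ≤
        ∑ j, (Real.exp (∑ i, ((ε i : ℤ) : ℝ) * (τ * r * (L i * x i j))) +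
          Real.exp (∑ i, ((ε i : ℤ) : ℝ) * (-(τ * r) * (L i * x i j)))) := by
      intro ε
      obtain ⟨j, hj⟩ := exists_abs_dotProduct_le hp
        (fun k => ∑ i, ((ε i : ℤ) : ℝ) * (L i * x i k))
      refine le_trans ?_ (Finset.single_le_sum (f := fun j =>
        Real.exp (∑ i, ((ε i : ℤ) : ℝ) * (τ * r * (L i * x i j))) +
          Real.exp (∑ i, ((ε i : ℤ) : ℝ) * (-(τ * r) * (L i * x i j))))
        (fun j _ => by positivity) (Finset.mem_univ j))
      set Z := ∑ i, ((ε i : ℤ) : ℝ) * (L i * x i j) with hZ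
      have e1 : ∑ i, ((ε i : ℤ) : ℝ) * (τ * r * (L i * x i j)) = τ * r * Z := by
        rw [hZ, Finset.mul_sum]; exact Finset.sum_congr rfl fun i _ => by ring
      have e2 : ∑ i, ((ε i : ℤ) : ℝ) * (-(τ * r) * (L i * x i j)) = -(τ * r * Z) := by
        rw [hZ, Finset.mul_sum, ← Finset.sum_neg_distrib]
        exact Finset.sum_congr rfl fun i _ => by ring
      have hsup : (D.sup' hD fun t => ∑ i, ((ε i : ℤ) : ℝ) * (τ * (L i * (x i ⬝ᵥ δ t)))) ≤
          τ * r * |Z| := by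
        refine Finset.sup'_le _ _ fun t ht => ?_
        have e3 : ∑ i, ((ε i : ℤ) : ℝ) * (τ * (L i * (x i ⬝ᵥ δ t))) =
            τ * ∑ k, δ t k * ∑ i, ((ε i : ℤ) : ℝ) * (L i * x i k) := by
          simp only [dotProduct, Finset.mul_sum]
          rw [Finset.sum_comm]
          exact Finset.sum_congr rfl fun k _ => Finset.sum_congr rfl fun i _ => by ring
        rw [e3, mul_assoc]
        refine mul_le_mul_of_nonneg_left ?_ hτ0.le
        exact (le_abs_self _).trans ((hj (δ t)).trans
          (mul_le_mul_of_nonneg_right (hδ t ht) (abs_nonneg _)))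
      rw [e1, e2]
      refine (Real.exp_le_exp.2 hsup).trans ?_
      rcases abs_cases Z with h | h <;> rw [h.1]
      · linarith [Real.exp_pos (-(τ * r * Z))]
      · rw [mul_neg]; linarith [Real.exp_pos (τ * r * Z)]
    have hmgf : ∀ (u : ℝ) (j : Fin p), u ^ 2 = τ ^ 2 * r ^ 2 →
        ∑ ε : ι → ℤˣ, Real.exp (∑ i, ((ε i : ℤ) : ℝ) * (u * (L i * x i j))) ≤
        2 ^ Fintype.card ι * Real.exp (τ ^ 2 * r ^ 2 * V / 2) := by
      intro u j hu
      refine (sum_signs_exp_le _).trans (mul_le_mul_of_nonneg_left ?_ (by positivity))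
      refine Real.exp_le_exp.2 ?_
      have : ∑ i, (u * (L i * x i j)) ^ 2 = τ ^ 2 * r ^ 2 * ∑ i, (L i * x i j) ^ 2 := by
        rw [Finset.mul_sum, ← hu]; exact Finset.sum_congr rfl fun i _ => by ring
      rw [this]
      have := mul_le_mul_of_nonneg_left (hxV j) (by positivity : 0 ≤ τ ^ 2 * r ^ 2)
      linarith
    calc _ ≤ ∑ ε : ι → ℤˣ, ∑ j, (Real.exp (∑ i, ((ε i : ℤ) : ℝ) * (τ * r * (L i * x i j))) +
          Real.exp (∑ i, ((ε i : ℤ) : ℝ) * (-(τ * r) * (L i * x i j)))) :=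
          Finset.sum_le_sum fun ε _ => hpt ε
      _ = ∑ j, (∑ ε : ι → ℤˣ, Real.exp (∑ i, ((ε i : ℤ) : ℝ) * (τ * r * (L i * x i j))) +
          ∑ ε : ι → ℤˣ, Real.exp (∑ i, ((ε i : ℤ) : ℝ) * (-(τ * r) * (L i * x i j)))) := by
          rw [Finset.sum_comm]; simp only [Finset.sum_add_distrib]
      _ ≤ ∑ _j : Fin p, (2 ^ Fintype.card ι * Real.exp (τ ^ 2 * r ^ 2 * V / 2) +
          2 ^ Fintype.card ι * Real.exp (τ ^ 2 * r ^ 2 * V / 2)) :=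
          Finset.sum_le_sum fun j _ => add_le_add (hmgf _ j (by ring)) (hmgf _ j (by ring))
      _ = _ := by rw [Finset.sum_const, Finset.card_univ, Fintype.card_fin, nsmul_eq_mul]; ring
  -- both signs of the process are controlled by contraction
  have hcontr : ∀ e : ℝ, |e| = 1 →
      ∑ ε : ι → ℤˣ, Real.exp (D.sup' hD fun t => ∑ i, ((ε i : ℤ) : ℝ) * (e * (τ * φ i t))) ≤
      2 * p * (2 ^ Fintype.card ι * Real.exp (τ ^ 2 * r ^ 2 * V / 2)) := by
    intro e he
    refine le_trans (sum_signs_contraction hD _ _ (fun i t ht t' ht' => ?_) fun i t ht => ?_) hlin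
    · rw [← mul_sub, abs_mul, he, one_mul, ← mul_sub, ← mul_sub, ← mul_sub, abs_mul, abs_mul,
        abs_mul, abs_of_nonneg (hL i)]
      exact mul_le_mul_of_nonneg_left (hdiff i t ht t' ht') (abs_nonneg _)
    · rw [abs_mul, he, one_mul, abs_mul, abs_mul, abs_mul, abs_of_nonneg (hL i)]
      exact mul_le_mul_of_nonneg_left (habs i t ht) (abs_nonneg _)
  -- Markov's inequality for the exponential of the supremum
  have hmarkov : ∀ ε : ι → ℤˣ,
      (if ∃ t ∈ D, y < |∑ i, ((ε i : ℤ) : ℝ) * φ i t| then (1 : ℝ) else 0) ≤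
      Real.exp (-(τ * y)) *
        (Real.exp (D.sup' hD fun t => ∑ i, ((ε i : ℤ) : ℝ) * (1 * (τ * φ i t))) +
        Real.exp (D.sup' hD fun t => ∑ i, ((ε i : ℤ) : ℝ) * (-1 * (τ * φ i t)))) := by
    intro ε
    split_ifs with h
    · obtain ⟨t, ht, hlt⟩ := h
      have e1 : ∀ e : ℝ, e * (τ * ∑ i, ((ε i : ℤ) : ℝ) * φ i t) ≤
          D.sup' hD fun t => ∑ i, ((ε i : ℤ) : ℝ) * (e * (τ * φ i t)) := by
        intro e
        refine le_trans (le_of_eq ?_)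
          (D.le_sup' (fun t => ∑ i, ((ε i : ℤ) : ℝ) * (e * (τ * φ i t))) ht)
        simp only [Finset.mul_sum]
        exact Finset.sum_congr rfl fun i _ => by ring
      rw [mul_add, ← Real.exp_add, ← Real.exp_add]
      set Z := ∑ i, ((ε i : ℤ) : ℝ) * φ i t
      have hpos := mul_lt_mul_of_pos_left hlt hτ0
      rcases abs_cases Z with h | h <;> rw [h.1] at hpos
      · have := Real.one_le_exp (x := -(τ * y) +
          D.sup' hD fun t => ∑ i, ((ε i : ℤ) : ℝ) * (1 * (τ * φ i t))) (by linarith [e1 1])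
        linarith [Real.exp_pos (-(τ * y) +
          D.sup' hD fun t => ∑ i, ((ε i : ℤ) : ℝ) * (-1 * (τ * φ i t)))]
      · have := Real.one_le_exp (x := -(τ * y) +
          D.sup' hD fun t => ∑ i, ((ε i : ℤ) : ℝ) * (-1 * (τ * φ i t))) (by linarith [e1 (-1)])
        linarith [Real.exp_pos (-(τ * y) +
          D.sup' hD fun t => ∑ i, ((ε i : ℤ) : ℝ) * (1 * (τ * φ i t)))]
    · positivity
  rw [Finset.card_filter, Nat.cast_sum]
  push_cast
  calc _ ≤ ∑ ε : ι → ℤˣ, Real.exp (-(τ * y)) *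
        (Real.exp (D.sup' hD fun t => ∑ i, ((ε i : ℤ) : ℝ) * (1 * (τ * φ i t))) +
        Real.exp (D.sup' hD fun t => ∑ i, ((ε i : ℤ) : ℝ) * (-1 * (τ * φ i t)))) :=
        Finset.sum_le_sum fun ε _ => hmarkov ε
    _ ≤ Real.exp (-(τ * y)) * (2 * p * (2 ^ Fintype.card ι * Real.exp (τ ^ 2 * r ^ 2 * V / 2)) +
        2 * p * (2 ^ Fintype.card ι * Real.exp (τ ^ 2 * r ^ 2 * V / 2))) := by
        rw [← Finset.mul_sum, Finset.sum_add_distrib]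
        exact mul_le_mul_of_nonneg_left (add_le_add (hcontr 1 (by simp)) (hcontr (-1) (by simp)))
          (Real.exp_pos _).le
    _ = 2 ^ Fintype.card ι * (4 * p * (Real.exp (-(τ * y)) *
          Real.exp (τ ^ 2 * r ^ 2 * V / 2))) := by ring
    _ = _ := by
        rw [← Real.exp_add]
        congr 4
        rw [hτ]; field_simp; ring

end

/-! ### Moment inequalities for sums of independent observations -/

/-- Markov's inequality in a form that is valid when the bound `M` on the mean vanishes. -/
lemma measure_mul_lt_le_of_lintegral_le {Ω : Type*} [MeasurableSpace Ω] {μ : Measure Ω}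
    {Z : Ω → ℝ} (hZ : Measurable Z) {M c : ℝ} (hM : 0 ≤ M) (hc : 0 < c)
    (hint : ∫⁻ ω, ENNReal.ofReal (Z ω) ∂μ ≤ ENNReal.ofReal M) :
    μ {ω | c * M < Z ω} ≤ ENNReal.ofReal (1 / c) := by
  rcases hM.eq_or_lt with rfl | hM
  · have h0 : ∫⁻ ω, ENNReal.ofReal (Z ω) ∂μ = 0 := by simpa using hint
    rw [lintegral_eq_zero_iff hZ.ennreal_ofReal] at h0
    refine le_of_eq_of_le ?_ zero_le
    have h1 : ∀ᵐ ω ∂μ, ¬ c * 0 < Z ω := by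
      filter_upwards [h0] with ω hω
      simpa using hω
    simpa [ae_iff] using h1
  · have h1 := mul_meas_ge_le_lintegral (μ := μ) hZ.ennreal_ofReal (ENNReal.ofReal (c * M))
    have h2 : μ {ω | c * M < Z ω} ≤ μ {ω | ENNReal.ofReal (c * M) ≤ ENNReal.ofReal (Z ω)} :=
      measure_mono fun ω hω => ENNReal.ofReal_le_ofReal (le_of_lt hω)
    have h3 := (mul_le_mul_right h2 (ENNReal.ofReal (c * M))).trans (h1.trans hint)
    rw [ENNReal.ofReal_div_of_pos hc, ENNReal.ofReal_one,
      ENNReal.le_div_iff_mul_le (by simp [hc]) (by simp)]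
    rw [ENNReal.ofReal_mul hc.le, mul_comm, ← mul_assoc] at h3
    have h4 : ENNReal.ofReal M ≠ 0 := by simpa using hM
    rw [← ENNReal.mul_le_mul_iff_left h4 ENNReal.ofReal_ne_top, one_mul]
    exact h3

lemma memLp_two_of_lintegral_sq_le {𝒳 : Type*} [MeasurableSpace 𝒳] {P : Measure 𝒳} {g : 𝒳 → ℝ}
    (hg : Measurable g) {M : ℝ}
    (hint : ∫⁻ w, ENNReal.ofReal (g w ^ 2) ∂P ≤ ENNReal.ofReal M) : MemLp g 2 P := by
  rw [memLp_two_iff_integrable_sq hg.aestronglyMeasurable]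
  refine ⟨(hg.pow_const 2).aestronglyMeasurable, ?_⟩
  rw [hasFiniteIntegral_iff_ofReal (Filter.Eventually.of_forall fun w => sq_nonneg _)]
  exact hint.trans_lt ENNReal.ofReal_lt_top

section
variable {𝒳 ι : Type*} [MeasurableSpace 𝒳] [Fintype ι] {P : Measure 𝒳} [IsProbabilityMeasure P]

/-- The variance of a sum of independent observations grows linearly. -/
lemma lintegral_sum_sub_sq_le {g : 𝒳 → ℝ} (hg : Measurable g) {M : ℝ} (hM : 0 ≤ M)
    (hint : ∫⁻ w, ENNReal.ofReal (g w ^ 2) ∂P ≤ ENNReal.ofReal M) :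
    ∫⁻ v, ENNReal.ofReal ((∑ i, g (v i) - Fintype.card ι * ∫ w, g w ∂P) ^ 2)
      ∂(Measure.pi fun _ : ι => P) ≤ ENNReal.ofReal (Fintype.card ι * M) := by
  have hL := memLp_two_of_lintegral_sq_le hg hint
  have hvar : Var[g; P] ≤ M := by
    refine (variance_le_expectation_sq hg.aestronglyMeasurable).trans ?_
    change ∫ w, g w ^ 2 ∂P ≤ M
    rw [integral_eq_lintegral_of_nonneg_ae (Filter.Eventually.of_forall fun w => sq_nonneg _)
      (hg.pow_const 2).aestronglyMeasurable]
    exact ENNReal.toReal_le_of_le_ofReal hM hint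
  have hLi : ∀ i : ι, MemLp (fun v : ι → 𝒳 => g (v i)) 2 (Measure.pi fun _ : ι => P) := fun i =>
    hL.comp_measurePreserving (measurePreserving_eval (fun _ : ι => P) i)
  have hmean : ∫ v, ∑ i, g (v i) ∂(Measure.pi fun _ : ι => P) =
      Fintype.card ι * ∫ w, g w ∂P := by
    rw [integral_finsetSum _ fun i _ => (hLi i).integrable one_le_two]
    have : ∀ i : ι, ∫ v, g (v i) ∂(Measure.pi fun _ : ι => P) = ∫ w, g w ∂P := fun i => by
      have h := (measurePreserving_eval (fun _ : ι => P) i).map_eq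
      conv_rhs => rw [← h]
      rw [integral_map (measurable_pi_apply i).aemeasurable hg.aestronglyMeasurable]
    simp [this]
  have hsum : MemLp (fun v : ι → 𝒳 => ∑ i, g (v i)) 2 (Measure.pi fun _ : ι => P) :=
    memLp_finsetSum _ fun i _ => hLi i
  have hpi := variance_sum_pi (ι := ι) (μ := fun _ => P) (X := fun _ => g) fun _ => hL
  have hpi' : Var[fun v : ι → 𝒳 => ∑ i, g (v i); Measure.pi fun _ : ι => P] =
      Fintype.card ι * Var[g; P] := by
    have e : (∑ i, fun ω : ι → 𝒳 => g (ω i)) = fun v : ι → 𝒳 => ∑ i, g (v i) := by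
      ext v; simp
    rw [e] at hpi
    rw [hpi]; simp
  rw [← hmean, ← ofReal_integral_eq_lintegral_ofReal]
  · rw [← variance_eq_integral hsum.aestronglyMeasurable.aemeasurable, hpi']
    exact ENNReal.ofReal_le_ofReal (mul_le_mul_of_nonneg_left hvar (Nat.cast_nonneg _))
  · exact (hsum.sub (memLp_const _)).integrable_sq
  · exact Filter.Eventually.of_forall fun v => sq_nonneg _

/-- Chebyshev's inequality for a sum of independent observations. -/
lemma measure_sum_sub_sq_gt_le {g : 𝒳 → ℝ} (hg : Measurable g) {M c : ℝ} (hM : 0 ≤ M) (hc : 0 < c)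
    (hint : ∫⁻ w, ENNReal.ofReal (g w ^ 2) ∂P ≤ ENNReal.ofReal M) :
    (Measure.pi fun _ : ι => P)
      {v | c * (Fintype.card ι * M) < (∑ i, g (v i) - Fintype.card ι * ∫ w, g w ∂P) ^ 2} ≤
      ENNReal.ofReal (1 / c) :=
  measure_mul_lt_le_of_lintegral_le (by fun_prop) (by positivity) hc
    (lintegral_sum_sub_sq_le hg hM hint)

/-! ### Symmetrization -/

/-- The product law of two independent samples is invariant under exchanging the two samples in
the coordinates selected by `ε`. -/
lemma measurePreserving_swap (ε : ι → ℤˣ) :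
    MeasurePreserving (fun z : (ι → 𝒳) × (ι → 𝒳) =>
      ((fun i => if ε i = 1 then z.1 i else z.2 i, fun i => if ε i = 1 then z.2 i else z.1 i) :
        (ι → 𝒳) × (ι → 𝒳)))
      ((Measure.pi fun _ : ι => P).prod (Measure.pi fun _ : ι => P))
      ((Measure.pi fun _ : ι => P).prod (Measure.pi fun _ : ι => P)) := by
  have h1 := measurePreserving_arrowProdEquivProdArrow 𝒳 𝒳 ι (fun _ => P) (fun _ => P)
  have h2 : MeasurePreserving
      (fun (z : ι → 𝒳 × 𝒳) i => (if ε i = 1 then z i else (z i).swap))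
      (Measure.pi fun _ : ι => P.prod P) (Measure.pi fun _ : ι => P.prod P) := by
    refine measurePreserving_pi (fun _ => P.prod P) (fun _ => P.prod P)
      (f := fun i (z : 𝒳 × 𝒳) => if ε i = 1 then z else z.swap) fun i => ?_
    by_cases h : ε i = 1
    · simp only [h, if_true]; exact MeasurePreserving.id _
    · simp only [h, if_false]; exact Measure.measurePreserving_swap
  have h3 := (h1.comp h2).comp (h1.symm _)
  convert h3 using 1
  funext z
  ext i
  all_goals
    simp only [Function.comp_apply, MeasurableEquiv.arrowProdEquivProdArrow,
      Equiv.arrowProdEquivProdArrow]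
    by_cases h : ε i = 1 <;> simp [h]

/-- Symmetrization in probability for a finite family of functions: if each centred sum is
at most `y / 2` in absolute value with probability at least `1 / 2`, the probability that some
centred sum exceeds `y` is at most four times the probability that some Rademacher sum exceeds
`y / 4`. The latter is bounded given the observations, off the exceptional set `G`. -/
lemma measure_exists_sum_sub_gt_le {T : Type*} (D : Finset T) (f : T → 𝒳 → ℝ)
    (hf : ∀ t, Measurable (f t)) (c : T → ℝ) {y β : ℝ}
    (hcheb : ∀ t ∈ D, (Measure.pi fun _ : ι => P) {v | y / 2 < |∑ i, f t (v i) - c t|} ≤ 1 / 2)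
    (G : Set (ι → 𝒳)) [DecidableEq ι]
    (hG : ∀ v ∉ G, ((Finset.univ.filter fun ε : ι → ℤˣ =>
        ∃ t ∈ D, y / 4 < |∑ i, ((ε i : ℤ) : ℝ) * f t (v i)|).card : ℝ) ≤
      2 ^ Fintype.card ι * β) :
    (Measure.pi fun _ : ι => P) {v | ∃ t ∈ D, y < |∑ i, f t (v i) - c t|} ≤
      4 * (ENNReal.ofReal β + (Measure.pi fun _ : ι => P) G) := by
  set ν := Measure.pi fun _ : ι => P with hν
  have hfi : ∀ t (i : ι), Measurable fun v : ι → 𝒳 => f t (v i) := fun t i =>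
    (hf t).comp (measurable_pi_apply i)
  have hmeas : ∀ (h : T → (ι → 𝒳) → ℝ) (a : ℝ), (∀ t, Measurable (h t)) →
      MeasurableSet {v | ∃ t ∈ D, a < |h t v|} := by
    intro h a hh
    have : {v | ∃ t ∈ D, a < |h t v|} = ⋃ t ∈ D, {v | a < |h t v|} := by ext; simp
    rw [this]
    exact D.measurableSet_biUnion fun t _ => measurableSet_lt measurable_const (hh t).abs
  have hA := hmeas (fun t v => ∑ i, f t (v i) - c t) y fun t =>
    (Finset.measurable_fun_sum _ fun i _ => hfi t i).sub_const _
  set A := {v : ι → 𝒳 | ∃ t ∈ D, y < |∑ i, f t (v i) - c t|} with hAdef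
  set E : (ι → ℤˣ) → Set ((ι → 𝒳) × (ι → 𝒳)) := fun ε =>
    {z | ∃ t ∈ D, y / 2 < |∑ i, ((ε i : ℤ) : ℝ) * (f t (z.1 i) - f t (z.2 i))|} with hE
  set C : (ι → ℤˣ) → Set (ι → 𝒳) := fun ε =>
    {v | ∃ t ∈ D, y / 4 < |∑ i, ((ε i : ℤ) : ℝ) * f t (v i)|} with hC
  have hCm : ∀ ε, MeasurableSet (C ε) := fun ε =>
    hmeas (fun t v => ∑ i, ((ε i : ℤ) : ℝ) * f t (v i)) (y / 4) fun t =>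
      Finset.measurable_fun_sum _ fun i _ => (hfi t i).const_mul _
  have hEm : ∀ ε, MeasurableSet (E ε) := by
    intro ε
    have : E ε = ⋃ t ∈ D,
        {z | y / 2 < |∑ i, ((ε i : ℤ) : ℝ) * (f t (z.1 i) - f t (z.2 i))|} := by
      ext; simp [hE]
    rw [this]
    refine D.measurableSet_biUnion fun t _ => measurableSet_lt measurable_const
      (Measurable.abs (Finset.measurable_fun_sum _ fun i _ => Measurable.const_mul ?_ _))
    exact ((hfi t i).comp measurable_fst).sub ((hfi t i).comp measurable_snd)
  -- comparison with an independent copy of the sample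
  have hghost : ν A ≤ 2 * (ν.prod ν) (E 1) := by
    rw [Measure.prod_apply (hEm 1)]
    have hle : ∫⁻ v, A.indicator (fun _ => (1 / 2 : ENNReal)) v ∂ν ≤
        ∫⁻ v, ν (Prod.mk v ⁻¹' E 1) ∂ν := by
      refine lintegral_mono fun v => ?_
      by_cases hv : v ∈ A
      · rw [Set.indicator_of_mem hv]
        obtain ⟨t, ht, hlt⟩ := hv
        have hms : MeasurableSet {v : ι → 𝒳 | y / 2 < |∑ i, f t (v i) - c t|} :=
          measurableSet_lt measurable_const
            (((Finset.measurable_fun_sum _ fun i _ => hfi t i).sub_const _).abs)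
        have hsub : {v : ι → 𝒳 | y / 2 < |∑ i, f t (v i) - c t|}ᶜ ⊆ Prod.mk v ⁻¹' E 1 := by
          intro v' hv'
          simp only [Set.mem_compl_iff, Set.mem_ofPred_eq, not_lt] at hv'
          refine ⟨t, ht, ?_⟩
          simp only [Pi.one_apply, Units.val_one, Int.cast_one, one_mul, Finset.sum_sub_distrib]
          have := abs_sub_abs_le_abs_sub (∑ i, f t (v i) - c t) (∑ i, f t (v' i) - c t)
          rw [sub_sub_sub_cancel_right] at this
          linarith
        refine le_trans ?_ (measure_mono hsub)
        rw [prob_compl_eq_one_sub hms]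
        refine le_trans (le_of_eq ?_) (tsub_le_tsub_left (hcheb t ht) 1)
        rw [one_div, ENNReal.one_sub_inv_two]
      · rw [Set.indicator_of_notMem hv]; exact zero_le
    rw [lintegral_indicator_const hA] at hle
    calc ν A = 2 * (1 / 2 * ν A) := by
          rw [← mul_assoc, one_div, ENNReal.mul_inv_cancel two_ne_zero ENNReal.ofNat_ne_top,
            one_mul]
      _ ≤ _ := mul_le_mul_right hle 2
  -- randomization of the signs
  have hrandom : ∀ ε, (ν.prod ν) (E 1) = (ν.prod ν) (E ε) := by
    intro ε
    rw [← (measurePreserving_swap (P := P) ε).measure_preimage (hEm 1).nullMeasurableSet]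
    congr 1
    ext z
    simp only [hE, Set.mem_preimage, Set.mem_ofPred_eq]
    have : ∀ t, ∑ i, (((1 : ι → ℤˣ) i : ℤ) : ℝ) *
        (f t (if ε i = 1 then z.1 i else z.2 i) - f t (if ε i = 1 then z.2 i else z.1 i)) =
        ∑ i, ((ε i : ℤ) : ℝ) * (f t (z.1 i) - f t (z.2 i)) := by
      intro t
      refine Finset.sum_congr rfl fun i _ => ?_
      rcases Int.units_eq_one_or (ε i) with h | h <;> simp [h]
    simp only [this]
  -- the difference of two samples is large only if one of them is
  have hsplit : ∀ ε, (ν.prod ν) (E ε) ≤ 2 * ν (C ε) := by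
    intro ε
    have hsub : E ε ⊆ Prod.fst ⁻¹' C ε ∪ Prod.snd ⁻¹' C ε := by
      rintro z ⟨t, ht, hlt⟩
      by_contra hcon
      simp only [Set.mem_union, Set.mem_preimage, not_or, hC, Set.mem_ofPred_eq, not_exists,
        not_and, not_lt] at hcon
      have h1 := hcon.1 t ht
      have h2 := hcon.2 t ht
      simp only [mul_sub, Finset.sum_sub_distrib] at hlt
      have := abs_sub (∑ i, ((ε i : ℤ) : ℝ) * f t (z.1 i)) (∑ i, ((ε i : ℤ) : ℝ) * f t (z.2 i))
      linarith
    refine (measure_mono hsub).trans ((measure_union_le _ _).trans (le_of_eq ?_))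
    rw [measurePreserving_fst.measure_preimage (hCm ε).nullMeasurableSet,
      measurePreserving_snd.measure_preimage (hCm ε).nullMeasurableSet, two_mul]
  -- for fixed observations off `G`, the proportion of signs in `C ε` is at most `β`
  have haverage : ∑ ε, ν (C ε) ≤ 2 ^ Fintype.card ι * (ENNReal.ofReal β + ν G) := by
    have e1 : ∑ ε, ν (C ε) = ∫⁻ v, ∑ ε, (C ε).indicator 1 v ∂ν := by
      rw [lintegral_finsetSum _ fun ε _ => measurable_one.indicator (hCm ε)]
      simp only [lintegral_indicator_one (hCm _)]
    have e2 : ∀ v, ∑ ε, (C ε).indicator (1 : (ι → 𝒳) → ENNReal) v =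
        ENNReal.ofReal ((Finset.univ.filter fun ε : ι → ℤˣ =>
        ∃ t ∈ D, y / 4 < |∑ i, ((ε i : ℤ) : ℝ) * f t (v i)|).card : ℝ) := by
      intro v
      rw [ENNReal.ofReal_natCast, Finset.card_filter, Nat.cast_sum]
      refine Finset.sum_congr rfl fun ε _ => ?_
      simp only [Set.indicator_apply, hC, Set.mem_ofPred_eq, Pi.one_apply]
      split_ifs <;> simp
    have hcardle : ∀ v : ι → 𝒳, ENNReal.ofReal ((Finset.univ.filter fun ε : ι → ℤˣ =>
        ∃ t ∈ D, y / 4 < |∑ i, ((ε i : ℤ) : ℝ) * f t (v i)|).card : ℝ) ≤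
        2 ^ Fintype.card ι := by
      intro v
      rw [ENNReal.ofReal_natCast]
      have := Finset.card_filter_le (Finset.univ : Finset (ι → ℤˣ)) fun ε : ι → ℤˣ =>
        ∃ t ∈ D, y / 4 < |∑ i, ((ε i : ℤ) : ℝ) * f t (v i)|
      rw [Finset.card_univ, Fintype.card_fun, Fintype.card_units_int] at this
      exact_mod_cast this
    rw [e1]
    calc ∫⁻ v, ∑ ε, (C ε).indicator 1 v ∂ν
        ≤ ∫⁻ v, (2 ^ Fintype.card ι * ENNReal.ofReal β +
            (toMeasurable ν G).indicator (fun _ => 2 ^ Fintype.card ι) v) ∂ν := by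
          refine lintegral_mono fun v => ?_
          rw [e2]
          by_cases hv : v ∈ toMeasurable ν G
          · rw [Set.indicator_of_mem hv]
            exact (hcardle v).trans le_add_self
          · refine le_trans ?_ le_self_add
            refine (ENNReal.ofReal_le_ofReal
              (hG v fun h => hv (subset_toMeasurable ν G h))).trans (le_of_eq ?_)
            rw [ENNReal.ofReal_mul (by positivity), ENNReal.ofReal_pow zero_le_two]
            simp
      _ = 2 ^ Fintype.card ι * (ENNReal.ofReal β + ν G) := by
          rw [lintegral_add_left measurable_const, lintegral_const, measure_univ, mul_one,
            lintegral_indicator_const (measurableSet_toMeasurable ν G), measure_toMeasurable,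
            mul_add]
  have hcard : (Fintype.card (ι → ℤˣ) : ENNReal) = 2 ^ Fintype.card ι := by
    rw [Fintype.card_fun, Fintype.card_units_int]; simp
  have hpow : (2 ^ Fintype.card ι : ENNReal) ≠ 0 := by simp
  have hpow' : (2 ^ Fintype.card ι : ENNReal) ≠ ⊤ := by finiteness
  rw [← ENNReal.mul_le_mul_iff_right hpow hpow']
  calc 2 ^ Fintype.card ι * ν A = ∑ _ε : ι → ℤˣ, ν A := by
        rw [Finset.sum_const, Finset.card_univ, nsmul_eq_mul, hcard]
    _ ≤ ∑ ε, 4 * ν (C ε) := by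
        refine Finset.sum_le_sum fun ε _ => hghost.trans ?_
        rw [hrandom ε]
        refine (mul_le_mul_right (hsplit ε) 2).trans (le_of_eq ?_)
        rw [← mul_assoc]; norm_num
    _ ≤ 4 * (2 ^ Fintype.card ι * (ENNReal.ofReal β + ν G)) := by
        rw [← Finset.mul_sum]
        exact mul_le_mul_right haverage 4
    _ = _ := by ring

end

/-- A bound on the probability that a process exceeds a level somewhere on a finite set extends to
all subsets of the index set, if the process is continuous up to a deterministic function `M`: the
graph of `M` is separable, however irregular `M` is. -/
lemma measure_exists_gt_le_of_finite {Ω E : Type*} [MeasurableSpace Ω] {ν : Measure Ω}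
    [TopologicalSpace E] [TopologicalSpace.PseudoMetrizableSpace E] [SecondCountableTopology E]
    (S : Set E) (F : Ω → E → ℝ)
    (hF : ∀ ω, Continuous (F ω)) (M : E → ℝ) {y : ℝ} {b : ENNReal}
    (hfin : ∀ D : Finset E, (D : Set E) ⊆ S → ν {ω | ∃ θ ∈ D, y < |F ω θ - M θ|} ≤ b) :
    ν {ω | ∃ θ ∈ S, y < |F ω θ - M θ|} ≤ b := by
  classical
  rcases S.eq_empty_or_nonempty with rfl | hS
  · simp
  obtain ⟨c, hcsub, hc, hcl⟩ : ∃ c ⊆ S, c.Countable ∧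
      ∀ θ ∈ S, (θ, M θ) ∈ closure ((fun θ => (θ, M θ)) '' c) := by
    have hsep : TopologicalSpace.IsSeparable ((fun θ => (θ, M θ)) '' S) :=
      TopologicalSpace.IsSeparable.of_separableSpace _
    obtain ⟨c', hc', hcc, hcl⟩ := hsep.exists_countable_dense_subset
    have hinj : Function.Injective fun θ => (θ, M θ) := fun θ θ' h => congrArg Prod.fst h
    refine ⟨(fun θ => (θ, M θ)) ⁻¹' c', fun θ hθ => ?_, hcc.preimage hinj, fun θ hθ => ?_⟩
    · obtain ⟨θ', hθ', h⟩ := hc' hθ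
      rwa [← hinj h]
    · rw [Set.image_preimage_eq_of_subset (hc'.trans (Set.image_subset_range _ _))]
      exact hcl ⟨θ, hθ, rfl⟩
  have hcne : c.Nonempty := by
    obtain ⟨θ, hθ⟩ := hS
    obtain ⟨z, hz⟩ := closure_nonempty_iff.1 ⟨_, hcl θ hθ⟩
    obtain ⟨θ', hθ', -⟩ := hz
    exact ⟨θ', hθ'⟩
  obtain ⟨u, rfl⟩ := hc.exists_eq_range hcne
  have hsub : {ω | ∃ θ ∈ S, y < |F ω θ - M θ|} ⊆ ⋃ k, {ω | y < |F ω (u k) - M (u k)|} := by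
    rintro ω ⟨θ, hθ, hlt⟩
    have hopen : IsOpen {z : E × ℝ | y < |F ω z.1 - z.2|} :=
      isOpen_lt continuous_const ((((hF ω).comp continuous_fst).sub continuous_snd).abs)
    obtain ⟨z, hz, θ', ⟨k, rfl⟩, rfl⟩ := mem_closure_iff.1 (hcl θ hθ) _ hopen hlt
    exact Set.mem_iUnion.2 ⟨k, hz⟩
  -- continuity of the measure from below reduces the countable set to finite ones
  refine (measure_mono hsub).trans ?_
  rw [measure_iUnion_eq_iSup_accumulate]
  refine iSup_le fun k => le_trans (measure_mono ?_)
    (hfin ((Finset.range (k + 1)).image u) ?_)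
  · intro ω hω
    obtain ⟨j, hj, hlt⟩ := Set.mem_accumulate.1 hω
    exact ⟨u j, Finset.mem_image_of_mem u (Finset.mem_range.2 (by omega)), hlt⟩
  · intro θ hθ
    obtain ⟨j, -, rfl⟩ := Finset.mem_image.1 (Finset.mem_coe.1 hθ)
    exact hcsub ⟨j, rfl⟩

/-! ### The score -/

section
variable {𝒳₁ 𝒳₂ : Type*} [MeasurableSpace 𝒳₁] [MeasurableSpace 𝒳₂] {P : Measure (𝒳₁ × 𝒳₂)}
  [IsProbabilityMeasure P] {U : 𝒳₁ × 𝒳₂ → ℝ} {σ : ℝ}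

/-- The conditional sub-Gaussian bound, integrated over an event determined by the regressors. -/
lemma setLIntegral_exp_sub_le
    (hU : ∀ t : ℝ, Integrable (fun w => Real.exp (t * U w)) P ∧
      ∀ᵐ w ∂P, Real.log ((P[fun w' => Real.exp (t * U w') |
          MeasurableSpace.comap Prod.fst inferInstance]) w) ≤ σ ^ 2 * t ^ 2 / 2)
    (c : ℝ) {S : Set 𝒳₁} (hS : MeasurableSet S) :
    ∫⁻ w in Prod.fst ⁻¹' S, ENNReal.ofReal (Real.exp (c * U w - σ ^ 2 * c ^ 2 / 2)) ∂P ≤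
      P (Prod.fst ⁻¹' S) := by
  obtain ⟨hint, hlog⟩ := hU c
  have hle : MeasurableSpace.comap Prod.fst inferInstance ≤
      (inferInstance : MeasurableSpace (𝒳₁ × 𝒳₂)) := measurable_fst.comap_le
  have hnonneg : 0 ≤ᵐ[P] P[fun w' => Real.exp (c * U w') |
      MeasurableSpace.comap Prod.fst inferInstance] :=
    condExp_nonneg (Filter.Eventually.of_forall fun w => (Real.exp_pos _).le)
  have hbound : ∀ᵐ w ∂P, (P[fun w' => Real.exp (c * U w') |
      MeasurableSpace.comap Prod.fst inferInstance]) w ≤ Real.exp (σ ^ 2 * c ^ 2 / 2) := by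
    filter_upwards [hnonneg, hlog] with w h0 h1
    -- at `0` the logarithm takes a conventional value, but the bound is trivial there
    rcases (show (0 : ℝ) ≤ _ from h0).eq_or_lt with h | h
    · rw [← h]; exact (Real.exp_pos _).le
    · exact (Real.log_le_iff_le_exp h).1 h1
  have hset : ∫ w in Prod.fst ⁻¹' S, Real.exp (c * U w) ∂P ≤
      P.real (Prod.fst ⁻¹' S) * Real.exp (σ ^ 2 * c ^ 2 / 2) := by
    rw [← setIntegral_condExp hle hint ⟨S, hS, rfl⟩]
    refine (setIntegral_mono_ae integrable_condExp.integrableOn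
      (integrable_const (Real.exp (σ ^ 2 * c ^ 2 / 2))).integrableOn hbound).trans (le_of_eq ?_)
    rw [setIntegral_const, smul_eq_mul]
  have e1 : ∀ w, Real.exp (c * U w - σ ^ 2 * c ^ 2 / 2) =
      Real.exp (c * U w) * Real.exp (-(σ ^ 2 * c ^ 2 / 2)) := fun w => by
    rw [← Real.exp_add]; ring_nf
  simp only [e1]
  rw [← ofReal_integral_eq_lintegral_ofReal (hint.mul_const _).integrableOn
    (Filter.Eventually.of_forall fun w => by positivity), integral_mul_const,
    ← ofReal_measureReal]
  refine ENNReal.ofReal_le_ofReal ?_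
  refine (mul_le_mul_of_nonneg_right hset (Real.exp_pos _).le).trans (le_of_eq ?_)
  rw [mul_assoc, ← Real.exp_add]; simp

/-- In a conditional sub-Gaussian bound the deterministic argument may be replaced by a function of
the regressors: this is clear for simple functions, and Fatou's lemma does the rest. -/
lemma lintegral_exp_mul_sub_le_one (hUm : Measurable U)
    (hU : ∀ t : ℝ, Integrable (fun w => Real.exp (t * U w)) P ∧
      ∀ᵐ w ∂P, Real.log ((P[fun w' => Real.exp (t * U w') |
          MeasurableSpace.comap Prod.fst inferInstance]) w) ≤ σ ^ 2 * t ^ 2 / 2)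
    {h : 𝒳₁ → ℝ} (hh : Measurable h) :
    ∫⁻ w, ENNReal.ofReal (Real.exp (h w.1 * U w - σ ^ 2 * h w.1 ^ 2 / 2)) ∂P ≤ 1 := by
  have hsimple : ∀ s : SimpleFunc 𝒳₁ ℝ,
      ∫⁻ w, ENNReal.ofReal (Real.exp (s w.1 * U w - σ ^ 2 * s w.1 ^ 2 / 2)) ∂P ≤ 1 := by
    intro s
    have hcover : (⋃ c ∈ s.range, (Prod.fst ⁻¹' (s ⁻¹' {c}) : Set (𝒳₁ × 𝒳₂))) = Set.univ := by
      ext w; simp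
    have hdisj : (s.range : Set ℝ).PairwiseDisjoint
        fun c => (Prod.fst ⁻¹' (s ⁻¹' {c}) : Set (𝒳₁ × 𝒳₂)) := by
      intro c _ c' _ hcc
      refine Set.disjoint_left.2 fun w h1 h2 => hcc ?_
      simp only [Set.mem_preimage, Set.mem_singleton_iff] at h1 h2
      rw [← h1, h2]
    have hms : ∀ c ∈ s.range, MeasurableSet (Prod.fst ⁻¹' (s ⁻¹' {c}) : Set (𝒳₁ × 𝒳₂)) :=
      fun c _ => measurable_fst (s.measurableSet_preimage {c})
    rw [← setLIntegral_univ, ← hcover, lintegral_biUnion_finset hdisj hms]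
    calc _ ≤ ∑ c ∈ s.range, P (Prod.fst ⁻¹' (s ⁻¹' {c})) := by
          refine Finset.sum_le_sum fun c hc => ?_
          refine le_trans (le_of_eq ?_)
            (setLIntegral_exp_sub_le hU c (s.measurableSet_preimage {c}))
          refine setLIntegral_congr_fun (hms c hc) fun w hw => ?_
          have : s w.1 = c := hw
          simp only [this]
      _ = 1 := by
          rw [← measure_biUnion_finset hdisj hms, hcover, measure_univ]
  have hlim := hh.stronglyMeasurable.tendsto_approx
  set s := hh.stronglyMeasurable.approx
  have hpt : ∀ w : 𝒳₁ × 𝒳₂, ENNReal.ofReal (Real.exp (h w.1 * U w - σ ^ 2 * h w.1 ^ 2 / 2)) =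
      Filter.liminf (fun n => ENNReal.ofReal
        (Real.exp (s n w.1 * U w - σ ^ 2 * s n w.1 ^ 2 / 2))) Filter.atTop := by
    intro w
    refine (Filter.Tendsto.liminf_eq ?_).symm
    refine (ENNReal.continuous_ofReal.tendsto _).comp ((Real.continuous_exp.tendsto _).comp ?_)
    exact ((hlim w.1).mul_const _).sub ((((hlim w.1).pow 2).const_mul _).div_const _)
  simp only [hpt]
  refine (lintegral_liminf_le fun n => ?_).trans ?_
  · have : Measurable fun w : 𝒳₁ × 𝒳₂ => s n w.1 := (s n).measurable.comp measurable_fst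
    exact ((((this.mul hUm).sub (((this.pow_const 2).const_mul _).div_const _)).exp)).ennreal_ofReal
  · refine Filter.liminf_le_of_frequently_le' (Filter.Frequently.of_forall fun n => hsimple (s n))

/-- Tail bound for a self-normalized sum of conditionally sub-Gaussian variables. -/
lemma measure_sum_mul_gt_le {ι : Type*} [Fintype ι] (hσ : 0 < σ) (hUm : Measurable U)
    (hU : ∀ t : ℝ, Integrable (fun w => Real.exp (t * U w)) P ∧
      ∀ᵐ w ∂P, Real.log ((P[fun w' => Real.exp (t * U w') |
          MeasurableSpace.comap Prod.fst inferInstance]) w) ≤ σ ^ 2 * t ^ 2 / 2)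
    {h : 𝒳₁ → ℝ} (hh : Measurable h) {V y : ℝ} (hV : 0 < V) (hy : 0 < y) :
    (Measure.pi fun _ : ι => P)
      {v | ∑ i, h (v i).1 ^ 2 ≤ V ∧ y < ∑ i, h (v i).1 * U (v i)} ≤
      ENNReal.ofReal (Real.exp (-(y ^ 2 / (2 * σ ^ 2 * V)))) := by
  set ν := Measure.pi fun _ : ι => P
  -- `τ` minimizes the exponent `-τ y + σ² τ² V / 2`
  set τ : ℝ := y / (σ ^ 2 * V) with hτ
  have hτ0 : 0 < τ := by positivity
  set F : 𝒳₁ × 𝒳₂ → ENNReal := fun w =>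
    ENNReal.ofReal (Real.exp (τ * h w.1 * U w - σ ^ 2 * (τ * h w.1) ^ 2 / 2)) with hF
  have hFm : Measurable F := by
    have : Measurable fun w : 𝒳₁ × 𝒳₂ => h w.1 := hh.comp measurable_fst
    exact ((((this.const_mul τ).mul hUm).sub
      ((((this.const_mul τ).pow_const 2).const_mul _).div_const _)).exp).ennreal_ofReal
  have hF1 : ∫⁻ w, F w ∂P ≤ 1 := lintegral_exp_mul_sub_le_one hUm hU (hh.const_mul τ)
  have hprod : ∫⁻ v, ∏ i, F (v i) ∂ν ≤ 1 := by
    rw [lintegral_prod_eq_prod_lintegral_of_indepFun Finset.univ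
      (fun i (v : ι → 𝒳₁ × 𝒳₂) => F (v i))
      (iIndepFun_pi (X := fun _ : ι => F) fun i => hFm.aemeasurable)
      fun i => hFm.comp (measurable_pi_apply i)]
    refine Finset.prod_le_one' fun i _ => ?_
    rw [(measurePreserving_eval (fun _ : ι => P) i).lintegral_comp hFm]
    exact hF1
  have hKpos : 0 < Real.exp (-(y ^ 2 / (2 * σ ^ 2 * V))) := Real.exp_pos _
  have hpt : ∀ v : ι → 𝒳₁ × 𝒳₂, (∑ i, h (v i).1 ^ 2 ≤ V ∧ y < ∑ i, h (v i).1 * U (v i)) →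
      1 ≤ ENNReal.ofReal (Real.exp (-(y ^ 2 / (2 * σ ^ 2 * V)))) * ∏ i, F (v i) := by
    rintro v ⟨h1, h2⟩
    rw [hF, ← ENNReal.ofReal_prod_of_nonneg fun i _ => (Real.exp_pos _).le, ← Real.exp_sum,
      ← ENNReal.ofReal_mul hKpos.le, ← Real.exp_add, ENNReal.one_le_ofReal]
    refine Real.one_le_exp ?_
    have e : ∑ i, (τ * h (v i).1 * U (v i) - σ ^ 2 * (τ * h (v i).1) ^ 2 / 2) =
        τ * ∑ i, h (v i).1 * U (v i) - σ ^ 2 * τ ^ 2 / 2 * ∑ i, h (v i).1 ^ 2 := by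
      rw [Finset.mul_sum, Finset.mul_sum, ← Finset.sum_sub_distrib]
      exact Finset.sum_congr rfl fun i _ => by ring
    rw [e]
    have h3 := mul_le_mul_of_nonneg_left h1 (by positivity : 0 ≤ σ ^ 2 * τ ^ 2 / 2)
    have h4 := mul_lt_mul_of_pos_left h2 hτ0
    have e2 : y ^ 2 / (2 * σ ^ 2 * V) = τ * y - σ ^ 2 * τ ^ 2 / 2 * V := by
      rw [hτ]; field_simp; ring
    linarith
  refine (measure_mono fun v hv => hpt v hv).trans ?_
  have hprodm : Measurable fun v : ι → 𝒳₁ × 𝒳₂ => ∏ i, F (v i) :=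
    Finset.measurable_fun_prod _ fun i _ => hFm.comp (measurable_pi_apply i)
  have := mul_meas_ge_le_lintegral (μ := ν) (hprodm.const_mul
    (ENNReal.ofReal (Real.exp (-(y ^ 2 / (2 * σ ^ 2 * V)))))) 1
  rw [one_mul, lintegral_const_mul _ hprodm] at this
  exact this.trans (mul_le_of_le_one_right' hprod)

end

/-- Tail bound for the maximum norm of the score. -/
lemma measure_exists_score_gt_le {p : ℕ} {𝒴 ι : Type*} [MeasurableSpace 𝒴] [Fintype ι]
    {P : Measure (Obs p 𝒴)} [IsProbabilityMeasure P] {U : Obs p 𝒴 → ℝ} {σ : ℝ}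
    (hσ : 0 < σ) (hUm : Measurable U)
    (hU : ∀ t : ℝ, Integrable (fun w => Real.exp (t * U w)) P ∧
      ∀ᵐ w ∂P, Real.log ((P[fun w' => Real.exp (t * U w') |
          MeasurableSpace.comap Prod.fst inferInstance]) w) ≤ σ ^ 2 * t ^ 2 / 2)
    {V y : ℝ} (hV : 0 < V) (hy : 0 < y) :
    (Measure.pi fun _ : ι => P)
      {v | (∀ j, ∑ i, (v i).1 j ^ 2 ≤ V) ∧ ∃ j, y < |∑ i, (v i).1 j * U (v i)|} ≤
      ENNReal.ofReal (2 * p * Real.exp (-(y ^ 2 / (2 * σ ^ 2 * V)))) := by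
  set b := ENNReal.ofReal (Real.exp (-(y ^ 2 / (2 * σ ^ 2 * V)))) with hb
  have hsub : {v : ι → Obs p 𝒴 | (∀ j, ∑ i, (v i).1 j ^ 2 ≤ V) ∧
      ∃ j, y < |∑ i, (v i).1 j * U (v i)|} ⊆
      ⋃ j : Fin p, ({v | ∑ i, (v i).1 j ^ 2 ≤ V ∧ y < ∑ i, (v i).1 j * U (v i)} ∪
        {v | ∑ i, (-(v i).1 j) ^ 2 ≤ V ∧ y < ∑ i, -(v i).1 j * U (v i)}) := by
    rintro v ⟨h1, j, h2⟩
    refine Set.mem_iUnion.2 ⟨j, ?_⟩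
    rcases abs_cases (∑ i, (v i).1 j * U (v i)) with h | h
    · exact Or.inl ⟨h1 j, by linarith⟩
    · refine Or.inr ⟨by simpa using h1 j, ?_⟩
      simp only [neg_mul, Finset.sum_neg_distrib]
      linarith
  refine (measure_mono hsub).trans ((measure_iUnion_fintype_le _ _).trans ?_)
  calc _ ≤ ∑ _j : Fin p, (b + b) := by
        refine Finset.sum_le_sum fun j _ => (measure_union_le _ _).trans (add_le_add ?_ ?_)
        · exact measure_sum_mul_gt_le hσ hUm hU (h := fun x : Fin p → ℝ => x j)
            (measurable_pi_apply j) hV hy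
        · exact measure_sum_mul_gt_le hσ hUm hU (h := fun x : Fin p → ℝ => -x j)
            (measurable_pi_apply j).neg hV hy
    _ = _ := by
        rw [Finset.sum_const, Finset.card_univ, Fintype.card_fin, nsmul_eq_mul, ← two_mul,
          ← mul_assoc, ENNReal.ofReal_mul (by positivity), hb, ENNReal.ofReal_mul zero_le_two]
        simp [mul_comm]

/-! ### The empirical process near the target -/

lemma abs_dotProduct_le_mul_l1norm {p : ℕ} {x : Fin p → ℝ} {B : ℝ} (hx : ∀ j, |x j| ≤ B)
    (δ : Fin p → ℝ) : |x ⬝ᵥ δ| ≤ B * l1norm δ := by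
  rw [dotProduct, l1norm, Finset.mul_sum]
  refine (Finset.abs_sum_le_sum_abs _ _).trans (Finset.sum_le_sum fun j _ => ?_)
  rw [abs_mul]
  exact mul_le_mul_of_nonneg_right (hx j) (abs_nonneg _)

lemma integral_lossAt_sub {p : ℕ} {𝒴 : Type*} [MeasurableSpace 𝒴] {P : Measure (Obs p 𝒴)}
    {m : ℝ → 𝒴 → ℝ} {θ₀ θ : Fin p → ℝ} (hint : Integrable (lossAt m θ₀) P)
    (h : Integrable (lossAt m θ) P) :
    ∫ w, (lossAt m θ w - lossAt m θ₀ w) ∂P = excessRisk P m θ₀ θ :=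
  integral_sub h hint

lemma integral_sq_le_of_lintegral_sq_le {𝒳 : Type*} [MeasurableSpace 𝒳] {Q : Measure 𝒳}
    [IsProbabilityMeasure Q] {g : 𝒳 → ℝ} (hg : Measurable g) {M : ℝ} (hM : 0 ≤ M)
    (hint : ∫⁻ w, ENNReal.ofReal (g w ^ 2) ∂Q ≤ ENNReal.ofReal M) : (∫ w, g w ∂Q) ^ 2 ≤ M := by
  have hL := memLp_two_of_lintegral_sq_le hg hint
  have h1 := variance_nonneg g Q
  rw [variance_eq_sub hL] at h1
  have h2 : ∫ w, (g ^ 2) w ∂Q ≤ M := by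
    change ∫ w, g w ^ 2 ∂Q ≤ M
    rw [integral_eq_lintegral_of_nonneg_ae (Filter.Eventually.of_forall fun w => sq_nonneg _)
      (hg.pow_const 2).aestronglyMeasurable]
    exact ENNReal.toReal_le_of_le_ofReal hM hint
  linarith

/-- The empirical fourth moment of the Lipschitz constant is bounded with high probability, as its
eighth moment is finite. -/
lemma measure_sum_pow_four_gt_le {𝒳 ι : Type*} [MeasurableSpace 𝒳] [Fintype ι] [Nonempty ι]
    {Q : Measure 𝒳} [IsProbabilityMeasure Q] {L : 𝒳 → ℝ} (hL : Measurable L) {C : ℝ} (hC : 0 < C)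
    (hint : ∫⁻ w, ENNReal.ofReal (L w ^ 8) ∂Q ≤ ENNReal.ofReal ((C / 2) ^ 8)) :
    (Measure.pi fun _ : ι => Q) {v | Fintype.card ι * C ^ 4 < ∑ i, L (v i) ^ 4} ≤
      ENNReal.ofReal (1 / (4 * Fintype.card ι)) := by
  have hN : (0 : ℝ) < Fintype.card ι := by exact_mod_cast Fintype.card_pos
  have hint' : ∫⁻ w, ENNReal.ofReal ((L w ^ 4) ^ 2) ∂Q ≤ ENNReal.ofReal ((C / 2) ^ 8) := by
    simpa only [← pow_mul] using hint
  have hmean : ∫ w, L w ^ 4 ∂Q ≤ C ^ 4 / 16 := by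
    have h1 := integral_sq_le_of_lintegral_sq_le (hL.pow_const 4) (by positivity) hint'
    have h2 : (C / 2) ^ 8 = (C ^ 4 / 16) ^ 2 := by ring
    rw [h2] at h1
    exact (abs_le_of_sq_le_sq' h1 (by positivity)).2
  refine (measure_mono fun v hv => ?_).trans (measure_sum_sub_sq_gt_le (ι := ι) (hL.pow_const 4)
    (M := (C / 2) ^ 8) (c := 4 * Fintype.card ι) (by positivity) (by positivity) hint')
  have hv' : Fintype.card ι * C ^ 4 < ∑ i, L (v i) ^ 4 := hv
  have h3 := mul_le_mul_of_nonneg_left hmean hN.le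
  have h4 : Fintype.card ι * C ^ 4 / 2 <
      ∑ i, L (v i) ^ 4 - Fintype.card ι * ∫ w, L w ^ 4 ∂Q := by
    have : 0 < Fintype.card ι * C ^ 4 := by positivity
    linarith
  have h5 : (Fintype.card ι * C ^ 4 / 2) ^ 2 <
      (∑ i, L (v i) ^ 4 - Fintype.card ι * ∫ w, L w ^ 4 ∂Q) ^ 2 :=
    pow_lt_pow_left₀ h4 (by positivity) two_ne_zero
  refine lt_of_le_of_lt ?_ h5
  have h6 : 4 * (Fintype.card ι : ℝ) * (Fintype.card ι * (C / 2) ^ 8) =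
      (Fintype.card ι * C ^ 4) ^ 2 / 64 := by ring
  rw [h6]
  have : 0 < (Fintype.card ι * C ^ 4) ^ 2 := by positivity
  nlinarith

section
variable {p : ℕ} {𝒴 : Type*} [MeasurableSpace 𝒴] {P : Measure (Obs p 𝒴)} [IsProbabilityMeasure P]
  {m : ℝ → 𝒴 → ℝ} {Θ : Set (Fin p → ℝ)} {θ₀ : Fin p → ℝ}
  {ι : Type*} [Fintype ι]

/-- Concentration of the empirical risk increments, uniformly over the parameters in the
intersection of an `ℓ¹` ball and an `ℓ²` ball around the target. -/
lemma measure_exists_increment_gt_le [Nonempty ι] {n : ℕ} {cL CL B CX ζ r u y : ℝ} (hp : 0 < p)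
    (hm : Measurable (Function.uncurry m)) (hconvex : ConvexLoss m)
    (hdiff : DifferentiableIntegrable P m Θ) (hθ₀ : θ₀ ∈ Θ) (hlocal : LocalLoss P m Θ θ₀ cL CL)
    (hcard : Fintype.card ι ≤ n) (hCX : 0 < CX) (hu : 0 < u) (hucL : u ≤ cL) (hr : 0 < r)
    (hBr : B * r ≤ cL) (hB : 0 < B) (hy : 0 < y)
    (hyN : 8 * (Fintype.card ι * (CL ^ 2 * u ^ 2)) ≤ y ^ 2)
    (hbdd : (Measure.pi fun _ : ι => P) {v | ¬ ∀ i j, |(v i).1 j| ≤ B} ≤ ENNReal.ofReal ζ)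
    (hfour : (Measure.pi fun _ : ι => P) {v | ¬ ∀ j, ∑ i, (v i).1 j ^ 4 ≤ n * CX ^ 4} ≤
      ENNReal.ofReal ζ) :
    (Measure.pi fun _ : ι => P) {v | ∃ θ ∈ {θ ∈ Θ | l1norm (θ - θ₀) ≤ r ∧ l2norm (θ - θ₀) ≤ u},
        y < |∑ i, (lossAt m θ (v i) - lossAt m θ₀ (v i)) -
          Fintype.card ι * excessRisk P m θ₀ θ|} ≤
      4 * (ENNReal.ofReal
          (4 * p * Real.exp (-((y / 4) ^ 2 / (2 * r ^ 2 * (n * CL ^ 2 * CX ^ 2))))) +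
        (ENNReal.ofReal ζ + ENNReal.ofReal ζ + ENNReal.ofReal (1 / (4 * Fintype.card ι)))) := by
  classical
  obtain ⟨hcL, hCL, ⟨L, hLm, hL0, hLip, hL8⟩, hL2⟩ := hlocal
  have hN : (0 : ℝ) < Fintype.card ι := by exact_mod_cast Fintype.card_pos
  have hcard' : (Fintype.card ι : ℝ) ≤ n := by exact_mod_cast hcard
  have hn : (0 : ℝ) < n := hN.trans_le hcard'
  have hV : 0 < n * CL ^ 2 * CX ^ 2 := by positivity
  refine measure_exists_gt_le_of_finite _
    (fun (v : ι → Obs p 𝒴) θ => ∑ i, (lossAt m θ (v i) - lossAt m θ₀ (v i)))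
    (fun v => continuous_finsetSum _ fun i _ => (continuous_lossAt hconvex (v i)).sub
      continuous_const) (fun θ => Fintype.card ι * excessRisk P m θ₀ θ) fun D hD => ?_
  -- the exceptional set on which the conditional Rademacher bound may fail
  set G : Set (ι → Obs p 𝒴) := ({v | ¬ ∀ i j, |(v i).1 j| ≤ B} ∪
    {v | ¬ ∀ j, ∑ i, (v i).1 j ^ 4 ≤ n * CX ^ 4}) ∪
    ({v | Fintype.card ι * CL ^ 4 < ∑ i, L (v i) ^ 4} ∪
      {v | ¬ ∀ i, ∀ t₁ t₂ : ℝ, max |t₁| |t₂| ≤ cL →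
        |m ((v i).1 ⬝ᵥ θ₀ + t₁) (v i).2 - m ((v i).1 ⬝ᵥ θ₀ + t₂) (v i).2| ≤
          L (v i) * |t₁ - t₂|}) with hGdef
  have hGle : (Measure.pi fun _ : ι => P) G ≤
      ENNReal.ofReal ζ + ENNReal.ofReal ζ + ENNReal.ofReal (1 / (4 * Fintype.card ι)) := by
    refine (measure_union_le _ _).trans (add_le_add
      ((measure_union_le _ _).trans (add_le_add hbdd hfour))
      ((measure_union_le _ _).trans ?_))
    have hae : (Measure.pi fun _ : ι => P) {v | ¬ ∀ i, ∀ t₁ t₂ : ℝ, max |t₁| |t₂| ≤ cL →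
        |m ((v i).1 ⬝ᵥ θ₀ + t₁) (v i).2 - m ((v i).1 ⬝ᵥ θ₀ + t₂) (v i).2| ≤
          L (v i) * |t₁ - t₂|} = 0 := by
      rw [← ae_iff, ae_all_iff]
      intro i
      exact (measurePreserving_eval (fun _ : ι => P) i).quasiMeasurePreserving.ae hLip
    rw [hae, add_zero]
    exact measure_sum_pow_four_gt_le hLm hCL hL8
  refine (measure_exists_sum_sub_gt_le D (fun θ w => lossAt m θ w - lossAt m θ₀ w)
    (fun θ => (measurable_lossAt hm θ).sub (measurable_lossAt hm θ₀))
    (fun θ => Fintype.card ι * excessRisk P m θ₀ θ) ?_ G ?_).trans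
    (mul_le_mul_right (add_le_add_right hGle _) 4)
  · intro θ hθ
    obtain ⟨hΘ, -, hθu⟩ := hD hθ
    have hch := measure_sum_sub_sq_gt_le (ι := ι) (P := P) (c := 2)
      ((measurable_lossAt hm θ).sub (measurable_lossAt hm θ₀)) (by positivity) two_pos
      (hL2 u ⟨hu.le, hucL⟩ θ hΘ hθu)
    simp only [Pi.sub_apply] at hch
    rw [integral_lossAt_sub (hdiff θ₀ hθ₀).2 (hdiff θ hΘ).2] at hch
    refine (measure_mono fun v hv => ?_).trans (hch.trans (le_of_eq ?_))
    · have hv' : y / 2 < |∑ i, (lossAt m θ (v i) - lossAt m θ₀ (v i)) -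
          Fintype.card ι * excessRisk P m θ₀ θ| := hv
      have h1 := pow_lt_pow_left₀ hv' (by positivity) two_ne_zero
      rw [sq_abs] at h1
      change 2 * (Fintype.card ι * (CL ^ 2 * u ^ 2)) < _
      refine lt_of_le_of_lt ?_ h1
      linarith
    · rw [ENNReal.ofReal_div_of_pos two_pos]; simp
  · intro v hv
    simp only [hGdef, Set.mem_union, Set.mem_ofPred_eq, not_or, not_not, not_lt] at hv
    obtain ⟨⟨hvB, hvX⟩, hvL, hvLip⟩ := hv
    have hidx : ∀ i, ∀ θ ∈ D, |(v i).1 ⬝ᵥ (θ - θ₀)| ≤ cL := by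
      intro i θ hθ
      refine (abs_dotProduct_le_mul_l1norm (hvB i) _).trans (le_trans ?_ hBr)
      exact mul_le_mul_of_nonneg_left (hD hθ).2.1 hB.le
    have hloss : ∀ i θ, lossAt m θ (v i) =
        m ((v i).1 ⬝ᵥ θ₀ + (v i).1 ⬝ᵥ (θ - θ₀)) (v i).2 := by
      intro i θ
      rw [dotProduct_sub, add_sub_cancel]
      rfl
    refine card_signs_exceeding_le hp (fun i θ => lossAt m θ (v i) - lossAt m θ₀ (v i))
      (fun i => (v i).1) (fun i => L (v i)) (fun θ => θ - θ₀) hr hV (by positivity)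
      (fun θ hθ => (hD hθ).2.1) ?_ ?_ (fun i => hL0 _) ?_
    · intro i θ hθ θ' hθ'
      rw [sub_sub_sub_cancel_right, hloss, hloss i θ']
      exact hvLip i _ _ (max_le (hidx i θ hθ) (hidx i θ' hθ'))
    · intro i θ hθ
      have h1 := hvLip i ((v i).1 ⬝ᵥ (θ - θ₀)) 0 (max_le (hidx i θ hθ) (by simpa using hcL.le))
      rw [add_zero, sub_zero] at h1
      rw [hloss]
      exact h1
    -- the Cauchy–Schwarz inequality combines the two fourth moments
    · intro j
      refine abs_le_of_sq_le_sq' ?_ hV.le |>.2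
      calc (∑ i, (L (v i) * (v i).1 j) ^ 2) ^ 2
          = (∑ i, L (v i) ^ 2 * (v i).1 j ^ 2) ^ 2 := by simp only [mul_pow]
        _ ≤ (∑ i, (L (v i) ^ 2) ^ 2) * ∑ i, ((v i).1 j ^ 2) ^ 2 :=
            Finset.sum_mul_sq_le_sq_mul_sq _ _ _
        _ = (∑ i, L (v i) ^ 4) * ∑ i, (v i).1 j ^ 4 := by simp only [← pow_mul]
        _ ≤ (n * CL ^ 4) * (n * CX ^ 4) := by
            refine mul_le_mul (hvL.trans ?_) (hvX j)
              (Finset.sum_nonneg fun i _ => by positivity) (by positivity)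
            exact mul_le_mul_of_nonneg_right hcard' (by positivity)
        _ = (n * CL ^ 2 * CX ^ 2) ^ 2 := by ring

end

/-! ### Penalized estimators on favourable data -/

section
variable {p : ℕ}

lemma l1norm_nonneg (δ : Fin p → ℝ) : 0 ≤ l1norm δ :=
  Finset.sum_nonneg fun _ _ => abs_nonneg _

lemma l1norm_smul (κ : ℝ) (δ : Fin p → ℝ) : l1norm (κ • δ) = |κ| * l1norm δ := by
  simp [l1norm, abs_mul, Finset.mul_sum]

lemma l2norm_smul (κ : ℝ) (δ : Fin p → ℝ) : l2norm (κ • δ) = |κ| * l2norm δ := by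
  simp only [l2norm, Pi.smul_apply, smul_eq_mul, mul_pow, ← Finset.mul_sum]
  rw [Real.sqrt_mul (sq_nonneg κ), Real.sqrt_sq_eq_abs]

lemma l1norm_le_add_l1norm_sub (θ θ₀ : Fin p → ℝ) : l1norm θ₀ ≤ l1norm θ + l1norm (θ - θ₀) := by
  rw [l1norm, l1norm, l1norm, ← Finset.sum_add_distrib]
  refine Finset.sum_le_sum fun j _ => ?_
  have := abs_sub_abs_le_abs_sub (θ₀ j) (θ j)
  rw [abs_sub_comm] at this
  simp only [Pi.sub_apply]
  linarith

/-- If the `ℓ¹` norm of `θ` hardly exceeds that of `θ₀`, then `θ - θ₀` is concentrated on the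
support of `θ₀`. -/
lemma l1norm_sub_le_of_l1norm_le {θ θ₀ : Fin p → ℝ} {c₀ : ℝ} (hc₀ : 1 < c₀)
    (h : c₀ * (l1norm θ - l1norm θ₀) ≤ l1norm (θ - θ₀)) :
    l1norm (θ - θ₀) ≤ (1 + cbar c₀) * Real.sqrt (sparsity θ₀) * l2norm (θ - θ₀) := by
  set T := Finset.univ.filter fun j => θ₀ j ≠ 0 with hT
  set a := ∑ j ∈ T, |(θ - θ₀) j|
  set b := ∑ j ∈ Finset.univ.filter (fun j => ¬ θ₀ j ≠ 0), |(θ - θ₀) j| with hb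
  have hab : l1norm (θ - θ₀) = a + b := (Finset.sum_filter_add_sum_filter_not _ _ _).symm
  have hdiff : b - a ≤ l1norm θ - l1norm θ₀ := by
    have e1 : l1norm θ - l1norm θ₀ = ∑ j ∈ T, (|θ j| - |θ₀ j|) +
        ∑ j ∈ Finset.univ.filter (fun j => ¬ θ₀ j ≠ 0), (|θ j| - |θ₀ j|) := by
      rw [Finset.sum_filter_add_sum_filter_not, Finset.sum_sub_distrib, l1norm, l1norm]
    have e2 : -a ≤ ∑ j ∈ T, (|θ j| - |θ₀ j|) := by
      rw [← Finset.sum_neg_distrib]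
      refine Finset.sum_le_sum fun j _ => ?_
      have := abs_sub_abs_le_abs_sub (θ₀ j) (θ j)
      rw [abs_sub_comm] at this
      simp only [Pi.sub_apply]
      linarith
    have e3 : b = ∑ j ∈ Finset.univ.filter (fun j => ¬ θ₀ j ≠ 0), (|θ j| - |θ₀ j|) := by
      refine Finset.sum_congr rfl fun j hj => ?_
      have hj0 : θ₀ j = 0 := not_not.1 (Finset.mem_filter.1 hj).2
      simp [hj0]
    linarith
  have ha : a ≤ Real.sqrt (sparsity θ₀) * l2norm (θ - θ₀) := by
    rw [l2norm, ← Real.sqrt_mul (Nat.cast_nonneg _)]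
    refine Real.le_sqrt_of_sq_le ?_
    refine (sq_sum_le_card_mul_sum_sq).trans ?_
    refine mul_le_mul_of_nonneg_left ?_ (Nat.cast_nonneg _)
    simp only [sq_abs]
    exact Finset.sum_le_sum_of_subset_of_nonneg (Finset.filter_subset _ _) fun _ _ _ => sq_nonneg _
  have hc : 0 < c₀ - 1 := by linarith
  have hba : b ≤ cbar c₀ * a := by
    rw [cbar, div_mul_eq_mul_div, le_div_iff₀ hc]
    rw [hab] at h
    nlinarith [mul_le_mul_of_nonneg_left hdiff (by linarith : (0 : ℝ) ≤ c₀)]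
  have hcb : 0 ≤ 1 + cbar c₀ := by
    have : 0 ≤ cbar c₀ := div_nonneg (by linarith) hc.le
    linarith
  rw [hab, mul_assoc]
  refine le_trans (by linarith : a + b ≤ (1 + cbar c₀) * a) (mul_le_mul_of_nonneg_left ha hcb)

end

section
variable {p : ℕ} {𝒴 : Type*} {m : ℝ → 𝒴 → ℝ} {Θ : Set (Fin p → ℝ)} {θ₀ : Fin p → ℝ}
  {ι : Type*} [Fintype ι]

lemma lossAt_convex_combination_le (hconvex : ConvexLoss m) (w : Obs p 𝒴) (θ : Fin p → ℝ) {κ : ℝ}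
    (h0 : 0 ≤ κ) (h1 : κ ≤ 1) :
    lossAt m (θ₀ + κ • (θ - θ₀)) w ≤ (1 - κ) * lossAt m θ₀ w + κ * lossAt m θ w := by
  have h := (hconvex w.2).2 (Set.mem_univ (w.1 ⬝ᵥ θ₀)) (Set.mem_univ (w.1 ⬝ᵥ θ))
    (sub_nonneg.2 h1) h0 (by ring)
  simp only [smul_eq_mul] at h
  refine le_trans (le_of_eq ?_) h
  unfold lossAt
  congr 1
  rw [dotProduct_add, dotProduct_smul, dotProduct_sub, smul_eq_mul]
  ring

/-- The oracle bound on a favourable event: if the penalty dominates the score and the empirical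
risk increments are concentrated at the scale `u`, a penalized estimator has small excess risk.
The margin condition forces the estimator into the `ℓ²` ball of radius `u`: otherwise a point of
the segment to `θ₀` would lie on the boundary of the ball and violate the margin condition. -/
lemma excessRisk_le_of_isPenalizedMinimizer [MeasurableSpace 𝒴] {P : Measure (Obs p 𝒴)} [Nonempty ι]
    {c₀ cM cM' S l u x : ℝ} (hc₀ : 1 < c₀) (hΘ : Convex ℝ Θ) (hθ₀ : θ₀ ∈ Θ)
    (hconvex : ConvexLoss m) (hmargin : Margin P m Θ θ₀ cM cM') {d : ι → Obs p 𝒴}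
    (hd : ∀ i, DifferentiableAt ℝ (fun t => m t (d i).2) ((d i).1 ⬝ᵥ θ₀))
    (hp : 0 < p) (hl : 0 < l) (hSl : c₀ * S ≤ l)
    (hscore : ∀ j, |∑ i, (d i).1 j * residualAt m θ₀ (d i)| ≤ Fintype.card ι * S)
    (hu : 0 < u) (hemp : ∀ θ ∈ Θ, l1norm (θ - θ₀) ≤ (1 + cbar c₀) * Real.sqrt (sparsity θ₀) * u →
      l2norm (θ - θ₀) ≤ u → |∑ i, (lossAt m θ (d i) - lossAt m θ₀ (d i)) -
        Fintype.card ι * excessRisk P m θ₀ θ| ≤ Fintype.card ι * x)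
    (hcM' : (1 + cbar c₀) * Real.sqrt (sparsity θ₀) * u ≤ cM')
    (hsmall : x + l * ((1 + cbar c₀) * Real.sqrt (sparsity θ₀) * u) ≤ cM * u ^ 2 / 2)
    {θ : Fin p → ℝ} (hθ : IsPenalizedMinimizer m Θ d l θ) :
    excessRisk P m θ₀ θ ≤ x + l * ((1 + cbar c₀) * Real.sqrt (sparsity θ₀) * u) := by
  obtain ⟨hθΘ, hmin⟩ := hθ
  have hN : (0 : ℝ) < Fintype.card ι := by exact_mod_cast Fintype.card_pos
  set r := (1 + cbar c₀) * Real.sqrt (sparsity θ₀) * u with hr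
  have hcb : 0 ≤ 1 + cbar c₀ := by
    have : 0 ≤ cbar c₀ := div_nonneg (by linarith) (by linarith)
    linarith
  -- optimality bounds the increment from above, and the score bounds it from below by convexity
  have hbasic : ∑ i, (lossAt m θ (d i) - lossAt m θ₀ (d i)) ≤
      Fintype.card ι * (l * (l1norm θ₀ - l1norm θ)) := by
    have h1 := hmin θ₀ hθ₀
    simp only [empRisk] at h1
    rw [Finset.sum_sub_distrib]
    have h2 := mul_le_mul_of_nonneg_left h1 hN.le
    rw [mul_add, mul_add, mul_inv_cancel_left₀ hN.ne', mul_inv_cancel_left₀ hN.ne'] at h2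
    linarith
  have hscoreδ : -(Fintype.card ι * S * l1norm (θ - θ₀)) ≤
      ∑ i, (lossAt m θ (d i) - lossAt m θ₀ (d i)) := by
    obtain ⟨j, hj⟩ := exists_abs_dotProduct_le hp
      fun k => ∑ i, (d i).1 k * residualAt m θ₀ (d i)
    have h1 := (neg_le_of_abs_le ((hj (θ - θ₀)).trans
      (mul_le_mul_of_nonneg_left (hscore j) (l1norm_nonneg _))))
    have h2 : ∑ k, (θ - θ₀) k * ∑ i, (d i).1 k * residualAt m θ₀ (d i) =
        ∑ i, residualAt m θ₀ (d i) * ((d i).1 ⬝ᵥ (θ - θ₀)) := by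
      simp only [dotProduct, Finset.mul_sum]
      rw [Finset.sum_comm]
      exact Finset.sum_congr rfl fun i _ => Finset.sum_congr rfl fun k _ => by ring
    rw [h2] at h1
    refine le_trans (by linarith) (Finset.sum_le_sum fun i _ => ?_ :
      ∑ i, residualAt m θ₀ (d i) * ((d i).1 ⬝ᵥ (θ - θ₀)) ≤ _)
    linarith [lossAt_add_residualAt_mul_le hconvex (hd i) θ]
  have hcone : l1norm (θ - θ₀) ≤
      (1 + cbar c₀) * Real.sqrt (sparsity θ₀) * l2norm (θ - θ₀) := by
    refine l1norm_sub_le_of_l1norm_le hc₀ ?_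
    have h1 : Fintype.card ι * (l * (l1norm θ - l1norm θ₀)) ≤
        Fintype.card ι * (S * l1norm (θ - θ₀)) := by linarith
    have h2 := le_of_mul_le_mul_left h1 hN
    have h3 := mul_le_mul_of_nonneg_right hSl (l1norm_nonneg (θ - θ₀))
    have h4 : l * (c₀ * (l1norm θ - l1norm θ₀)) ≤ l * l1norm (θ - θ₀) := by
      have := mul_le_mul_of_nonneg_left h2 (by linarith : 0 ≤ c₀)
      linarith
    exact le_of_mul_le_mul_left h4 hl
  -- the excess risk at any point of the segment that lies in the ball
  have hseg : ∀ κ : ℝ, 0 ≤ κ → κ ≤ 1 → l2norm (κ • (θ - θ₀)) ≤ u →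
      θ₀ + κ • (θ - θ₀) ∈ Θ ∧ l1norm (κ • (θ - θ₀)) ≤ r ∧
      excessRisk P m θ₀ (θ₀ + κ • (θ - θ₀)) ≤ x + l * r := by
    intro κ h0 h1 h2
    have hmem : θ₀ + κ • (θ - θ₀) ∈ Θ := hΘ.add_smul_sub_mem hθ₀ hθΘ ⟨h0, h1⟩
    have hl1 : l1norm (κ • (θ - θ₀)) ≤ r := by
      rw [l1norm_smul, abs_of_nonneg h0]
      rw [l2norm_smul, abs_of_nonneg h0] at h2
      calc κ * l1norm (θ - θ₀)
          ≤ κ * ((1 + cbar c₀) * Real.sqrt (sparsity θ₀) * l2norm (θ - θ₀)) :=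
            mul_le_mul_of_nonneg_left hcone h0
        _ = (1 + cbar c₀) * Real.sqrt (sparsity θ₀) * (κ * l2norm (θ - θ₀)) := by ring
        _ ≤ r := mul_le_mul_of_nonneg_left h2 (mul_nonneg hcb (Real.sqrt_nonneg _))
    refine ⟨hmem, hl1, ?_⟩
    have h3 := hemp _ hmem (by rwa [add_sub_cancel_left]) (by rwa [add_sub_cancel_left])
    have h4 : ∑ i, (lossAt m (θ₀ + κ • (θ - θ₀)) (d i) - lossAt m θ₀ (d i)) ≤
        κ * ∑ i, (lossAt m θ (d i) - lossAt m θ₀ (d i)) := by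
      rw [Finset.mul_sum]
      refine Finset.sum_le_sum fun i _ => ?_
      linarith [lossAt_convex_combination_le (θ₀ := θ₀) hconvex (d i) θ h0 h1]
    have h5 := mul_le_mul_of_nonneg_left hbasic h0
    have h6 : κ * (l1norm θ₀ - l1norm θ) ≤ r := by
      rw [l1norm_smul, abs_of_nonneg h0] at hl1
      refine (mul_le_mul_of_nonneg_left ?_ h0).trans hl1
      linarith [l1norm_le_add_l1norm_sub θ θ₀]
    have h7 := mul_le_mul_of_nonneg_left h6 (mul_nonneg hN.le hl.le)
    refine le_of_mul_le_mul_left ?_ hN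
    linarith [neg_le_of_abs_le h3]
  rcases le_or_gt (l2norm (θ - θ₀)) u with hle | hgt
  · have := (hseg 1 zero_le_one le_rfl (by rwa [one_smul])).2.2
    rwa [one_smul, add_sub_cancel] at this
  · exfalso
    have hpos : 0 < l2norm (θ - θ₀) := hu.trans hgt
    have hκ0 : 0 ≤ u / l2norm (θ - θ₀) := by positivity
    have hnorm : l2norm ((u / l2norm (θ - θ₀)) • (θ - θ₀)) = u := by
      rw [l2norm_smul, abs_of_nonneg hκ0, div_mul_cancel₀ _ hpos.ne']
    obtain ⟨hmem, hl1, hex⟩ := hseg (u / l2norm (θ - θ₀)) hκ0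
      ((div_le_one hpos).2 hgt.le) hnorm.le
    have hm := hmargin.2.2 _ hmem (by rw [add_sub_cancel_left]; exact hl1.trans hcM')
    rw [add_sub_cancel_left, hnorm] at hm
    have : 0 < cM * u ^ 2 := mul_pos hmargin.1 (by positivity)
    linarith

end

/-! ### The excess risk of a subsample estimator -/

lemma cbar_pos {c₀ : ℝ} (hc₀ : 1 < c₀) : 0 < cbar c₀ :=
  div_pos (by linarith) (by linarith)

lemma Ceps_pos {c₀ CL CX : ℝ} (hc₀ : 1 < c₀) (hCL : 0 < CL) (hCX : 0 < CX) :
    0 < Ceps c₀ CL CX := by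
  have := cbar_pos hc₀
  unfold Ceps
  positivity

lemma CS_pos {K : ℕ} {cD CX σ : ℝ} (hK : 2 ≤ K) (hcD : 0 < cD) (hCX : 0 < CX) (hσ : 0 < σ) :
    0 < CS K cD CX σ := by
  have : (2 : ℝ) ≤ K := by exact_mod_cast hK
  have : 0 < (K : ℝ) - 1 := by linarith
  unfold CS
  positivity

lemma Cfactor_pos {K : ℕ} {c₀ CL CX cD σ a : ℝ} (hK : 2 ≤ K) (hc₀ : 1 < c₀) (hCL : 0 < CL)
    (hCX : 0 < CX) (hcD : 0 < cD) (hσ : 0 < σ) (ha : 0 < a) :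
    0 < Cfactor K c₀ CL CX cD σ a := by
  have h1 : (2 : ℝ) ≤ K := by exact_mod_cast hK
  have h2 : 0 < (K : ℝ) - 1 := by linarith
  have h3 := cbar_pos hc₀
  have h4 := Ceps_pos hc₀ hCL hCX
  have h5 := CS_pos hK hcD hCX hσ
  unfold Cfactor
  positivity

lemma Ceps_sq (c₀ CL CX : ℝ) : Ceps c₀ CL CX ^ 2 = 512 * (1 + cbar c₀) ^ 2 * CL ^ 2 * CX ^ 2 := by
  have h : Real.sqrt 2 ^ 2 = 2 := Real.sq_sqrt (by norm_num)
  calc Ceps c₀ CL CX ^ 2 = 256 * Real.sqrt 2 ^ 2 * (1 + cbar c₀) ^ 2 * CL ^ 2 * CX ^ 2 := by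
        unfold Ceps; ring
    _ = _ := by rw [h]; ring

/-- The level for the increments is large compared with their standard deviation, as Chebyshev's
inequality within the symmetrization argument requires. -/
lemma level_sq_ge {N n q x u w Ce CL : ℝ} (hn : 0 < n) (hq : 0 < q) (hN : q * n ≤ N) (hCL : 0 < CL)
    (h : 16 * q * CL ^ 2 ≤ Ce ^ 2 * w) (hx : x ^ 2 = Ce ^ 2 * w * u ^ 2 / (q ^ 2 * n)) :
    8 * (N * (CL ^ 2 * u ^ 2)) ≤ (N * x) ^ 2 := by
  have hN0 : 0 < N := (mul_pos hq hn).trans_le hN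
  have h1 : 16 * q * CL ^ 2 * u ^ 2 ≤ x ^ 2 * (q ^ 2 * n) := by
    rw [hx, div_mul_cancel₀ _ (by positivity)]
    exact mul_le_mul_of_nonneg_right h (sq_nonneg u)
  have h2 : q * (16 * CL ^ 2 * u ^ 2) ≤ q * (x ^ 2 * (q * n)) := by linarith
  have h3 := le_of_mul_le_mul_left h2 hq
  have h4 := mul_le_mul_of_nonneg_left hN (sq_nonneg x)
  have h5 := mul_le_mul_of_nonneg_left (h3.trans h4) hN0.le
  have h6 : 0 ≤ N * (CL ^ 2 * u ^ 2) := by positivity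
  linarith

/-- With the increment level `x`, of squared size `512 C_L² C_X² lg r² / (q² n)`, the Rademacher
tail bound has exponent at least `2 lg`. -/
lemma increment_exponent_ge {N n q x r lg CL CX : ℝ} (hn : 0 < n) (hq : 0 < q) (hN : q * n ≤ N)
    (hlg : 0 ≤ lg) (hr : 0 < r) (hC : 0 < CL ^ 2 * CX ^ 2)
    (hx : x ^ 2 = 512 * (CL ^ 2 * CX ^ 2) * lg * r ^ 2 / (q ^ 2 * n)) :
    2 * lg ≤ (N * x / 4) ^ 2 / (2 * r ^ 2 * (n * CL ^ 2 * CX ^ 2)) := by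
  have h1 : (q * n) ^ 2 ≤ N ^ 2 := pow_le_pow_left₀ (by positivity) hN 2
  rw [mul_assoc n, le_div_iff₀ (by positivity)]
  have h2 := mul_le_mul_of_nonneg_right h1 (sq_nonneg x)
  have h3 : (q * n) ^ 2 * x ^ 2 = n * (512 * (CL ^ 2 * CX ^ 2) * lg * r ^ 2) := by
    rw [hx]; field_simp
  have h4 : 0 ≤ n * ((CL ^ 2 * CX ^ 2) * lg * r ^ 2) := by positivity
  linarith

/-- With the score level `y = C_S √(lg / n)` the sub-Gaussian tail bound has exponent at least
`2 lg`. -/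
lemma score_exponent_ge {N n q y lg σ CX : ℝ} (hn : 0 < n) (hq : 0 < q) (hN : q * n ≤ N)
    (hσ : 0 < σ) (hCX : 0 < CX)
    (hy : y ^ 2 = (2 * CX * σ) ^ 2 * lg / (q ^ 2 * n)) :
    2 * lg ≤ (N * y) ^ 2 / (2 * σ ^ 2 * (n * CX ^ 2)) := by
  have h1 : (q * n) ^ 2 ≤ N ^ 2 := pow_le_pow_left₀ (by positivity) hN 2
  rw [le_div_iff₀ (by positivity)]
  have h2 := mul_le_mul_of_nonneg_right h1 (sq_nonneg y)
  have h3 : (q * n) ^ 2 * y ^ 2 = n * ((2 * CX * σ) ^ 2 * lg) := by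
    rw [hy]; field_simp
  linarith

lemma exp_neg_le_of_two_mul_log_le {z e : ℝ} (hz : 0 < z) (he : 2 * Real.log z ≤ e) :
    Real.exp (-e) ≤ 1 / z ^ 2 := by
  refine (Real.exp_le_exp.2 (neg_le_neg he)).trans (le_of_eq ?_)
  rw [Real.exp_neg, two_mul, Real.exp_add, Real.exp_log hz, one_div, sq]

section
variable {p : ℕ} {𝒴 : Type*} [MeasurableSpace 𝒴] {P : Measure (Obs p 𝒴)} [IsProbabilityMeasure P]
  {m : ℝ → 𝒴 → ℝ} {Θ : Set (Fin p → ℝ)} {θ₀ : Fin p → ℝ} {ι : Type*} [Fintype ι] [Nonempty ι]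

/-- With high probability, all penalized estimators on a subsample whose penalty has the order of
the score have excess risk of the order `s ln(pn) / n`. -/
lemma measure_not_oracle_bound_le {n s K : ℕ} (hn : 3 ≤ n) (hp : 2 ≤ p)
    (hm : Measurable (Function.uncurry m)) (hs : s = sparsity θ₀) (hs1 : 1 ≤ s) (hθ₀ : θ₀ ∈ Θ)
    {c₀ cM cM' ζ B CX cL CL cD a σ Cms1 : ℝ} (hc₀ : 1 < c₀) (hΘ : Convex ℝ Θ)
    (hconvex : ConvexLoss m) (hdiff : DifferentiableIntegrable P m Θ)
    (hmargin : Margin P m Θ θ₀ cM cM') (hζ : 0 < ζ) (hB : 1 ≤ B) (hCX : 0 < CX)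
    (hlocal : LocalLoss P m Θ θ₀ cL CL) (hres : ResidualCV P m Θ θ₀ σ Cms1)
    (hK : 2 ≤ K) (hcD : 0 < cD) (ha0 : 0 < a)
    (hcard : Fintype.card ι ≤ n) (hcard' : ((K : ℝ) - 1) * cD * n ≤ Fintype.card ι)
    (hbdd : (Measure.pi fun _ : ι => P) {v | ¬ ∀ i j, |(v i).1 j| ≤ B} ≤ ENNReal.ofReal ζ)
    (hfour : (Measure.pi fun _ : ι => P) {v | ¬ ∀ j, ∑ i, (v i).1 j ^ 4 ≤ n * CX ^ 4} ≤
      ENNReal.ofReal ζ)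
    (h1 : 16 * ((K : ℝ) - 1) * cD * CL ^ 2 / Ceps c₀ CL CX ^ 2 ≤ s * Real.log (p * n))
    (h2 : (1 + cbar c₀) * utilde n p s K c₀ cM CL CX cD σ a * Real.sqrt s ≤ min (cL / B) cM') :
    (Measure.pi fun _ : ι => P) {v | ¬ ∀ l θ,
        c₀ * CS K cD CX σ * Real.sqrt (Real.log (p * n) / n) ≤ l →
        l ≤ c₀ * CS K cD CX σ * Real.sqrt (Real.log (p * n) / n) / a →
        IsPenalizedMinimizer m Θ v l θ →
        excessRisk P m θ₀ θ ≤ Crisk K c₀ cM CL CX cD σ a ^ 2 * (s * Real.log (p * n) / n)} ≤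
      ENNReal.ofReal (5 / n + 9 * ζ + 1 / (((K : ℝ) - 1) * cD * n)) := by
  obtain ⟨hσ, -, hU, -⟩ := hres
  have hcM : 0 < cM := hmargin.1
  have hcL : 0 < cL := hlocal.1
  have hCL : 0 < CL := hlocal.2.1
  have hn' : (3 : ℝ) ≤ n := by exact_mod_cast hn
  have hp' : (2 : ℝ) ≤ p := by exact_mod_cast hp
  have hs' : (1 : ℝ) ≤ s := by exact_mod_cast hs1
  have hK' : (2 : ℝ) ≤ K := by exact_mod_cast hK
  have hpn : (6 : ℝ) ≤ p * n := by nlinarith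
  set q : ℝ := ((K : ℝ) - 1) * cD with hq
  have hq0 : 0 < q := mul_pos (by linarith) hcD
  set lg := Real.log (p * n) with hlg
  have hlg0 : 0 < lg := Real.log_pos (by linarith)
  set N : ℝ := (Fintype.card ι : ℝ) with hN
  have hN0 : 0 < N := by rw [hN]; exact_mod_cast Fintype.card_pos
  have hNn : N ≤ n := by rw [hN]; exact_mod_cast hcard
  have hn0 : (0 : ℝ) < n := by linarith
  have hcb := cbar_pos hc₀
  have hCe := Ceps_pos hc₀ hCL hCX
  have hCS := CS_pos hK hcD hCX hσ
  have hF := Cfactor_pos hK hc₀ hCL hCX hcD hσ ha0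
  set F := Cfactor K c₀ CL CX cD σ a with hFdef
  set Ce := Ceps c₀ CL CX with hCedef
  set Cs := CS K cD CX σ with hCsdef
  have hFeq : F = Ce / q + (1 + cbar c₀) * c₀ * Cs / a := rfl
  clear_value q
  set rt := Real.sqrt (s * lg / n) with hrt
  have hrt0 : 0 < rt := Real.sqrt_pos.2 (by positivity)
  have hrtsq : rt ^ 2 = s * lg / n := Real.sq_sqrt (by positivity)
  set sl := Real.sqrt (lg / n) with hsl
  have hsl0 : 0 < sl := Real.sqrt_pos.2 (by positivity)
  have hslsq : sl ^ 2 = lg / n := Real.sq_sqrt (by positivity)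
  set ss := Real.sqrt s with hss
  have hss1 : 1 ≤ ss := Real.one_le_sqrt.2 hs'
  have hsssq : ss ^ 2 = s := Real.sq_sqrt (by positivity)
  have hrtsl : ss * sl = rt := by
    rw [hss, hsl, hrt, ← Real.sqrt_mul (by positivity), mul_div_assoc]
  set u := utilde n p s K c₀ cM CL CX cD σ a with hu
  have hueq : u = 2 / cM * F * rt := rfl
  have hu0 : 0 < u := by rw [hueq]; positivity
  set x := Ce / q * rt * u with hx
  have hx0 : 0 < x := by positivity
  set r := (1 + cbar c₀) * ss * u with hr
  have hr0 : 0 < r := by positivity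
  have hr2 : r ≤ min (cL / B) cM' := by
    refine le_trans (le_of_eq ?_) h2
    rw [hr]; ring
  have hBr : B * r ≤ cL := by
    have := (le_div_iff₀ (by linarith : 0 < B)).1 (hr2.trans (min_le_left _ _))
    linarith
  have hur : u ≤ r := by
    rw [hr]
    exact le_mul_of_one_le_left hu0.le
      (one_le_mul_of_one_le_of_one_le (by linarith) hss1)
  have hucL : u ≤ cL := hur.trans ((le_mul_of_one_le_left hr0.le hB).trans hBr)
  have h1' : 16 * q * CL ^ 2 ≤ Ce ^ 2 * (s * lg) := by
    rw [div_le_iff₀ (by positivity)] at h1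
    rw [hq]; linarith
  -- the two levels satisfy the requirements of the probability bounds
  have hx2 : x ^ 2 = Ce ^ 2 * (s * lg / n) * u ^ 2 / q ^ 2 := by
    rw [← hrtsq, hx]; ring
  have hr2' : r ^ 2 = (1 + cbar c₀) ^ 2 * s * u ^ 2 := by
    rw [← hsssq, hr]; ring
  have hs2 : (Cs * sl) ^ 2 = (2 * CX * σ) ^ 2 * (lg / n) / q ^ 2 := by
    rw [← hslsq, hCsdef, CS, ← hq]; ring
  have hyN := level_sq_ge (x := x) (u := u) (w := s * lg) hn0 hq0 hcard' hCL h1' (by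
    rw [hx2]; ring)
  have hexp1 : 2 * lg ≤ (N * x / 4) ^ 2 / (2 * r ^ 2 * (n * CL ^ 2 * CX ^ 2)) :=
    increment_exponent_ge hn0 hq0 hcard' hlg0.le hr0 (by positivity) (by
      rw [hx2, hr2', hCedef, Ceps_sq]; ring)
  have hexp2 : 2 * lg ≤ (N * (Cs * sl)) ^ 2 / (2 * σ ^ 2 * (n * CX ^ 2)) :=
    score_exponent_ge hn0 hq0 hcard' hσ hCX (by rw [hs2]; ring)
  have hevent1 := measure_exists_increment_gt_le (ι := ι) (by omega) hm hconvex hdiff hθ₀ hlocal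
    hcard hCX hu0 hucL hr0 hBr (by linarith) (by positivity : 0 < N * x) hyN hbdd hfour
  have hevent2 := measure_exists_score_gt_le (ι := ι) (P := P) hσ
    (measurable_residualAt hm hconvex θ₀) hU (by positivity : 0 < n * CX ^ 2)
    (by positivity : 0 < N * (Cs * sl))
  have hevent0 : (Measure.pi fun _ : ι => P)
      {v | ¬ ∀ i, DifferentiableAt ℝ (fun t => m t (v i).2) ((v i).1 ⬝ᵥ θ₀)} = 0 := by
    rw [← ae_iff, ae_all_iff]
    intro i
    exact (measurePreserving_eval (fun _ : ι => P) i).quasiMeasurePreserving.ae (hdiff θ₀ hθ₀).1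
  set A0 := {v : ι → Obs p 𝒴 | ¬ ∀ i, DifferentiableAt ℝ (fun t => m t (v i).2) ((v i).1 ⬝ᵥ θ₀)}
  set A1 := {v : ι → Obs p 𝒴 | ∃ θ ∈ {θ ∈ Θ | l1norm (θ - θ₀) ≤ r ∧ l2norm (θ - θ₀) ≤ u},
    N * x < |∑ i, (lossAt m θ (v i) - lossAt m θ₀ (v i)) - N * excessRisk P m θ₀ θ|} with hA1
  set A2 := {v : ι → Obs p 𝒴 | (∀ j, ∑ i, (v i).1 j ^ 2 ≤ n * CX ^ 2) ∧
    ∃ j, N * (Cs * sl) < |∑ i, (v i).1 j * residualAt m θ₀ (v i)|} with hA2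
  set A3 := {v : ι → Obs p 𝒴 | ¬ ∀ j, ∑ i, (v i).1 j ^ 4 ≤ n * CX ^ 4} with hA3
  -- off the four exceptional events the deterministic oracle bound applies
  have hsub : {v : ι → Obs p 𝒴 | ¬ ∀ l θ, c₀ * Cs * sl ≤ l → l ≤ c₀ * Cs * sl / a →
        IsPenalizedMinimizer m Θ v l θ →
        excessRisk P m θ₀ θ ≤ Crisk K c₀ cM CL CX cD σ a ^ 2 * (s * lg / n)} ⊆
      (A0 ∪ A1) ∪ (A2 ∪ A3) := by
    intro v hv
    by_contra hcon
    simp only [Set.mem_union, not_or] at hcon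
    obtain ⟨⟨hv0, hv1⟩, hv2, hv3⟩ := hcon
    simp only [hA3, Set.mem_ofPred_eq, not_not] at hv3
    have hsq : ∀ j, ∑ i, (v i).1 j ^ 2 ≤ n * CX ^ 2 := by
      intro j
      refine (abs_le_of_sq_le_sq' ?_ (by positivity : (0 : ℝ) ≤ n * CX ^ 2)).2
      calc (∑ i, (v i).1 j ^ 2) ^ 2 ≤ N * ∑ i, ((v i).1 j ^ 2) ^ 2 :=
            sq_sum_le_card_mul_sum_sq
        _ = N * ∑ i, (v i).1 j ^ 4 := by simp only [← pow_mul]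
        _ ≤ n * (n * CX ^ 4) := mul_le_mul hNn (hv3 j)
            (Finset.sum_nonneg fun i _ => by positivity) hn0.le
        _ = (n * CX ^ 2) ^ 2 := by ring
    refine hv fun l θ hl1 hl2 hθ => ?_
    have hlr : x + l * r ≤ F * rt * u := by
      have e1 : l * r ≤ c₀ * Cs * sl / a * r := mul_le_mul_of_nonneg_right hl2 hr0.le
      have e2 : c₀ * Cs * sl / a * r = (1 + cbar c₀) * c₀ * Cs / a * rt * u := by
        rw [hr, ← hrtsl]; ring
      rw [hFeq, hx]
      linarith
    -- `u` is the scale at which the oracle bound balances with the margin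
    have hFu : F * rt * u = cM * u ^ 2 / 2 := by
      have : F * rt = cM * u / 2 := by rw [hueq]; field_simp
      rw [this]; ring
    have hbound := excessRisk_le_of_isPenalizedMinimizer (S := Cs * sl) (x := x) hc₀ hΘ hθ₀ hconvex
      hmargin (not_not.1 hv0) (by omega) (lt_of_lt_of_le (by positivity) hl1)
      (by linarith) (fun j => ?_) hu0 ?_ ?_ ?_ hθ
    · rw [← hs, ← hss, ← hr] at hbound
      refine hbound.trans (hlr.trans (le_of_eq ?_))
      have : Crisk K c₀ cM CL CX cD σ a ^ 2 = 2 / cM * F ^ 2 := by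
        rw [Crisk, mul_pow, Real.sq_sqrt (by positivity)]
      rw [this, ← hrtsq, hueq]; ring
    · by_contra hlt
      exact hv2 ⟨hsq, j, not_le.1 hlt⟩
    · intro θ' hθ' h1' h2'
      rw [← hs, ← hss, ← hr] at h1'
      by_contra hlt
      exact hv1 ⟨θ', ⟨hθ', h1', h2'⟩, not_le.1 hlt⟩
    · rw [← hs, ← hss, ← hr]; exact hr2.trans (min_le_right _ _)
    · rw [← hs, ← hss, ← hr]; linarith
  -- the union bound over coordinates costs a factor `p`, which `(pn)⁻²` absorbs
  have hpn2 : ∀ e, 2 * lg ≤ e → p * Real.exp (-e) ≤ 1 / (6 * n) := by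
    intro e he
    have e1 := exp_neg_le_of_two_mul_log_le (by linarith : (0 : ℝ) < p * n) he
    have e2 : (p : ℝ) * Real.exp (-e) ≤ p * (1 / (p * n) ^ 2) :=
      mul_le_mul_of_nonneg_left e1 (by linarith)
    refine e2.trans ?_
    have e3 : (p : ℝ) * (1 / (p * n) ^ 2) = 1 / (p * n * n) := by
      have : (p : ℝ) ≠ 0 := by linarith
      field_simp
    rw [e3]
    exact one_div_le_one_div_of_le (by positivity) (mul_le_mul_of_nonneg_right hpn hn0.le)
  refine (measure_mono hsub).trans ?_
  calc _ ≤ (Measure.pi fun _ : ι => P) (A0 ∪ A1) + (Measure.pi fun _ : ι => P) (A2 ∪ A3) :=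
        measure_union_le _ _
    _ ≤ ((Measure.pi fun _ : ι => P) A0 + (Measure.pi fun _ : ι => P) A1) +
        ((Measure.pi fun _ : ι => P) A2 + (Measure.pi fun _ : ι => P) A3) :=
        add_le_add (measure_union_le _ _) (measure_union_le _ _)
    _ ≤ (0 + 4 * (ENNReal.ofReal (4 * (1 / (6 * n))) + (ENNReal.ofReal ζ + ENNReal.ofReal ζ +
        ENNReal.ofReal (1 / (4 * N))))) +
        (ENNReal.ofReal (2 * (1 / (6 * n))) + ENNReal.ofReal ζ) := by
        refine add_le_add (add_le_add hevent0.le (hevent1.trans ?_))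
          (add_le_add (hevent2.trans ?_) hfour)
        · refine mul_le_mul_right (add_le_add_left (ENNReal.ofReal_le_ofReal ?_) _) 4
          rw [mul_assoc]
          exact mul_le_mul_of_nonneg_left (hpn2 _ hexp1) (by norm_num)
        · refine ENNReal.ofReal_le_ofReal ?_
          rw [mul_assoc]
          exact mul_le_mul_of_nonneg_left (hpn2 _ hexp2) (by norm_num)
    _ = ENNReal.ofReal (4 * (4 * (1 / (6 * n)) + (ζ + ζ + 1 / (4 * N))) +
        (2 * (1 / (6 * n)) + ζ)) := by
        rw [zero_add, show (4 : ENNReal) = ENNReal.ofReal 4 by simp,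
          ← ENNReal.ofReal_add (by positivity) (by positivity),
          ← ENNReal.ofReal_add (by positivity) (by positivity),
          ← ENNReal.ofReal_add (by positivity) (by positivity),
          ← ENNReal.ofReal_mul (by positivity),
          ← ENNReal.ofReal_add (by positivity) (by positivity),
          ← ENNReal.ofReal_add (by positivity) (by positivity)]
    _ ≤ _ := by
        refine ENNReal.ofReal_le_ofReal ?_
        have e1 : 1 / N ≤ 1 / (q * n) := one_div_le_one_div_of_le (by positivity) hcard'
        have e2 : 4 * (4 * (1 / (6 * (n : ℝ))) + (ζ + ζ + 1 / (4 * N))) + (2 * (1 / (6 * n)) + ζ) =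
            3 / n + 9 * ζ + 1 / N := by field_simp; ring
        have e3 : (3 : ℝ) / n ≤ 5 / n := by gcongr; norm_num
        rw [e2]
        linarith

end

/-! ### Held-out losses and residuals -/

section
variable {p : ℕ} {𝒴 : Type*} [MeasurableSpace 𝒴]

/-- The properties of a parameter `θ ∈ Θ` that are used for held-out data. Unlike membership in
`Θ`, which is an arbitrary convex set, they define a measurable set of parameters. -/
def IsRegularParameter (P : Measure (Obs p 𝒴)) (m : ℝ → 𝒴 → ℝ) (θ₀ : Fin p → ℝ) (Cms Cms1 : ℝ)
    (θ : Fin p → ℝ) : Prop :=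
  0 ≤ excessRisk P m θ₀ θ ∧
  ∫⁻ w, ENNReal.ofReal ((lossAt m θ w - lossAt m θ₀ w) ^ 2) ∂P
    ≤ ENNReal.ofReal (Cms ^ 2 * max (excessRisk P m θ₀ θ) (excessRisk P m θ₀ θ ^ 2)) ∧
  ∫⁻ w, ENNReal.ofReal ((residualAt m θ w - residualAt m θ₀ w) ^ 2) ∂P
    ≤ ENNReal.ofReal (Cms1 ^ 2 * max (Real.sqrt (excessRisk P m θ₀ θ)) (excessRisk P m θ₀ θ))

/-- The held-out data for which the total loss increment of `θ`, or its summed squared residual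
error, is far from what the excess risk of `θ` predicts. The deviations are scaled so that the
probability is at most `2 / R` if `θ` is regular. -/
def heldOutFailure {ι : Type*} [Fintype ι] (P : Measure (Obs p 𝒴)) (m : ℝ → 𝒴 → ℝ)
    (θ₀ : Fin p → ℝ) (Cms Cms1 R : ℝ) (θ : Fin p → ℝ) : Set (ι → Obs p 𝒴) :=
  {v | R * (Fintype.card ι *
      (Cms ^ 2 * max (excessRisk P m θ₀ θ) (excessRisk P m θ₀ θ ^ 2))) <
        (∑ i, (lossAt m θ (v i) - lossAt m θ₀ (v i)) -
          Fintype.card ι * excessRisk P m θ₀ θ) ^ 2} ∪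
  {v | R * (Fintype.card ι *
      (Cms1 ^ 2 * max (Real.sqrt (excessRisk P m θ₀ θ)) (excessRisk P m θ₀ θ))) <
        ∑ i, (residualAt m θ (v i) - residualAt m θ₀ (v i)) ^ 2}

variable {P : Measure (Obs p 𝒴)} [IsProbabilityMeasure P] {m : ℝ → 𝒴 → ℝ} {θ₀ : Fin p → ℝ}
  {Cms Cms1 R : ℝ} {ι : Type*} [Fintype ι]

lemma measurableSet_isRegularParameter (hm : Measurable (Function.uncurry m))
    (hconvex : ConvexLoss m) : MeasurableSet {θ | IsRegularParameter P m θ₀ Cms Cms1 θ} := by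
  have hE := measurable_excessRisk hm P θ₀
  simp only [IsRegularParameter, measurableSet_setOfPred]
  refine (measurableSet_setOfPred.1 (measurableSet_le measurable_const hE)).and
    ((measurableSet_setOfPred.1 (measurableSet_le ?_ ?_)).and
      (measurableSet_setOfPred.1 (measurableSet_le ?_ ?_)))
  · refine Measurable.lintegral_prod_right' (f := fun z : (Fin p → ℝ) × Obs p 𝒴 =>
      ENNReal.ofReal ((lossAt m z.1 z.2 - lossAt m θ₀ z.2) ^ 2)) ?_
    exact (((measurable_lossAt_uncurry hm).sub
      ((measurable_lossAt hm θ₀).comp measurable_snd)).pow_const 2).ennreal_ofReal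
  · exact ((hE.max (hE.pow_const 2)).const_mul _).ennreal_ofReal
  · refine Measurable.lintegral_prod_right' (f := fun z : (Fin p → ℝ) × Obs p 𝒴 =>
      ENNReal.ofReal ((residualAt m z.1 z.2 - residualAt m θ₀ z.2) ^ 2)) ?_
    exact (((measurable_residualAt_uncurry hm hconvex).sub
      ((measurable_residualAt hm hconvex θ₀).comp measurable_snd)).pow_const 2).ennreal_ofReal
  · exact ((hE.sqrt.max hE).const_mul _).ennreal_ofReal

lemma measurableSet_heldOutFailure (hm : Measurable (Function.uncurry m))
    (hconvex : ConvexLoss m) : MeasurableSet {z : (ι → Obs p 𝒴) × (Fin p → ℝ) |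
      z.1 ∈ heldOutFailure P m θ₀ Cms Cms1 R z.2} := by
  have hE : Measurable fun z : (ι → Obs p 𝒴) × (Fin p → ℝ) => excessRisk P m θ₀ z.2 :=
    (measurable_excessRisk hm P θ₀).comp measurable_snd
  have hi : ∀ i, Measurable fun z : (ι → Obs p 𝒴) × (Fin p → ℝ) => z.1 i := fun i =>
    (measurable_pi_apply i).comp measurable_fst
  refine (measurableSet_lt ?_ ?_).union (measurableSet_lt ?_ ?_)
  · exact (((hE.max (hE.pow_const 2)).const_mul _).const_mul _).const_mul _
  · refine (((Finset.measurable_fun_sum _ fun i _ => ?_).sub (hE.const_mul _)).pow_const 2)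
    exact ((measurable_lossAt_uncurry hm).comp (measurable_snd.prodMk (hi i))).sub
      ((measurable_lossAt hm θ₀).comp (hi i))
  · exact (((hE.sqrt.max hE).const_mul _).const_mul _).const_mul _
  · refine Finset.measurable_fun_sum _ fun i _ => Measurable.pow_const ?_ 2
    exact ((measurable_residualAt_uncurry hm hconvex).comp (measurable_snd.prodMk (hi i))).sub
      ((measurable_residualAt hm hconvex θ₀).comp (hi i))

/-- Chebyshev's inequality for the loss increments and Markov's inequality for the squared residual
errors. -/
lemma measure_heldOutFailure_le (hm : Measurable (Function.uncurry m)) (hconvex : ConvexLoss m)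
    (hint : Integrable (lossAt m θ₀) P) (hR : 0 < R) {θ : Fin p → ℝ}
    (hθ : IsRegularParameter P m θ₀ Cms Cms1 θ) :
    (Measure.pi fun _ : ι => P) (heldOutFailure P m θ₀ Cms Cms1 R θ) ≤
      ENNReal.ofReal (2 / R) := by
  obtain ⟨h0, hL, hU⟩ := hθ
  have hLm : Measurable fun w => lossAt m θ w - lossAt m θ₀ w :=
    (measurable_lossAt hm θ).sub (measurable_lossAt hm θ₀)
  have hUm : Measurable fun w => (residualAt m θ w - residualAt m θ₀ w) ^ 2 :=
    ((measurable_residualAt hm hconvex θ).sub (measurable_residualAt hm hconvex θ₀)).pow_const 2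
  have hLp := memLp_two_of_lintegral_sq_le hLm hL
  have hint' : Integrable (lossAt m θ) P := by
    have h := (hLp.integrable one_le_two).add hint
    refine h.congr (Filter.Eventually.of_forall fun w => ?_)
    simp
  have h1 := measure_sum_sub_sq_gt_le (ι := ι) hLm
    (mul_nonneg (sq_nonneg Cms) (le_max_of_le_left h0)) hR hL
  rw [integral_lossAt_sub hint hint'] at h1
  have h2 : (Measure.pi fun _ : ι => P) {v | R * (Fintype.card ι *
      (Cms1 ^ 2 * max (Real.sqrt (excessRisk P m θ₀ θ)) (excessRisk P m θ₀ θ))) <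
        ∑ i, (residualAt m θ (v i) - residualAt m θ₀ (v i)) ^ 2} ≤ ENNReal.ofReal (1 / R) := by
    have hi : ∀ i : ι, Measurable fun v : ι → Obs p 𝒴 =>
        (residualAt m θ (v i) - residualAt m θ₀ (v i)) ^ 2 := fun i =>
      hUm.comp (measurable_pi_apply i)
    refine measure_mul_lt_le_of_lintegral_le (Finset.measurable_fun_sum _ fun i _ => hi i)
      (mul_nonneg (Nat.cast_nonneg _) (mul_nonneg (sq_nonneg _) (le_max_of_le_right h0))) hR ?_
    simp only [ENNReal.ofReal_sum_of_nonneg fun i _ => sq_nonneg _]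
    rw [lintegral_finsetSum _ fun i _ => (hi i).ennreal_ofReal,
      ENNReal.ofReal_mul (Nat.cast_nonneg _), ENNReal.ofReal_natCast]
    calc _ ≤ ∑ _i : ι, ENNReal.ofReal (Cms1 ^ 2 *
          max (Real.sqrt (excessRisk P m θ₀ θ)) (excessRisk P m θ₀ θ)) := by
          refine Finset.sum_le_sum fun i _ => ?_
          have := (measurePreserving_eval (fun _ : ι => P) i).lintegral_comp hUm.ennreal_ofReal
          exact this.le.trans hU
      _ = _ := by rw [Finset.sum_const, Finset.card_univ, nsmul_eq_mul]
  refine (measure_union_le _ _).trans ((add_le_add h1 h2).trans (le_of_eq ?_))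
  rw [← ENNReal.ofReal_add (by positivity) (by positivity)]
  congr 1
  ring

/-- Conditionally on the training data, an estimator is a fixed parameter, so the held-out data
fail for it with small probability. -/
lemma prod_heldOutFailure_le {κ : Type*} [Fintype κ] (hm : Measurable (Function.uncurry m))
    (hconvex : ConvexLoss m) (hint : Integrable (lossAt m θ₀) P) (hR : 0 < R)
    {g : (κ → Obs p 𝒴) → Fin p → ℝ} (hg : Measurable g)
    (hreg : ∀ᵐ v ∂(Measure.pi fun _ : κ => P), IsRegularParameter P m θ₀ Cms Cms1 (g v)) :
    ((Measure.pi fun _ : ι => P).prod (Measure.pi fun _ : κ => P))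
      {z | z.1 ∈ heldOutFailure P m θ₀ Cms Cms1 R (g z.2)} ≤ ENNReal.ofReal (2 / R) := by
  have hms : MeasurableSet {z : (ι → Obs p 𝒴) × (κ → Obs p 𝒴) |
      z.1 ∈ heldOutFailure P m θ₀ Cms Cms1 R (g z.2)} := by
    have h : Measurable fun z : (ι → Obs p 𝒴) × (κ → Obs p 𝒴) => (z.1, g z.2) :=
      measurable_fst.prodMk (hg.comp measurable_snd)
    exact measurableSet_preimage h
      (measurableSet_heldOutFailure (P := P) (θ₀ := θ₀) (Cms := Cms) (Cms1 := Cms1) (R := R)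
        hm hconvex)
  rw [Measure.prod_apply_symm hms]
  have h2 : ∀ᵐ v ∂(Measure.pi fun _ : κ => P), (Measure.pi fun _ : ι => P)
      ((fun u => (u, v)) ⁻¹' {z : (ι → Obs p 𝒴) × (κ → Obs p 𝒴) |
      z.1 ∈ heldOutFailure P m θ₀ Cms Cms1 R (g z.2)}) ≤ ENNReal.ofReal (2 / R) := by
    filter_upwards [hreg] with v hv
    refine (measure_mono fun u hu => ?_).trans
      (measure_heldOutFailure_le (ι := ι) hm hconvex hint hR hv)
    simpa only [Set.mem_preimage, Set.mem_ofPred_eq] using hu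
  refine (lintegral_mono_ae h2).trans ?_
  simp

end

/-! ### The sample and its cells -/

section
variable {p n K : ℕ} {𝒴 Ω : Type*} [MeasurableSpace 𝒴] [MeasurableSpace Ω] {μ : Measure Ω}
  {P : Measure (Obs p 𝒴)} [IsProbabilityMeasure P] {W : Fin n → Ω → Obs p 𝒴}

/-- The joint law of the observations inside and outside a cell. -/
lemma map_inside_outside [IsProbabilityMeasure μ] (hW : IsSample μ P W) (fold : Fin n → Fin K)
    (k : Fin K) :
    MeasurePreserving (fun ω => ((fun i : {i // fold i = k} => W i.1 ω),
      (fun i : Outside fold k => W i.1 ω))) μ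
      ((Measure.pi fun _ : {i // fold i = k} => P).prod
        (Measure.pi fun _ : Outside fold k => P)) := by
  obtain ⟨hWm, hind, hlaw⟩ := hW
  have h1 : MeasurePreserving (fun ω i => W i ω) μ (Measure.pi fun _ : Fin n => P) := by
    refine ⟨measurable_pi_lambda _ hWm, ?_⟩
    rw [(iIndepFun_iff_map_fun_eq_pi_map fun i => (hWm i).aemeasurable).1 hind]
    simp only [hlaw]
  exact (measurePreserving_piEquivPiSubtypeProd (fun _ : Fin n => P) fun i => fold i = k).comp h1

end

/-! ### Candidate penalties -/

/-- The set of candidate penalties is finite: `a ^ ℓ ≥ c_Λ / n` and `1 / c_Λ ≤ n` leave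
`ℓ ≤ 2 ln n / ln(1/a)`, and `1 / a ≤ n` accounts for the index `ℓ = 0`. -/
lemma exists_finset_candidatePenalties {n : ℕ} {cΛ CΛ a : ℝ} (hn : 3 ≤ n) (hcΛ : 0 < cΛ)
    (ha0 : 0 < a) (ha1 : a < 1) (h5 : 1 / min cΛ a ≤ n) :
    ∃ F : Finset ℝ, (∀ l, l ∈ F ↔ l ∈ candidatePenalties n cΛ CΛ a) ∧
      (F.card : ℝ) ≤ 3 * Real.log n / Real.log (1 / a) := by
  classical
  have hn0 : (0 : ℝ) < n := by exact_mod_cast (by omega : 0 < n)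
  have hla : 0 < Real.log (1 / a) := Real.log_pos ((one_lt_div ha0).2 ha1)
  have hmin : 0 < min cΛ a := lt_min hcΛ ha0
  have hb1 : Real.log (1 / cΛ) ≤ Real.log n :=
    Real.log_le_log (by positivity) ((one_div_le_one_div_of_le hmin (min_le_left _ _)).trans h5)
  have hb2 : Real.log (1 / a) ≤ Real.log n :=
    Real.log_le_log (by positivity) ((one_div_le_one_div_of_le hmin (min_le_right _ _)).trans h5)
  set X := 2 * Real.log n / Real.log (1 / a) with hX
  have hX0 : 0 ≤ X := by
    have : 0 ≤ Real.log n := hla.le.trans hb2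
    positivity
  have hℓ : ∀ ℓ : ℕ, cΛ / n ≤ a ^ ℓ → (ℓ : ℝ) ≤ X := by
    intro ℓ h
    rw [hX, le_div_iff₀ hla]
    have h1 := Real.log_le_log (by positivity) h
    rw [Real.log_div hcΛ.ne' hn0.ne', Real.log_pow] at h1
    rw [one_div, Real.log_inv] at hb1
    rw [one_div, Real.log_inv]
    linarith
  refine ⟨((Finset.range (⌊X⌋₊ + 1)).filter fun ℓ => cΛ / n ≤ a ^ ℓ).image fun ℓ => CΛ * a ^ ℓ,
    fun l => ?_, ?_⟩
  · simp only [Finset.mem_image, Finset.mem_filter, Finset.mem_range, candidatePenalties,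
      Set.mem_ofPred_eq]
    constructor
    · rintro ⟨ℓ, ⟨-, h⟩, rfl⟩
      exact ⟨ℓ, h, rfl⟩
    · rintro ⟨ℓ, h, rfl⟩
      exact ⟨ℓ, ⟨Nat.lt_succ_of_le (Nat.le_floor (hℓ ℓ h)), h⟩, rfl⟩
  · have h1 : (((Finset.range (⌊X⌋₊ + 1)).filter fun ℓ => cΛ / n ≤ a ^ ℓ).image
        fun ℓ => CΛ * a ^ ℓ).card ≤ ⌊X⌋₊ + 1 :=
      Finset.card_image_le.trans ((Finset.card_filter_le _ _).trans (Finset.card_range _).le)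
    have h2 : ((⌊X⌋₊ + 1 : ℕ) : ℝ) ≤ X + 1 := by
      push_cast
      linarith [Nat.floor_le hX0]
    have h3 : 1 ≤ Real.log n / Real.log (1 / a) := (one_le_div hla).2 hb2
    have h4 : X = 2 * (Real.log n / Real.log (1 / a)) := by rw [hX, mul_div_assoc]
    calc _ ≤ ((⌊X⌋₊ + 1 : ℕ) : ℝ) := by exact_mod_cast h1
      _ ≤ 3 * (Real.log n / Real.log (1 / a)) := by linarith
      _ = _ := by rw [mul_div_assoc]

/-- The candidate penalties meet every level between their extremes up to the factor `a`. -/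
lemma exists_candidatePenalty_between {n : ℕ} {cΛ CΛ a u : ℝ} (hCΛ : 0 < CΛ)
    (ha0 : 0 < a) (ha1 : a < 1) (hu : 0 < u) (hlow : CΛ * (cΛ / n) ≤ u) (hup : u ≤ CΛ * a) :
    ∃ l ∈ candidatePenalties n cΛ CΛ a, u ≤ l ∧ l ≤ u / a := by
  have h1 : u / CΛ ≤ 1 := by
    rw [div_le_one hCΛ]
    nlinarith
  obtain ⟨ℓ, h2, h3⟩ := exists_nat_pow_near_of_lt_one (by positivity : 0 < u / CΛ) h1 ha0 ha1
  refine ⟨CΛ * a ^ ℓ, ⟨ℓ, le_trans ?_ h3, rfl⟩, ?_, ?_⟩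
  · rw [le_div_iff₀ hCΛ]; linarith
  · rw [div_le_iff₀ hCΛ] at h3; linarith
  · rw [lt_div_iff₀ hCΛ, pow_succ] at h2
    rw [le_div_iff₀ ha0]; linarith

/-! ### From the cross-validation criterion to the residuals -/

/-- The weighted average of `√e ∨ e` over the cells is small if the weighted average of `e` is
bounded by that of the oracle, up to fluctuations of order `D (√e ∨ e)`. -/
lemma sum_weight_mul_max_le {K : ℕ} {w e e' : Fin K → ℝ} {cD D E : ℝ} (hcD : 0 < cD) (hcD1 : cD < 1)
    (hw : ∀ k, cD ≤ w k) (hw1 : ∑ k, w k = 1) (he : ∀ k, 0 ≤ e k)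
    (he' : ∀ k, 0 ≤ e' k) (heE : ∀ k, e' k ≤ E)
    (hbasic : ∑ k, w k * e k ≤ ∑ k, w k * (e' k + D * max (Real.sqrt (e' k)) (e' k) +
      D * max (Real.sqrt (e k)) (e k)))
    (hsmall : 16 * (D ^ 2 + E / 2) ≤ cD) (hE : 0 ≤ E) :
    ∑ k, w k * max (Real.sqrt (e k)) (e k) ≤ 4 * Real.sqrt ((D ^ 2 + E / 2) / cD) := by
  have hw0 : ∀ k, 0 ≤ w k := fun k => hcD.le.trans (hw k)
  have hD4 : D ≤ 1 / 4 := by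
    refine (abs_le_of_sq_le_sq' ?_ (by norm_num : (0 : ℝ) ≤ 1 / 4)).2
    linarith
  have hfluct : ∀ z, 0 ≤ z → D * max (Real.sqrt z) z ≤ D ^ 2 + z / 4 := by
    intro z hz
    rcases max_cases (Real.sqrt z) z with h | h <;> rw [h.1]
    · nlinarith [Real.sq_sqrt hz, sq_nonneg (D - Real.sqrt z / 2)]
    · nlinarith [sq_nonneg D, mul_le_mul_of_nonneg_right hD4 hz]
  -- a quarter of the left-hand side reappears on the right and is absorbed
  have hsum : ∑ k, w k * e k ≤ 4 * (D ^ 2 + E / 2) := by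
    have h1 : ∑ k, w k * (e' k + D * max (Real.sqrt (e' k)) (e' k) +
        D * max (Real.sqrt (e k)) (e k)) ≤
        ∑ k, (w k * (5 / 4 * E + 2 * D ^ 2) + 1 / 4 * (w k * e k)) := by
      refine Finset.sum_le_sum fun k _ => ?_
      have h2 := hfluct _ (he k)
      have h3 := hfluct _ (he' k)
      have h4 := heE k
      have h5 := mul_le_mul_of_nonneg_left (by linarith : e' k +
        D * max (Real.sqrt (e' k)) (e' k) + D * max (Real.sqrt (e k)) (e k) ≤
          5 / 4 * E + 2 * D ^ 2 + e k / 4) (hw0 k)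
      linarith
    rw [Finset.sum_add_distrib, ← Finset.sum_mul, ← Finset.mul_sum, hw1] at h1
    nlinarith [sq_nonneg D]
  -- every cell has weight at least `cD`, so each `e k` lies in the range where `√e` dominates
  have he1 : ∀ k, e k ≤ 1 := by
    intro k
    have h1 : w k * e k ≤ ∑ k, w k * e k :=
      Finset.single_le_sum (f := fun k => w k * e k) (fun k _ => mul_nonneg (hw0 k) (he k))
        (Finset.mem_univ k)
    have h2 := mul_le_mul_of_nonneg_right (hw k) (he k)
    have h3 : cD * e k ≤ cD * 1 := by linarith
    exact le_of_mul_le_mul_left h3 hcD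
  have hmax : ∀ k, max (Real.sqrt (e k)) (e k) = Real.sqrt (e k) := fun k =>
    max_eq_left (Real.le_sqrt_of_sq_le (by nlinarith [he k, he1 k]))
  have hcs : (∑ k, w k * Real.sqrt (e k)) ^ 2 ≤ ∑ k, w k * e k := by
    have h1 := Finset.sum_mul_sq_le_sq_mul_sq Finset.univ (fun k => Real.sqrt (w k))
      fun k => Real.sqrt (w k) * Real.sqrt (e k)
    have h2 : ∀ k, Real.sqrt (w k) * (Real.sqrt (w k) * Real.sqrt (e k)) =
        w k * Real.sqrt (e k) := fun k => by rw [← mul_assoc, Real.mul_self_sqrt (hw0 k)]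
    simp only [h2, mul_pow, Real.sq_sqrt (hw0 _), Real.sq_sqrt (he _), hw1, one_mul] at h1
    exact h1
  simp only [hmax]
  rw [show (4 : ℝ) = Real.sqrt 16 by
    rw [show (16 : ℝ) = 4 ^ 2 by norm_num, Real.sqrt_sq (by norm_num)],
    ← Real.sqrt_mul (by norm_num)]
  refine Real.le_sqrt_of_sq_le (hcs.trans (hsum.trans ?_))
  have hG : 0 ≤ D ^ 2 + E / 2 := by positivity
  have h1 : D ^ 2 + E / 2 ≤ (D ^ 2 + E / 2) / cD := le_div_self hG hcD hcD1.le
  linarith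

lemma max_self_sq_eq {z : ℝ} (hz : 0 ≤ z) : max z (z ^ 2) = max (Real.sqrt z) z ^ 2 := by
  rcases le_total z 1 with h | h
  · rw [max_eq_left (by nlinarith), max_eq_left (Real.le_sqrt_of_sq_le (by nlinarith)),
      Real.sq_sqrt hz]
  · rw [max_eq_right (by nlinarith), max_eq_right (Real.sqrt_le_iff.2 ⟨hz, by nlinarith⟩)]

section
variable {p n K : ℕ} {𝒴 : Type*} [MeasurableSpace 𝒴] {P : Measure (Obs p 𝒴)} {m : ℝ → 𝒴 → ℝ}
  {θ₀ : Fin p → ℝ}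

/-- Off the failure event, the loss increments on a cell of size at least `b` deviate from their
mean by at most the cell size times `C_ms √(R / b) (√ℰ ∨ ℰ)`. -/
lemma abs_sum_sub_le_of_notMem_heldOutFailure {ι : Type*} [Fintype ι] {Cms Cms1 R b : ℝ}
    (hCms : 0 ≤ Cms) (hR : 0 ≤ R) (hb : 0 < b) (hcard : b ≤ Fintype.card ι) {θ : Fin p → ℝ}
    (hθ : 0 ≤ excessRisk P m θ₀ θ) {v : ι → Obs p 𝒴}
    (hv : v ∉ heldOutFailure P m θ₀ Cms Cms1 R θ) :
    |∑ i, (lossAt m θ (v i) - lossAt m θ₀ (v i)) - Fintype.card ι * excessRisk P m θ₀ θ| ≤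
      Fintype.card ι * (Cms * Real.sqrt (R / b) *
        max (Real.sqrt (excessRisk P m θ₀ θ)) (excessRisk P m θ₀ θ)) := by
  have h1 := (not_or.1 hv).1
  simp only [Set.mem_ofPred_eq, not_lt, max_self_sq_eq hθ] at h1
  set h := max (Real.sqrt (excessRisk P m θ₀ θ)) (excessRisk P m θ₀ θ)
  have hh : 0 ≤ h := le_max_of_le_right hθ
  refine abs_le_of_sq_le_sq (h1.trans ?_) (by positivity)
  rw [mul_pow, mul_pow, mul_pow, Real.sq_sqrt (by positivity)]
  have h2 : R * (Fintype.card ι * (Cms ^ 2 * h ^ 2)) =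
      Fintype.card ι * b * (Cms ^ 2 * (R / b) * h ^ 2) := by field_simp
  rw [h2, sq (Fintype.card ι : ℝ)]
  exact mul_le_mul_of_nonneg_right (mul_le_mul_of_nonneg_left hcard (Nat.cast_nonneg _))
    (by positivity)

/-- The residual bound on a favourable event: the cross-validated penalty does at least as well as
the penalty `l` on the held-out data, and held-out losses and squared residual errors are close to
what the excess risks predict. -/
lemma sum_sq_cvResidual_sub_le {fold : Fin n → Fin K} {cD Cms Cms1 R E : ℝ} (hn : 0 < n)
    (hfold : DataPartition fold cD) (hCms : 0 ≤ Cms) (hR : 0 ≤ R) (hE : 0 ≤ E)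
    {est : SubsampleEstimator fold p 𝒴} {d : Fin n → Obs p 𝒴} {lcv l : ℝ}
    (hcv : cvCriterion m est d lcv ≤ cvCriterion m est d l)
    (h0 : ∀ k, 0 ≤ excessRisk P m θ₀ (subsampleEstimate est d k lcv))
    (h0' : ∀ k, 0 ≤ excessRisk P m θ₀ (subsampleEstimate est d k l))
    (hlE : ∀ k, excessRisk P m θ₀ (subsampleEstimate est d k l) ≤ E)
    (hheld : ∀ k, (fun i : {i // fold i = k} => d i.1) ∉
      heldOutFailure P m θ₀ Cms Cms1 R (subsampleEstimate est d k lcv))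
    (hheld' : ∀ k, (fun i : {i // fold i = k} => d i.1) ∉
      heldOutFailure P m θ₀ Cms Cms1 R (subsampleEstimate est d k l))
    (hsmall : 16 * (Cms ^ 2 * (R / (cD * n)) + E / 2) ≤ cD) :
    (n : ℝ)⁻¹ * ∑ i, (cvResidual m est d lcv i - residualAt m θ₀ (d i)) ^ 2 ≤
      4 * R * Cms1 ^ 2 * Real.sqrt ((Cms ^ 2 * (R / (cD * n)) + E / 2) / cD) := by
  obtain ⟨-, hcD, hcD1, hcells⟩ := hfold
  have hn0 : (0 : ℝ) < n := by exact_mod_cast hn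
  set N : Fin K → ℝ := fun k => (Fintype.card {i // fold i = k} : ℝ) with hN
  have hNlow : ∀ k, cD * n ≤ N k := fun k => by
    rw [hN]
    simpa only [Fintype.card_subtype] using hcells k
  have hNsum : ∑ k, N k = n := by
    have h1 := Fintype.sum_fiberwise fold fun _ => (1 : ℝ)
    simpa [hN] using h1
  set D := Cms * Real.sqrt (R / (cD * n)) with hD
  have hDsq : D ^ 2 = Cms ^ 2 * (R / (cD * n)) := by
    rw [hD, mul_pow, Real.sq_sqrt (by positivity)]
  set e := fun k => excessRisk P m θ₀ (subsampleEstimate est d k lcv) with he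
  set e' := fun k => excessRisk P m θ₀ (subsampleEstimate est d k l) with he'
  set A := fun k => ∑ i : {i // fold i = k},
    (lossAt m (subsampleEstimate est d k lcv) (d i.1) - lossAt m θ₀ (d i.1)) with hA
  set A' := fun k => ∑ i : {i // fold i = k},
    (lossAt m (subsampleEstimate est d k l) (d i.1) - lossAt m θ₀ (d i.1)) with hA'
  have hsub : ∀ (k : Fin K) (f : Fin n → ℝ),
      ∑ i ∈ Finset.univ.filter (fun i => fold i = k), f i = ∑ i : {i // fold i = k}, f i.1 :=
    fun k f => Finset.sum_subtype _ (by simp) f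
  have hAA' : ∑ k, A k ≤ ∑ k, A' k := by
    simp only [cvCriterion, hsub] at hcv
    simp only [hA, hA', Finset.sum_sub_distrib]
    linarith
  have hAe : ∀ k, |A k - N k * e k| ≤ N k * (D * max (Real.sqrt (e k)) (e k)) := fun k =>
    abs_sum_sub_le_of_notMem_heldOutFailure hCms hR (by positivity) (hNlow k) (h0 k) (hheld k)
  have hAe' : ∀ k, |A' k - N k * e' k| ≤ N k * (D * max (Real.sqrt (e' k)) (e' k)) := fun k =>
    abs_sum_sub_le_of_notMem_heldOutFailure hCms hR (by positivity) (hNlow k) (h0' k) (hheld' k)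
  have hbasic : ∑ k, N k * e k ≤ ∑ k, N k * (e' k + D * max (Real.sqrt (e' k)) (e' k) +
      D * max (Real.sqrt (e k)) (e k)) := by
    have h1 : ∑ k, N k * e k ≤ ∑ k, (A k + N k * (D * max (Real.sqrt (e k)) (e k))) :=
      Finset.sum_le_sum fun k _ => by linarith [neg_le_of_abs_le (hAe k)]
    have h2 : ∑ k, A' k ≤ ∑ k, (N k * e' k + N k * (D * max (Real.sqrt (e' k)) (e' k))) :=
      Finset.sum_le_sum fun k _ => by linarith [le_of_abs_le (hAe' k)]
    simp only [mul_add, Finset.sum_add_distrib] at h1 h2 ⊢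
    linarith
  have hscale : ∀ f : Fin K → ℝ, ∑ k, N k / n * f k = (∑ k, N k * f k) / n := fun f => by
    rw [Finset.sum_div]
    exact Finset.sum_congr rfl fun k _ => by ring
  have hmain := sum_weight_mul_max_le (w := fun k => N k / n) (D := D) hcD hcD1
    (fun k => (le_div_iff₀ hn0).2 (hNlow k)) (by rw [← Finset.sum_div, hNsum, div_self hn0.ne'])
    h0 h0' hlE (by
      rw [hscale, hscale]
      exact div_le_div_of_nonneg_right hbasic hn0.le) (by rw [hDsq]; exact hsmall) hE
  rw [hscale, hDsq] at hmain
  have hres : ∑ i, (cvResidual m est d lcv i - residualAt m θ₀ (d i)) ^ 2 ≤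
      R * Cms1 ^ 2 * ∑ k, N k * max (Real.sqrt (e k)) (e k) := by
    rw [← Fintype.sum_fiberwise fold, Finset.mul_sum]
    refine Finset.sum_le_sum fun k _ => ?_
    have h1 := (not_or.1 (hheld k)).2
    simp only [Set.mem_ofPred_eq, not_lt] at h1
    refine le_trans (le_of_eq ?_) (h1.trans (le_of_eq ?_))
    · refine Finset.sum_congr rfl fun i _ => ?_
      obtain ⟨i, rfl⟩ := i
      rfl
    · ring
  calc _ ≤ (n : ℝ)⁻¹ * (R * Cms1 ^ 2 * ∑ k, N k * max (Real.sqrt (e k)) (e k)) :=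
        mul_le_mul_of_nonneg_left hres (by positivity)
    _ = R * Cms1 ^ 2 * ((∑ k, N k * max (Real.sqrt (e k)) (e k)) / n) := by ring
    _ ≤ R * Cms1 ^ 2 * (4 * Real.sqrt ((Cms ^ 2 * (R / (cD * n)) + E / 2) / cD)) :=
        mul_le_mul_of_nonneg_left hmain (by positivity)
    _ = _ := by ring

end

/-! ### Probability of the favourable event -/

lemma measure_le_of_measurePreserving {α β : Type*} [MeasurableSpace α] [MeasurableSpace β]
    {μ : Measure α} {ν : Measure β} {f : α → β} (hf : MeasurePreserving f μ ν) (S : Set β) :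
    μ (f ⁻¹' S) ≤ ν S := by
  have := Measure.le_map_apply (μ := μ) hf.measurable.aemeasurable S
  rwa [hf.map_eq] at this

lemma measure_compl_le_of_one_sub_le {Ω : Type*} [MeasurableSpace Ω] {μ : Measure Ω}
    [IsProbabilityMeasure μ] {S : Set Ω} (hS : MeasurableSet S) {ζ : ℝ} (h : 1 - ζ ≤ μ.real S) :
    μ Sᶜ ≤ ENNReal.ofReal ζ := by
  rw [← ofReal_measureReal, probReal_compl_eq_one_sub hS]
  exact ENNReal.ofReal_le_ofReal (by linarith)

lemma one_sub_le_measureReal {Ω : Type*} [MeasurableSpace Ω] {μ : Measure Ω}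
    [IsProbabilityMeasure μ] {S : Set Ω} {b : ℝ} (hb : 0 ≤ b) (h : μ Sᶜ ≤ ENNReal.ofReal b) :
    1 - b ≤ μ.real S := by
  have h1 : (1 : ENNReal) ≤ μ S + μ Sᶜ := by
    rw [← measure_univ (μ := μ), ← Set.union_compl_self S]
    exact measure_union_le _ _
  have h2 : (1 : ENNReal) ≤ ENNReal.ofReal (μ.real S + b) := by
    rw [ENNReal.ofReal_add measureReal_nonneg hb, ofReal_measureReal]
    exact h1.trans (add_le_add_right h _)
  have h3 := ENNReal.one_le_ofReal.1 h2
  linarith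

/-- The cells other than `I_k` contain at least `(K - 1) c_D n` indices. -/
lemma card_outside_ge {n K : ℕ} {fold : Fin n → Fin K} {cD : ℝ} (hfold : DataPartition fold cD)
    (k : Fin K) : ((K : ℝ) - 1) * cD * n ≤ Fintype.card (Outside fold k) := by
  obtain ⟨-, -, -, hcells⟩ := hfold
  have h1 : ∑ j, ((Finset.univ.filter fun i => fold i = j).card : ℝ) = n := by
    have := Fintype.sum_fiberwise fold fun _ => (1 : ℝ)
    simpa [Fintype.card_subtype] using this
  have h2 : (Fintype.card (Outside fold k) : ℝ) +
      ((Finset.univ.filter fun i => fold i = k).card : ℝ) = n := by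
    have := Fintype.card_subtype_compl fun i => fold i = k
    have h3 := Fintype.card_subtype_le fun i => fold i = k
    rw [← Fintype.card_subtype fun i => fold i = k, ← Nat.cast_add]
    rw [Fintype.card_fin] at this h3
    have h4 : Fintype.card (Outside fold k) = n - Fintype.card {i // fold i = k} := this
    rw [h4, Nat.sub_add_cancel h3]
  have h3 : ∑ j ∈ Finset.univ.erase k, ((Finset.univ.filter fun i => fold i = j).card : ℝ) =
      Fintype.card (Outside fold k) := by
    have := Finset.sum_erase_add Finset.univ
      (fun j => ((Finset.univ.filter fun i => fold i = j).card : ℝ)) (Finset.mem_univ k)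
    linarith
  rw [← h3]
  have h4 : ∑ _j ∈ Finset.univ.erase k, cD * (n : ℝ) = ((K : ℝ) - 1) * cD * n := by
    rw [Finset.sum_const, Finset.card_erase_of_mem (Finset.mem_univ k), Finset.card_univ,
      Fintype.card_fin, nsmul_eq_mul, Nat.cast_sub (by have := k.pos; omega)]
    push_cast; ring
  rw [← h4]
  exact Finset.sum_le_sum fun j _ => hcells j

lemma isRegularParameter_of_mem {p : ℕ} {𝒴 : Type*} [MeasurableSpace 𝒴] {P : Measure (Obs p 𝒴)}
    {m : ℝ → 𝒴 → ℝ} {Θ : Set (Fin p → ℝ)} {θ₀ θ : Fin p → ℝ} {σ Cms Cms1 : ℝ}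
    (htarget : IsTarget P m Θ θ₀) (hres : ResidualCV P m Θ θ₀ σ Cms1)
    (hglobal : GlobalLoss P m Θ θ₀ Cms) (hθ : θ ∈ Θ) : IsRegularParameter P m θ₀ Cms Cms1 θ :=
  ⟨sub_nonneg.2 (htarget.2 θ hθ), hglobal.2 θ hθ, hres.2.2.2 θ hθ⟩

end CVResidual

theorem theorem4 {𝒴 Ω : Type*} [MeasurableSpace 𝒴] [MeasurableSpace Ω]
    (n p s K : ℕ) (hn : 3 ≤ n) (hp : 2 ≤ p)
    -- the model
    (P : Measure (Obs p 𝒴)) [IsProbabilityMeasure P]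
    (m : ℝ → 𝒴 → ℝ) (hm : Measurable (Function.uncurry m))
    (Θ : Set (Fin p → ℝ)) (θ₀ : Fin p → ℝ) (hs : s = sparsity θ₀) (hs1 : 1 ≤ s)
    (htarget : IsTarget P m Θ θ₀)
    -- the sample
    (μ : Measure Ω) [IsProbabilityMeasure μ]
    (W : Fin n → Ω → Obs p 𝒴) (hW : IsSample μ P W)
    -- the constants
    (c₀ cM cM' ζ B CX cL CL cD cΛ CΛ a σ Cms1 Cms : ℝ) (hc₀ : 1 < c₀)
    -- the assumptions on the model
    (hparam : ParameterSpace Θ θ₀)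
    (hconvex : ConvexLoss m)
    (hdiff : DifferentiableIntegrable P m Θ)
    (hmargin : Margin P m Θ θ₀ cM cM')
    (hcov : Covariates μ W ζ B CX)
    (hlocal : LocalLoss P m Θ θ₀ cL CL)
    (hres : ResidualCV P m Θ θ₀ σ Cms1)
    (hglobal : GlobalLoss P m Θ θ₀ Cms)
    -- the data partition and the candidate penalties
    (fold : Fin n → Fin K) (hfold : DataPartition fold cD)
    (hcΛ : 0 < cΛ) (hCΛ : 0 < CΛ) (ha0 : 0 < a) (ha1 : a < 1)
    -- the subsample estimators and the cross-validated penalty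
    (est : SubsampleEstimator fold p 𝒴)
    (hest : IsSubsampleMEstimator μ W m Θ (candidatePenalties n cΛ CΛ a) est)
    (lcv : Ω → ℝ) (hlcv : IsCVPenalty μ W m (candidatePenalties n cΛ CΛ a) est lcv)
    -- the side conditions
    (h1 : 16 * ((K : ℝ) - 1) * cD * CL ^ 2 / Ceps c₀ CL CX ^ 2 ≤ s * Real.log (p * n))
    (h2 : (1 + cbar c₀) * utilde n p s K c₀ cM CL CX cD σ a * Real.sqrt s ≤ min (cL / B) cM')
    (h3 : Real.log (p * n) / n ≤ (CΛ * a / (c₀ * CS K cD CX σ)) ^ 2)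
    (h4 : (CΛ * cΛ / (c₀ * CS K cD CX σ)) ^ 2 ≤ n * Real.log (p * n))
    (h5 : 1 / min cΛ a ≤ n)
    (t : ℝ) (ht : 0 < t)
    (h6 : 48 * Cms ^ 2 / (cD ^ 2 * Real.log (1 / a)) * (t * Real.log n / n)
        + 8 * Crisk K c₀ cM CL CX cD σ a ^ 2 / cD * (s * Real.log (p * n) / n) ≤ 1) :
    1 - K * (5 / n + 9 * ζ + 1 / (((K : ℝ) - 1) * cD * n) + 2 / t)
      ≤ μ.real {ω | (n : ℝ)⁻¹ * ∑ i, (cvResidual m est (fun j => W j ω) (lcv ω) i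
              - residualAt m θ₀ (W i ω)) ^ 2
          ≤ 12 * Cms1 ^ 2 * t * Real.log n / Real.log (1 / a)
            * Real.sqrt (3 * Cms ^ 2 / (cD ^ 2 * Real.log (1 / a)) * (t * Real.log n / n)
              + Crisk K c₀ cM CL CX cD σ a ^ 2 / (2 * cD) * (s * Real.log (p * n) / n))} := by
  obtain ⟨hK, hcD, hcD1, hcells⟩ := id hfold
  obtain ⟨hζ, hB, hCX, hcovB, hcovX⟩ := hcov
  have hσ : 0 < σ := hres.1
  have hCms : 0 < Cms := hglobal.1
  have hn' : (3 : ℝ) ≤ n := by exact_mod_cast hn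
  have hn0 : (0 : ℝ) < n := by linarith
  have hp' : (2 : ℝ) ≤ p := by exact_mod_cast hp
  have hK' : (2 : ℝ) ≤ K := by exact_mod_cast hK
  have hq0 : 0 < ((K : ℝ) - 1) * cD := mul_pos (by linarith) hcD
  have hlg : 0 < Real.log (p * n) := Real.log_pos (by nlinarith)
  have hln : 0 < Real.log n := Real.log_pos (by linarith)
  have hla : 0 < Real.log (1 / a) := Real.log_pos ((one_lt_div ha0).2 ha1)
  have hWm := hW.1
  -- `R` bounds the number of candidate penalties times `t`
  set R : ℝ := 3 * Real.log n / Real.log (1 / a) * t with hRdef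
  have hR : 0 < R := by positivity
  set E : ℝ := Crisk K c₀ cM CL CX cD σ a ^ 2 * (s * Real.log (p * n) / n) with hEdef
  have hE : 0 ≤ E := by positivity
  obtain ⟨F, hF, hFcard⟩ := exists_finset_candidatePenalties (CΛ := CΛ) hn hcΛ ha0 ha1 h5
  -- the oracle penalty, within a factor `a` of `c₀` times the level of the score
  set lo := c₀ * CS K cD CX σ * Real.sqrt (Real.log (p * n) / n) with hlo
  have hcS : 0 < c₀ * CS K cD CX σ := mul_pos (by linarith) (CS_pos hK hcD hCX hσ)
  have hlo0 : 0 < lo := mul_pos hcS (Real.sqrt_pos.2 (by positivity))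
  obtain ⟨l, hlΛ, hl1, hl2⟩ : ∃ l ∈ candidatePenalties n cΛ CΛ a, lo ≤ l ∧ l ≤ lo / a := by
    refine exists_candidatePenalty_between hCΛ ha0 ha1 hlo0 ?_ ?_
    · have e1 : CΛ * cΛ / (c₀ * CS K cD CX σ) ≤ Real.sqrt (n * Real.log (p * n)) :=
        Real.le_sqrt_of_sq_le h4
      rw [div_le_iff₀ hcS] at e1
      have e2 : Real.sqrt (n * Real.log (p * n)) = n * Real.sqrt (Real.log (p * n) / n) := by
        have e3 : n * Real.log (p * n) = (n : ℝ) ^ 2 * (Real.log (p * n) / n) := by field_simp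
        rw [e3, Real.sqrt_mul (by positivity), Real.sqrt_sq hn0.le]
      rw [e2] at e1
      rw [← mul_div_assoc, div_le_iff₀ hn0, hlo]
      linarith
    · have e1 : Real.sqrt (Real.log (p * n) / n) ≤ CΛ * a / (c₀ * CS K cD CX σ) :=
        Real.sqrt_le_iff.2 ⟨by positivity, h3⟩
      rw [le_div_iff₀ hcS] at e1
      rw [hlo]
      linarith
  -- the exceptional events of each cell
  set bad1 : Fin K → Set Ω := fun k => {ω | ¬ ∀ l θ, lo ≤ l → l ≤ lo / a →
    IsPenalizedMinimizer m Θ (fun i : Outside fold k => W i.1 ω) l θ →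
      excessRisk P m θ₀ θ ≤ E} with hbad1
  set bad2 : Fin K → ℝ → Set Ω := fun k l => {ω | (fun i : {i // fold i = k} => W i.1 ω) ∈
    heldOutFailure P m θ₀ Cms Cms1 R (subsampleEstimate est (fun i => W i ω) k l)} with hbad2
  have hbad1_le : ∀ k, μ (bad1 k) ≤
      ENNReal.ofReal (5 / n + 9 * ζ + 1 / (((K : ℝ) - 1) * cD * n)) := by
    intro k
    have hmp : MeasurePreserving (fun ω (i : Outside fold k) => W i.1 ω) μ
        (Measure.pi fun _ : Outside fold k => P) :=
      measurePreserving_snd.comp (map_inside_outside hW fold k)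
    have hcard := card_outside_ge hfold k
    have hne : Nonempty (Outside fold k) := by
      rw [← Fintype.card_pos_iff]
      have : (0 : ℝ) < Fintype.card (Outside fold k) := lt_of_lt_of_le (by positivity) hcard
      exact_mod_cast this
    have hcardn : Fintype.card (Outside fold k) ≤ n :=
      (Fintype.card_subtype_le _).trans (Fintype.card_fin n).le
    have hmX : ∀ (i : Fin n) (j : Fin p), Measurable fun ω => (W i ω).1 j := fun i j =>
      (measurable_pi_apply j).comp (measurable_fst.comp (hWm i))
    have hmx : ∀ (i : Outside fold k) (j : Fin p),
        Measurable fun v : Outside fold k → Obs p 𝒴 => (v i).1 j := fun i j =>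
      (measurable_pi_apply j).comp (measurable_fst.comp (measurable_pi_apply i))
    have hbdd : (Measure.pi fun _ : Outside fold k => P) {v | ¬ ∀ i j, |(v i).1 j| ≤ B} ≤
        ENNReal.ofReal ζ := by
      have hms : MeasurableSet {v : Outside fold k → Obs p 𝒴 | ¬ ∀ i j, |(v i).1 j| ≤ B} := by
        have hpos : MeasurableSet {v : Outside fold k → Obs p 𝒴 | ∀ i j, |(v i).1 j| ≤ B} := by
          simp only [Set.ofPred_forall]
          exact MeasurableSet.iInter fun i => MeasurableSet.iInter fun j =>
            measurableSet_le (hmx i j).abs measurable_const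
        exact hpos.compl
      rw [← hmp.measure_preimage hms.nullMeasurableSet]
      refine (measure_mono ?_).trans (measure_compl_le_of_one_sub_le ?_ hcovB)
      · intro ω hω hcon
        exact hω fun i j => hcon i.1 j
      · simp only [Set.ofPred_forall]
        exact MeasurableSet.iInter fun i => MeasurableSet.iInter fun j =>
          measurableSet_le (hmX i j).abs measurable_const
    have hfour : (Measure.pi fun _ : Outside fold k => P)
        {v | ¬ ∀ j, ∑ i, (v i).1 j ^ 4 ≤ n * CX ^ 4} ≤ ENNReal.ofReal ζ := by
      have hms : MeasurableSet {v : Outside fold k → Obs p 𝒴 |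
          ¬ ∀ j, ∑ i, (v i).1 j ^ 4 ≤ n * CX ^ 4} := by
        have hpos : MeasurableSet {v : Outside fold k → Obs p 𝒴 |
            ∀ j, ∑ i, (v i).1 j ^ 4 ≤ n * CX ^ 4} := by
          simp only [Set.ofPred_forall]
          exact MeasurableSet.iInter fun j => measurableSet_le
            (Finset.measurable_fun_sum _ fun i _ => (hmx i j).pow_const 4) measurable_const
        exact hpos.compl
      rw [← hmp.measure_preimage hms.nullMeasurableSet]
      refine (measure_mono ?_).trans (measure_compl_le_of_one_sub_le ?_ hcovX)
      · intro ω hω hcon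
        refine hω fun j => le_trans ?_ (hcon j)
        have := Fintype.sum_subtype_add_sum_subtype (fun i => fold i = k) fun i => (W i ω).1 j ^ 4
        have hnn : 0 ≤ ∑ i : {i // fold i = k}, (W i.1 ω).1 j ^ 4 :=
          Finset.sum_nonneg fun i _ => by positivity
        rw [← this]
        exact le_add_of_nonneg_left hnn
      · simp only [Set.ofPred_forall]
        exact MeasurableSet.iInter fun j => measurableSet_le
          (Finset.measurable_fun_sum _ fun i _ => (hmX i j).pow_const 4) measurable_const
    exact (measure_le_of_measurePreserving hmp _).trans
      (measure_not_oracle_bound_le hn hp hm hs hs1 htarget.1 hc₀ hparam.1 hconvex hdiff hmargin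
        hζ hB hCX hlocal hres hK hcD ha0 hcardn hcard hbdd hfour h1 h2)
  -- membership in `Θ` need not be a measurable condition, but regularity is, so that it passes from
  -- the sample to the law of the observations outside the cell
  have hbad2_le : ∀ k, ∀ l ∈ F, μ (bad2 k l) ≤ ENNReal.ofReal (2 / R) := by
    intro k l hl
    have hmp := map_inside_outside hW fold k
    have hmo : MeasurePreserving (fun ω (i : Outside fold k) => W i.1 ω) μ
        (Measure.pi fun _ : Outside fold k => P) := measurePreserving_snd.comp hmp
    obtain ⟨hg, hmin⟩ := hest k l ((hF l).1 hl)
    have hreg : ∀ᵐ v ∂(Measure.pi fun _ : Outside fold k => P),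
        IsRegularParameter P m θ₀ Cms Cms1 (est k l v) := by
      have hms : MeasurableSet {v | IsRegularParameter P m θ₀ Cms Cms1 (est k l v)} :=
        measurableSet_preimage hg (measurableSet_isRegularParameter hm hconvex)
      rw [← hmo.map_eq]
      refine (ae_map_iff hmo.measurable.aemeasurable hms).2 ?_
      filter_upwards [hmin] with ω hω
      exact isRegularParameter_of_mem htarget hres hglobal hω.1
    refine le_trans ?_ (prod_heldOutFailure_le (ι := {i // fold i = k}) hm hconvex
      (hdiff θ₀ htarget.1).2 hR hg hreg)
    exact measure_le_of_measurePreserving hmp {z | z.1 ∈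
      heldOutFailure P m θ₀ Cms Cms1 R (est k l z.2)}
  have hbad_le : μ (⋃ k, (bad1 k ∪ ⋃ l ∈ F, bad2 k l)) ≤
      ENNReal.ofReal (K * (5 / n + 9 * ζ + 1 / (((K : ℝ) - 1) * cD * n) + 2 / t)) := by
    have hFR : (F.card : ℝ) * (2 / R) ≤ 2 / t := by
      have e1 : (F.card : ℝ) * t ≤ R := mul_le_mul_of_nonneg_right hFcard ht.le
      rw [mul_div_assoc', div_le_div_iff₀ hR ht]
      linarith
    calc μ (⋃ k, (bad1 k ∪ ⋃ l ∈ F, bad2 k l))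
        ≤ ∑ k, μ (bad1 k ∪ ⋃ l ∈ F, bad2 k l) := measure_iUnion_fintype_le _ _
      _ ≤ ∑ _k : Fin K, (ENNReal.ofReal (5 / n + 9 * ζ + 1 / (((K : ℝ) - 1) * cD * n)) +
            ENNReal.ofReal (2 / t)) := by
          refine Finset.sum_le_sum fun k _ => (measure_union_le _ _).trans
            (add_le_add (hbad1_le k) ((measure_biUnion_finset_le _ _).trans ?_))
          refine (Finset.sum_le_sum fun l hl => hbad2_le k l hl).trans ?_
          rw [Finset.sum_const, nsmul_eq_mul, ← ENNReal.ofReal_natCast,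
            ← ENNReal.ofReal_mul (Nat.cast_nonneg _)]
          exact ENNReal.ofReal_le_ofReal hFR
      _ = _ := by
          rw [← ENNReal.ofReal_add (by positivity) (by positivity), Finset.sum_const,
            Finset.card_univ, Fintype.card_fin, nsmul_eq_mul,
            ENNReal.ofReal_mul (Nat.cast_nonneg _), ENNReal.ofReal_natCast]
  have hae : ∀ᵐ ω ∂μ, (lcv ω ∈ candidatePenalties n cΛ CΛ a ∧
      ∀ l ∈ candidatePenalties n cΛ CΛ a,
        cvCriterion m est (fun i => W i ω) (lcv ω) ≤ cvCriterion m est (fun i => W i ω) l) ∧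
      ∀ k, ∀ l ∈ F, IsPenalizedMinimizer m Θ (fun i : Outside fold k => W i.1 ω) l
        (subsampleEstimate est (fun i => W i ω) k l) := by
    refine hlcv.2.and (ae_all_iff.2 fun k => (Finset.eventually_all F).2 fun l hl => ?_)
    exact (hest k l ((hF l).1 hl)).2
  refine one_sub_le_measureReal (by positivity) ?_
  refine le_trans (measure_mono_ae ?_) hbad_le
  filter_upwards [hae] with ω hω hbad
  by_contra hgood
  refine hbad ?_
  change ω ∉ ⋃ k, (bad1 k ∪ ⋃ l ∈ F, bad2 k l) at hgood
  simp only [Set.mem_iUnion, Set.mem_union, not_exists, not_or] at hgood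
  obtain ⟨⟨hlcvΛ, hopt⟩, hmin⟩ := hω
  have hlF := (hF l).2 hlΛ
  have hlcvF := (hF _).2 hlcvΛ
  have hA : Cms ^ 2 * (R / (cD * n)) + E / 2 = cD *
      (3 * Cms ^ 2 / (cD ^ 2 * Real.log (1 / a)) * (t * Real.log n / n)
        + Crisk K c₀ cM CL CX cD σ a ^ 2 / (2 * cD) * (s * Real.log (p * n) / n)) := by
    rw [hRdef, hEdef]; field_simp
  have hbound := sum_sq_cvResidual_sub_le (P := P) (m := m) (θ₀ := θ₀) (Cms := Cms) (Cms1 := Cms1)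
    (R := R) (E := E) (est := est) (d := fun i => W i ω) (by omega) hfold hCms.le hR.le hE
    (hopt l hlΛ)
    (fun k => (isRegularParameter_of_mem htarget hres hglobal (hmin k _ hlcvF).1).1)
    (fun k => (isRegularParameter_of_mem htarget hres hglobal (hmin k _ hlF).1).1)
    (fun k => not_not.1 (hgood k).1 l _ hl1 hl2 (hmin k _ hlF))
    (fun k => (hgood k).2 _ hlcvF) (fun k => (hgood k).2 _ hlF) (by
      rw [hA]
      refine le_trans (le_of_eq ?_) (mul_le_of_le_one_right hcD.le h6)
      ring)
  refine hbound.trans (le_of_eq ?_)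
  rw [hA, mul_div_cancel_left₀ _ hcD.ne', hRdef]
  ring
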